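/- Let $n\ge 2$, $G=\mathrm{SO}_0(n+1,1)$ (identity component of the group preserving $x_1^2+\dots+x_{n+1}^2-x_{n+2}^2$), $H_0=E_{n+1,n+2}+E_{n+2,n+1}$, $N_j=E_{j,n+1}-E_{j,n+2}-E_{n+1,j}-E_{n+2,j}$, $\overline N_j=E_{j,n+1}+E_{j,n+2}-E_{n+1,j}+E_{n+2,j}$ $(1\le j\le n)$, $\overline n_x=\exp(\sum_j x_j\overline N_j)$, $M=\{\mathrm{diag}(A,1,1):A\in \mathrm{SO}(n)\}$, $A=\exp(\mathbb RH_0)$, $N=\exp(\mathrm{span}\{N_j\})$, $\rho=\frac n2$. Let $(\sigma,V_\sigma)$ be an irreducible unitary representation of $M\cong\mathrm{SO}(n)$ and $\lambda\in\mathbb C$. Let $\tilde I_{\sigma,\lambda}$ be the space of all $F\in C^\infty(G,V_\sigma)$ with $F(gm e^{tH_0}u)=e^{-(\lambda+\rho)t}\sigma(m)^{-1}F(g)$ for $g\in G$, $m\in M$, $t\in\mathbb R$, $u\in N$, with the left regular representation, whose derived representation is $(d\tilde\pi(X)F)(g)=\frac{d}{dt}\big|_{t=0}F(\exp(-tX)g)$.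 For $F\in\tilde I_{\sigma,\lambda}$ let $\widehat F$ be the restriction to $\mathbb R^n\setminus\{0\}$ of the (distributional) Fourier transform, normalized by $(2\pi)^{-n/2}\int e^{-i\langle x,\xi\rangle}(\cdot)\,dx$, of the tempered function $x\mapsto F(\overline n_x)$; it is a smooth function on $\mathbb R^n\setminus\{0\}$. Let $\widehat I_{\sigma,\lambda}=\{\widehat F: F\in\tilde I_{\sigma,\lambda}\}$, with the Lie algebra action $d\widehat\pi_{\sigma,\lambda}(X)\widehat F=\widehat{d\tilde\pi(X)F}$. Let $M_{e_1}\cong\mathrm{SO}(n-1)$ be the stabilizer of $e_1$ in $M$, let $m=\lfloor\frac{n+1}2\rfloor$, so that $M_{e_1}$ has rank $m-1$, and for $\tau\in\mathbb Z^{m-1}$ let $W_\tau\subseteq V_\sigma$ be the $M_{e_1}$-subrepresentation of highest weight $\tau$ (with $W_\tau=0$ if $\tau$ is not a highest weight occurring in $\sigma|_{M_{e_1}}$). For $\xi\ne0$ put $W_\tau(\xi)=\sigma(m_\xi)W_\tau$, where $m_\xi\in M$ satisfies $\|\xi\|m_\xi e_1=\xi$; then $V_\sigma=\bigoplus_\tau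 W_\tau(\xi)$ is an orthogonal decomposition. Let $\widehat I_{\sigma,\lambda}(\tau)$ be the space of all $f\in\widehat I_{\sigma,\lambda}$ with $f(\xi)\in W_\tau(\xi)$ for all $\xi\neq 0$, and for a $V_\sigma$-valued function $h$ on $\mathbb R^n\setminus\{0\}$ let $(\mathrm{pr}_\tau h)(\xi)$ be the projection of $h(\xi)$ to $W_\tau(\xi)$. Write $e_i$ also for the standard basis of $\mathbb Z^{m-1}$. **Proposition.** Let $f\in\widehat I_{\sigma,\lambda}(\tau)$ and $1\le j\le n$. Then $d\widehat\pi_{\sigma,\lambda}(N_j)f\in\widehat I_{\sigma,\lambda}$ is well defined, for every $\xi\in\mathbb R^n\setminus\{0\}$ $$\big(d\widehat\pi_{\sigma,\lambda}(N_j)f\big)(\xi)\in W_\tau(\xi)\oplus\bigoplus_{i=1}^{m-1}\big(W_{\tau+e_i}(\xi)\oplus W_{\tau-e_i}(\xi)\big),$$ and for $1\le i\le m-1$ and both choices of the sign $$\mathrm{pr}_{\tau\pm e_i}\big(d\widehat\pi_{\sigma,\lambda}(N_j)f\big)=-i\Big(2\lambda+1\pm2\big(\tau_i+\tfrac{n-2i-1}2\big)\Big)\,\mathrm{pr}_{\tau\pm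 e_i}(\partial_jf),$$ where the factor $-i$ outside the bracket is minus the imaginary unit. -/

import Mathlib

open scoped ContDiff

namespace FPicture

/-! ### The group `G = SO₀(n+1,1)` -/

/-- Real `(n+2) × (n+2)` matrices. The rows and columns `1, …, n` are indexed by `Fin n`, the rows
and columns `n+1` and `n+2` by `0 1 : Fin 2`. -/
abbrev Mat (n : ℕ) : Type := Matrix (Fin n ⊕ Fin 2) (Fin n ⊕ Fin 2) ℝ

/-- `ℝⁿ` with the Euclidean norm. -/
abbrev E (n : ℕ) : Type := EuclideanSpace ℝ (Fin n)

/-- `SO(n)`. -/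
abbrev SO (n : ℕ) : Type := Matrix.specialOrthogonalGroup (Fin n) ℝ

/-- The matrix `diag(1, …, 1, -1)` of the quadratic form. -/
def form (n : ℕ) : Mat n := Matrix.diagonal (Sum.elim (fun _ => 1) ![1, -1])

/-- `O(n+1,1)`: the matrices that leave the quadratic form invariant. -/
def indefO (n : ℕ) : Set (Mat n) := {g | g.transpose * form n * g = form n}

/-- `G = SO₀(n+1,1)`: the identity component of `O(n+1,1)`. -/
noncomputable def G (n : ℕ) : Set (Mat n) := connectedComponentIn (indefO n) 1

/-- `H₀ = E_{n+1,n+2} + E_{n+2,n+1}`. -/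
def H₀ (n : ℕ) : Mat n :=
  Matrix.single (Sum.inr 0) (Sum.inr 1) 1 + Matrix.single (Sum.inr 1) (Sum.inr 0) 1

/-- `N_j = E_{j,n+1} - E_{j,n+2} - E_{n+1,j} - E_{n+2,j}`. -/
def N {n : ℕ} (j : Fin n) : Mat n :=
  Matrix.single (Sum.inl j) (Sum.inr 0) 1 - Matrix.single (Sum.inl j) (Sum.inr 1) 1
    - Matrix.single (Sum.inr 0) (Sum.inl j) 1 - Matrix.single (Sum.inr 1) (Sum.inl j) 1

/-- `N̄_j = E_{j,n+1} + E_{j,n+2} - E_{n+1,j} + E_{n+2,j}`. -/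
def Nbar {n : ℕ} (j : Fin n) : Mat n :=
  Matrix.single (Sum.inl j) (Sum.inr 0) 1 + Matrix.single (Sum.inl j) (Sum.inr 1) 1
    - Matrix.single (Sum.inr 0) (Sum.inl j) 1 + Matrix.single (Sum.inr 1) (Sum.inl j) 1

/-- `n_x = exp (∑ x_j N_j)`. -/
noncomputable def nExp {n : ℕ} (x : E n) : Mat n := NormedSpace.exp (∑ j, x j • N j)

/-- `n̄_x = exp (∑ x_j N̄_j)`. -/
noncomputable def nbarExp {n : ℕ} (x : E n) : Mat n := NormedSpace.exp (∑ j, x j • Nbar j)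

/-- `exp (t H₀) ∈ A`. -/
noncomputable def aExp (n : ℕ) (t : ℝ) : Mat n := NormedSpace.exp (t • H₀ n)

/-- The embedding `m ↦ diag(m, 1, 1)` of `SO(n)` onto `M ⊆ G`. -/
def embM {n : ℕ} (m : SO n) : Mat n := Matrix.fromBlocks (m : Matrix (Fin n) (Fin n) ℝ) 0 0 1

/-! ### Irreducible unitary representations of `M = SO(n)` -/

section Rep

variable {n : ℕ} {V : Type*} [NormedAddCommGroup V] [InnerProductSpace ℂ V]

/-- `σ` is an irreducible unitary representation of `SO(n)`. -/
structure IsIrredUnitary (σ : Representation ℂ (SO n) V) : Prop where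
  continuous : ∀ v, Continuous fun m : SO n => σ m v
  unitary : ∀ m v w, inner ℂ (σ m v) (σ m w) = inner ℂ v w
  irreducible : σ.IsIrreducible

/-! ### Branching to the stabilizer `M_{e₁} ≅ SO(n-1)` and highest weights

The rank of `SO(n-1)` is `⌊(n-1)/2⌋`, which is `m - 1` for `n = 2m` and for `n = 2m - 1`. -/

/-- The subspace `W` of `V` is an irreducible subrepresentation for
`M_{e₁} = {m ∈ SO(n) | m e₁ = e₁}`. -/
structure IsIrredSub [NeZero n] (σ : Representation ℂ (SO n) V) (W : Submodule ℂ V) : Prop where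
  ne_bot : W ≠ ⊥
  invariant : ∀ m : SO n, (m : Matrix (Fin n) (Fin n) ℝ).mulVec (Pi.single 0 1) = Pi.single 0 1 →
    W.map (σ m) ≤ W
  minimal : ∀ U : Submodule ℂ V, U ≤ W →
    (∀ m : SO n, (m : Matrix (Fin n) (Fin n) ℝ).mulVec (Pi.single 0 1) = Pi.single 0 1 →
      U.map (σ m) ≤ U) → U = ⊥ ∨ U = W

/-- The generator of the rotations in the plane spanned by `e_{2k}, e_{2k+1}` for
`k = 1, …, ⌊(n-1)/2⌋` (with `k` and the basis vectors counted from `1`). These planes are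
orthogonal to `e₁`, and the rotations generate a maximal torus of `M_{e₁}`. -/
def rotGen (n : ℕ) (k : Fin ((n - 1) / 2)) : Matrix (Fin n) (Fin n) ℝ :=
  Matrix.single ⟨2 * k + 2, by omega⟩ ⟨2 * k + 1, by omega⟩ 1
    - Matrix.single ⟨2 * k + 1, by omega⟩ ⟨2 * k + 2, by omega⟩ 1

/-- The subspace of `V` of weight `μ` for the maximal torus of `M_{e₁}`: the rotation by the angle
`θ` in the `k`-th plane acts by `e^{i μ_k θ}`. -/
def weightSpace (σ : Representation ℂ (SO n) V) (μ : Fin ((n - 1) / 2) → ℤ) :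
    Submodule ℂ V where
  carrier := {v | ∀ (k : Fin ((n - 1) / 2)) (θ : ℝ) (m : SO n),
    (m : Matrix (Fin n) (Fin n) ℝ) = NormedSpace.exp (θ • rotGen n k) →
      σ m v = Complex.exp (Complex.I * μ k * θ) • v}
  add_mem' := fun ha hb k θ m hm => by rw [map_add, ha k θ m hm, hb k θ m hm, smul_add]
  zero_mem' := fun k θ m _ => by rw [map_zero, smul_zero]
  smul_mem' := fun c v hv k θ m hm => by rw [map_smul, hv k θ m hm, smul_comm]

/-- The standard positive roots of `so(n-1)`: `e_i ± e_j` for `i < j`, and also `e_i` if `n - 1` is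
odd. -/
def posRoots (n : ℕ) : Set (Fin ((n - 1) / 2) → ℤ) :=
  {α | (∃ i j, i < j ∧ (α = Pi.single i 1 - Pi.single j 1 ∨ α = Pi.single i 1 + Pi.single j 1)) ∨
    (Even n ∧ ∃ i, α = Pi.single i 1)}

/-- `W` has highest weight `μ`: it is a weight of `W`, and every weight of `W` differs from it by
a sum of positive roots. -/
def HasHighestWeight (σ : Representation ℂ (SO n) V) (W : Submodule ℂ V)
    (μ : Fin ((n - 1) / 2) → ℤ) : Prop :=
  W ⊓ weightSpace σ μ ≠ ⊥ ∧
    ∀ ν, W ⊓ weightSpace σ ν ≠ ⊥ → μ - ν ∈ AddSubmonoid.closure (posRoots n)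

/-- `W_τ ⊆ V`: the sum of all irreducible subrepresentations for `M_{e₁}` of highest weight `τ`
(there is at most one of them; `W_τ = 0` if `τ` does not occur in `V`). -/
def W [NeZero n] (σ : Representation ℂ (SO n) V) (τ : Fin ((n - 1) / 2) → ℤ) : Submodule ℂ V :=
  sSup {U | IsIrredSub σ U ∧ HasHighestWeight σ U τ}

/-- `W_τ(ξ) = σ(m) W_τ`, where `m ∈ SO(n)` is such that `‖ξ‖ m e₁ = ξ`. For `ξ ≠ 0` all choices of
`m` give the same subspace, so that the supremum over them is that subspace. -/
def fibre [NeZero n] (σ : Representation ℂ (SO n) V) (τ : Fin ((n - 1) / 2) → ℤ) (ξ : E n) :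
    Submodule ℂ V :=
  ⨆ (m : SO n) (_ : ‖ξ‖ • (m : Matrix (Fin n) (Fin n) ℝ).mulVec (Pi.single 0 1) = ξ.ofLp),
    (W σ τ).map (σ m)

/-- The projection `pr_τ` in the decomposition of `V`-valued functions on `ℝⁿ ∖ {0}` according to
`V = ⨁_τ W_τ(ξ)`. The sum is orthogonal, so this is the orthogonal projection in each fibre. -/
noncomputable def pr [NeZero n] [FiniteDimensional ℂ V] (σ : Representation ℂ (SO n) V)
    (τ : Fin ((n - 1) / 2) → ℤ) (f : E n → V) (ξ : E n) : V :=
  (fibre σ τ ξ).starProjection (f ξ)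

end Rep

/-! ### The principal series -/

section PrincipalSeries

variable {n : ℕ} {V : Type*} [NormedAddCommGroup V] [InnerProductSpace ℂ V]

section
attribute [local instance] Matrix.normedAddCommGroup Matrix.normedSpace

/-- `F` is smooth on `G`, a closed submanifold of the space of matrices. (The norm on matrices does
not matter.) -/
def SmoothOnG (F : Mat n → V) : Prop := ContDiffOn ℝ ∞ F (G n)

end

/-- `F ∈ Ĩ_{σ,λ} = Ind_P^G(σ ⊗ e^λ ⊗ 1)`. Only the values of `F` on `G` matter. -/
structure IsPrincipal (σ : Representation ℂ (SO n) V) (lam : ℂ) (F : Mat n → V) : Prop where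
  smooth : SmoothOnG F
  equivariant : ∀ g ∈ G n, ∀ (m : SO n) (t : ℝ) (x : E n),
    F (g * (embM m * aExp n t * nExp x)) =
      Complex.exp (-(lam + (n : ℂ) / 2) * t) • σ m⁻¹ (F g)

/-- The derived representation `dπ̃` of the left regular representation,
`(dπ̃(X)F)(g) = d/dt|_{t=0} F(exp(-tX) g)`. -/
noncomputable def dLeft (X : Mat n) (F : Mat n → V) (g : Mat n) : V :=
  deriv (fun t : ℝ => F (NormedSpace.exp ((-t) • X) * g)) 0

/-- The non-compact picture of `F`: the function `x ↦ F(n̄_x)` on `ℝⁿ`. -/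
noncomputable def nonCompact (F : Mat n → V) (x : E n) : V := F (nbarExp x)

/-! ### The Fourier picture -/

/-- `φ` is a test function on `ℝⁿ ∖ {0}`. -/
structure IsTest (φ : E n → ℂ) : Prop where
  smooth : ContDiff ℝ ∞ φ
  compact : HasCompactSupport φ
  away : (0 : E n) ∉ tsupport φ

/-- The Fourier transform `(2π)^{-n/2} ∫ e^{-i⟨x,ξ⟩} φ(x) dx` of a scalar function. -/
noncomputable def fourier (φ : E n → ℂ) (ξ : E n) : ℂ :=
  (((2 * Real.pi) ^ (-(n : ℝ) / 2) : ℝ) : ℂ) *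
    ∫ x, Complex.exp (-Complex.I * (inner ℝ x ξ : ℝ)) * φ x

/-- The smooth function `f` on `ℝⁿ ∖ {0}` is the restriction to `ℝⁿ ∖ {0}` of the Fourier
transform, in the sense of tempered distributions, of the tempered function `g` on `ℝⁿ`. -/
structure IsFourierImage (g f : E n → V) : Prop where
  smooth : ContDiffOn ℝ ∞ f {0}ᶜ
  pairing : ∀ φ : E n → ℂ, IsTest φ → ∫ ξ, φ ξ • f ξ = ∫ x, fourier φ x • g x

/-- `f ∈ Î_{σ,λ}`: the restrictions to `ℝⁿ ∖ {0}` of the Fourier transforms of the functions in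
the non-compact picture. Only the values of `f` on `ℝⁿ ∖ {0}` matter. -/
def InIhat (σ : Representation ℂ (SO n) V) (lam : ℂ) (f : E n → V) : Prop :=
  ∃ F, IsPrincipal σ lam F ∧ IsFourierImage (nonCompact F) f

/-- `f ∈ Î_{σ,λ}(τ)`: moreover, `f(ξ) ∈ W_τ(ξ)` for all `ξ ≠ 0`. -/
def InIhatType [NeZero n] (σ : Representation ℂ (SO n) V) (lam : ℂ)
    (τ : Fin ((n - 1) / 2) → ℤ) (f : E n → V) : Prop :=
  InIhat σ lam f ∧ ∀ ξ, ξ ≠ 0 → f ξ ∈ fibre σ τ ξ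

/-- `h = dπ̂_{σ,λ}(X) f` for `f ∈ Î_{σ,λ}`: whenever `f` is the image of `F ∈ Ĩ_{σ,λ}` in the
Fourier picture, `h` is the image of `dπ̃(X)F`. -/
def IsDerivedAction (σ : Representation ℂ (SO n) V) (lam : ℂ) (X : Mat n) (f h : E n → V) : Prop :=
  ∀ F, IsPrincipal σ lam F → IsFourierImage (nonCompact F) f →
    IsFourierImage (nonCompact (dLeft X F)) h

end PrincipalSeries

/-- The partial derivative `∂_j f`. -/
noncomputable def partialDeriv {n : ℕ} {V : Type*} [NormedAddCommGroup V] [NormedSpace ℝ V]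
    (j : Fin n) (f : E n → V) (ξ : E n) : V :=
  fderiv ℝ f ξ (EuclideanSpace.single j 1)

end FPicture

/-!
Moving `N_j` past `n̄_x` and decomposing `Ad(n̄_x)⁻¹ N_j` along `𝔫̄ ⊕ 𝔞 ⊕ 𝔪 ⊕ 𝔫`
(`N_mul_nbarExp`) shows that `N_j` acts on the functions `x ↦ F(n̄_x)` by a first-order differential
operator with polynomial coefficients (`IsPrincipal.dLeft_N`). By the Iwasawa decomposition these
functions grow at most polynomially (`IsPrincipal.growth`), so the Fourier transform turns this
operator into the second-order operator `fourierN` on `ℝⁿ ∖ {0}`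
(`IsPrincipal.isFourierImage_dLeft_N`). Here the differential of `σ` enters, through the operators
`S_ab` that represent `E_ab - E_ba`. It exists as soon as one function in the principal series does
not vanish on `G` (`IsPrincipal.exists_isDifferential`); if there is no such function, all
functions in the statement vanish.

The operators `fourierN` are equivariant for `SO(n)` (`IsDifferential.fourierN_transport`), hence it
suffices to consider `ξ = s e₁` with `s > 0`, where the fibre is `W_τ` itself. Let `g` take values
in the fibres. Differentiating along the circle from `s e₁` towards `s e_k` shows that, modulo
`W_τ`, the derivative `s ∂_k g` is `S_{k1} g` (`HasFibreValues.fderiv_sub_mem`), and differentiating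
again gives the second derivatives (`HasFibreValues.mixed_mem`, `HasFibreValues.second_mem`). Modulo
`W_τ` the action of `N_1` is then given by `∑_k S_{k1}²`, the difference of the Casimir operators of
`so(n)` and `so(n-1)`, which preserves `W_τ` (`HasFibreValues.fourierN_zero_mem`). The action of
`N_u` for `u ≠ 1` is a combination of `S_{u1} g` and `∑_k S_{uk} S_{k1} g`
(`HasFibreValues.fourierN_sub_mem`).

Two facts on the restriction of `σ` to `SO(n-1)` finish the proof. First, the operators `S_{k1}` map
`W_τ` to `W_τ ⊕ ⨁_i (W_{τ+e_i} ⊕ W_{τ-e_i})` (`S_mem_Wnear`), since a highest weight vector of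
weight `κ` on which they have a component in `W_τ` satisfies `κ = τ - ν` with `ν` a weight of the
vector representation (`exists_eq_sub_isoWt`). Secondly, as `2 ∑_k S_{uk} S_{k1}` is, up to a
multiple of `S_{u1}`, the commutator of `S_{u1}` with the Casimir operator of `so(n-1)`
(`IsDifferential.casimir_erase_S`), its component from `W_τ` to `W_{τ'}` is a multiple of that
of `S_{u1}`. The factor is given by the Casimir values on `W_τ` and `W_{τ'}`
(`starProjection_sum_S_S`, `casimir_erase_of_mem_W`), and their difference for `τ' = τ ± e_i`
(`casimirValue_add_single`) is the coefficient in the theorem.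
-/

namespace FPicture
open Matrix NormedSpace

/-! ### The exponential map of matrices -/

section MatrixExp
variable {ι : Type*} [Fintype ι] [DecidableEq ι]

/-- The topology on matrices is all that matters for derivatives, so any of the operator norms
gives the derivative of the exponential map. -/
theorem hasDerivAt_matrix_exp (X : Matrix ι ι ℝ) (t : ℝ) :
    HasDerivAt (fun s : ℝ => exp (s • X)) (exp (t • X) * X) t := by
  let _ : NormedRing (Matrix ι ι ℝ) := Matrix.linftyOpNormedRing
  let _ : NormedAlgebra ℝ (Matrix ι ι ℝ) := Matrix.linftyOpNormedAlgebra
  exact hasDerivAt_exp_smul_const X t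

theorem hasDerivAt_matrix_exp' (X : Matrix ι ι ℝ) (t : ℝ) :
    HasDerivAt (fun s : ℝ => exp (s • X)) (X * exp (t • X)) t := by
  let _ : NormedRing (Matrix ι ι ℝ) := Matrix.linftyOpNormedRing
  let _ : NormedAlgebra ℝ (Matrix ι ι ℝ) := Matrix.linftyOpNormedAlgebra
  exact hasDerivAt_exp_smul_const' X t

theorem hasDerivAt_matrix_mul {A B : ℝ → Matrix ι ι ℝ} {A' B' : Matrix ι ι ℝ} {t : ℝ}
    (hA : HasDerivAt A A' t) (hB : HasDerivAt B B' t) :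
    HasDerivAt (fun s => A s * B s) (A' * B t + A t * B') t := by
  let _ : NormedRing (Matrix ι ι ℝ) := Matrix.linftyOpNormedRing
  let _ : NormedAlgebra ℝ (Matrix ι ι ℝ) := Matrix.linftyOpNormedAlgebra
  exact HasDerivAt.mul hA hB

theorem hasDerivAt_matrix_const (A : Matrix ι ι ℝ) (t : ℝ) : HasDerivAt (fun _ => A) 0 t := by
  let _ : NormedRing (Matrix ι ι ℝ) := Matrix.linftyOpNormedRing
  let _ : NormedAlgebra ℝ (Matrix ι ι ℝ) := Matrix.linftyOpNormedAlgebra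
  exact hasDerivAt_const t A

theorem exp_neg_mul_exp (A : Matrix ι ι ℝ) : exp (-A) * exp A = 1 := by
  rw [← Matrix.exp_add_of_commute _ _ (Commute.neg_left (Commute.refl A))]; simp

theorem exp_mul_exp_neg (A : Matrix ι ι ℝ) : exp A * exp (-A) = 1 := by
  rw [← Matrix.exp_add_of_commute _ _ (Commute.neg_right (Commute.refl A))]; simp

theorem eq_of_hasDerivAt_matrix_zero {A : ℝ → Matrix ι ι ℝ} (h : ∀ t, HasDerivAt A 0 t) (s t : ℝ) :
    A s = A t := by
  let _ : NormedRing (Matrix ι ι ℝ) := Matrix.linftyOpNormedRing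
  let _ : NormedAlgebra ℝ (Matrix ι ι ℝ) := Matrix.linftyOpNormedAlgebra
  exact is_const_of_deriv_eq_zero (fun t => (h t).differentiableAt) (fun t => (h t).deriv) s t

/-- A curve `γ` with `γ' = X γ` and `γ(0) = 1` is the one-parameter group of `X`. -/
theorem eq_exp_of_hasDerivAt {X : Matrix ι ι ℝ} {γ : ℝ → Matrix ι ι ℝ}
    (h : ∀ t, HasDerivAt γ (X * γ t) t) (h0 : γ 0 = 1) (t : ℝ) : exp (t • X) = γ t := by
  have key : ∀ t, HasDerivAt (fun s : ℝ => exp (s • (-X)) * γ s) 0 t := fun t => by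
    have := hasDerivAt_matrix_mul (hasDerivAt_matrix_exp (-X) t) (h t)
    simpa [mul_assoc] using this
  have h1 := eq_of_hasDerivAt_matrix_zero key t 0
  simp only [zero_smul, exp_zero, h0, mul_one] at h1
  calc exp (t • X) = exp (t • X) * (exp (t • (-X)) * γ t) := by rw [h1, mul_one]
    _ = γ t := by rw [← mul_assoc, smul_neg, exp_mul_exp_neg, one_mul]

/-- Rodrigues' formula. It applies to the generators of the rotations in a coordinate plane. -/
theorem exp_smul_of_cube {Z : Matrix ι ι ℝ} (hZ : Z * (Z * Z) = -Z) (t : ℝ) :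
    exp (t • Z) = 1 + Real.sin t • Z + (1 - Real.cos t) • (Z * Z) := by
  refine eq_exp_of_hasDerivAt (X := Z)
    (γ := fun t => 1 + Real.sin t • Z + (1 - Real.cos t) • (Z * Z)) (fun t => ?_) (by simp) t
  let _ : NormedRing (Matrix ι ι ℝ) := Matrix.linftyOpNormedRing
  let _ : NormedAlgebra ℝ (Matrix ι ι ℝ) := Matrix.linftyOpNormedAlgebra
  have h1 := ((Real.hasDerivAt_sin t).smul_const Z).const_add 1
  have h2 := ((Real.hasDerivAt_cos t).const_sub 1).smul_const (Z * Z)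
  refine (h1.add h2).congr_deriv ?_
  simp only [mul_add, mul_one, mul_smul_comm, hZ]
  module

theorem exp_of_cube_zero {Y : Matrix ι ι ℝ} (hY : Y * (Y * Y) = 0) :
    exp Y = 1 + Y + (2⁻¹ : ℝ) • (Y * Y) := by
  have := eq_exp_of_hasDerivAt (X := Y)
    (γ := fun t => 1 + t • Y + (2⁻¹ * t ^ 2) • (Y * Y)) (fun t => ?_) (by simp) 1
  · simpa using this
  let _ : NormedRing (Matrix ι ι ℝ) := Matrix.linftyOpNormedRing
  let _ : NormedAlgebra ℝ (Matrix ι ι ℝ) := Matrix.linftyOpNormedAlgebra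
  have h1 := ((hasDerivAt_id t).smul_const Y).const_add 1
  have h2 := (((hasDerivAt_id t).pow 2).const_mul (2⁻¹)).smul_const (Y * Y)
  refine (h1.add h2).congr_deriv ?_
  simp only [mul_add, mul_one, mul_smul_comm, hY]
  simp

end MatrixExp

/-! ### Rotations generate `SO(n)` -/

section Rotations
variable {n : ℕ}

theorem transpose_mul_self_SO (m : SO n) : (m : Matrix (Fin n) (Fin n) ℝ)ᵀ * m = 1 :=
  (mem_orthogonalGroup_iff' _ _).1 (mem_specialOrthogonalGroup_iff.1 m.2).1

theorem mul_transpose_self_SO (m : SO n) :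
    (m : Matrix (Fin n) (Fin n) ℝ) * (m : Matrix _ _ ℝ)ᵀ = 1 :=
  (mem_orthogonalGroup_iff _ _).1 (mem_specialOrthogonalGroup_iff.1 m.2).1

theorem coe_inv_SO (m : SO n) : ((m⁻¹ : SO n) : Matrix (Fin n) (Fin n) ℝ) = (m : Matrix _ _ ℝ)ᵀ :=
  rfl

/-- The exponential of a skew-symmetric matrix is orthogonal, and its determinant is a square, being
that of `exp (A / 2) * exp (A / 2)`. -/
theorem det_exp_of_skew {A : Matrix (Fin n) (Fin n) ℝ} (hA : Aᵀ = -A) : (exp A).det = 1 := by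
  have h1 : exp A = exp ((2⁻¹ : ℝ) • A) * exp ((2⁻¹ : ℝ) • A) := by
    rw [← Matrix.exp_add_of_commute _ _ (Commute.refl _), ← add_smul]; norm_num
  have h2 : (exp A)ᵀ * exp A = 1 := by
    rw [← Matrix.exp_transpose, hA, exp_neg_mul_exp]
  have h3 := congrArg Matrix.det h2
  rw [det_mul, det_transpose, det_one] at h3
  have h4 : 0 ≤ (exp A).det := by rw [h1, det_mul]; exact mul_self_nonneg _
  nlinarith

theorem exp_mem_SO {A : Matrix (Fin n) (Fin n) ℝ} (hA : Aᵀ = -A) :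
    exp A ∈ Matrix.specialOrthogonalGroup (Fin n) ℝ := by
  refine mem_specialOrthogonalGroup_iff.2 ⟨(mem_orthogonalGroup_iff' _ _).2 ?_, det_exp_of_skew hA⟩
  rw [← Matrix.exp_transpose, hA, exp_neg_mul_exp]

/-- `exp A ∈ SO(n)` for a skew-symmetric matrix `A`; the value is `1` if `A` is not
skew-symmetric. -/
noncomputable def rot (A : Matrix (Fin n) (Fin n) ℝ) : SO n :=
  open Classical in if h : Aᵀ = -A then ⟨exp A, exp_mem_SO h⟩ else 1

theorem coe_rot {A : Matrix (Fin n) (Fin n) ℝ} (hA : Aᵀ = -A) :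
    (rot A : Matrix (Fin n) (Fin n) ℝ) = exp A := by
  simp [rot, hA]

theorem rot_neg {A : Matrix (Fin n) (Fin n) ℝ} (hA : Aᵀ = -A) : rot (-A) = (rot A)⁻¹ := by
  apply Subtype.ext
  rw [coe_inv_SO, coe_rot hA, coe_rot (by simp [hA]), ← Matrix.exp_transpose, hA]

theorem rot_zero : rot (0 : Matrix (Fin n) (Fin n) ℝ) = 1 := by
  apply Subtype.ext; rw [coe_rot (by simp)]; simp

theorem rot_add_smul {A : Matrix (Fin n) (Fin n) ℝ} (hA : Aᵀ = -A) (s t : ℝ) :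
    rot ((s + t) • A) = rot (s • A) * rot (t • A) := by
  apply Subtype.ext
  rw [Submonoid.coe_mul, coe_rot (by simp [hA]), coe_rot (by simp [hA]), coe_rot (by simp [hA]),
    add_smul, Matrix.exp_add_of_commute]
  exact ((Commute.refl A).smul_left s).smul_right t

/-- The rotations `exp A` that act in the coordinates `k, k + 1, …` only. -/
def rotations (n k : ℕ) : Set (SO n) :=
  {m | ∃ A : Matrix (Fin n) (Fin n) ℝ, Aᵀ = -A ∧
    (∀ a b : Fin n, (a : ℕ) < k ∨ (b : ℕ) < k → A a b = 0) ∧ m = rot A}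

theorem rotations_anti {k l : ℕ} (h : k ≤ l) : rotations n l ⊆ rotations n k := by
  rintro m ⟨A, hA, h0, rfl⟩
  exact ⟨A, hA, fun a b hab => h0 a b (hab.imp (fun x => x.trans_le h) fun x => x.trans_le h), rfl⟩

/-- A unit vector supported in the coordinates `≥ k` is moved to `e_k` by a rotation in these
coordinates, provided there are at least two of them. -/
theorem exists_rotation_mulVec {k : ℕ} (hk : k + 1 < n) (v : Fin n → ℝ)
    (hv : ∀ i : Fin n, (i : ℕ) < k → v i = 0) (h1 : v ⬝ᵥ v = 1) :
    ∃ A : Matrix (Fin n) (Fin n) ℝ, Aᵀ = -A ∧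
      (∀ a b : Fin n, (a : ℕ) < k ∨ (b : ℕ) < k → A a b = 0) ∧
      exp A *ᵥ (Pi.single ⟨k, by omega⟩ 1) = v := by
  set κ : Fin n := ⟨k, by omega⟩ with hκ
  set e : Fin n → ℝ := Pi.single κ 1 with he
  have hee : e ⬝ᵥ e = 1 := by simp [he]
  -- `w` is a unit vector orthogonal to `e_k` in a plane that contains `e_k` and `v`
  obtain ⟨w, hw0, hw1, hwe, θ, hθ⟩ : ∃ w : Fin n → ℝ, (∀ i : Fin n, (i : ℕ) < k → w i = 0) ∧
      w ⬝ᵥ w = 1 ∧ w ⬝ᵥ e = 0 ∧ ∃ θ : ℝ, v = Real.cos θ • e + Real.sin θ • w := by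
    set c := v κ with hc
    set v' := v - c • e with hv'
    have hv'e : v' ⬝ᵥ e = 0 := by simp [hv', he, hc]
    have hve : v ⬝ᵥ e = c := by simp [he, hc]
    have hn : v' ⬝ᵥ v' = 1 - c ^ 2 := by
      rw [hv', sub_dotProduct, dotProduct_sub, dotProduct_sub, smul_dotProduct, dotProduct_smul,
        smul_dotProduct, dotProduct_smul, h1, hee, dotProduct_comm e v, hve]
      simp; try ring
    have h0v' : ∀ i : Fin n, (i : ℕ) < k → v' i = 0 := fun i hi => by
      have : i ≠ κ := fun h => by rw [h] at hi; simp [hκ] at hi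
      simp [hv', he, hv i hi, this]
    by_cases hz : v' ⬝ᵥ v' = 0
    · have hz' : v' = 0 := dotProduct_self_eq_zero.1 hz
      refine ⟨Pi.single ⟨k + 1, hk⟩ 1, fun i hi => ?_, by simp, by simp [he, hκ], ?_⟩
      · rw [Pi.single_eq_of_ne]; intro h; rw [h] at hi; simp at hi
      · have hvc : v = c • e := sub_eq_zero.1 hz'
        have : c ^ 2 = 1 := by rw [hn] at hz; linarith
        rw [sq, mul_self_eq_one_iff] at this
        rcases this with h | h
        · exact ⟨0, by rw [hvc, h]; simp⟩
        · exact ⟨Real.pi, by rw [hvc, h]; simp⟩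
    · have hpos : 0 < v' ⬝ᵥ v' := lt_of_le_of_ne (by
        simpa [dotProduct] using Finset.sum_nonneg fun i _ => mul_self_nonneg (v' i)) (Ne.symm hz)
      set r := Real.sqrt (v' ⬝ᵥ v') with hr
      have hr0 : r ≠ 0 := (Real.sqrt_pos.2 hpos).ne'
      have hrr : r * r = v' ⬝ᵥ v' := Real.mul_self_sqrt hpos.le
      refine ⟨r⁻¹ • v', fun i hi => by simp [h0v' i hi], ?_, by simp [hv'e],
        Real.arccos c, ?_⟩
      · rw [smul_dotProduct, dotProduct_smul, ← hrr]; simp; field_simp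
      · have hc1 : c ^ 2 < 1 := by linarith
        rw [Real.cos_arccos (by nlinarith) (by nlinarith), Real.sin_arccos, ← hn, ← hr, smul_smul,
          mul_inv_cancel₀ hr0, one_smul, hv']
        simp
  set Z := vecMulVec w e - vecMulVec e w with hZ
  have hZe : Z *ᵥ e = w := by
    simp [hZ, sub_mulVec, vecMulVec_mulVec, hee, hwe]
  have hZw : Z *ᵥ w = -e := by
    simp [hZ, sub_mulVec, vecMulVec_mulVec, hw1, dotProduct_comm e w, hwe]
  have hZmul : ∀ x y : Fin n → ℝ, Z * vecMulVec x y = vecMulVec (Z *ᵥ x) y := fun x y => by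
    rw [mul_vecMulVec]
  have hcube : Z * (Z * Z) = -Z := by
    have h2 : Z * Z = -vecMulVec e e - vecMulVec w w := by
      rw [show Z * Z = Z * (vecMulVec w e - vecMulVec e w) from congrArg (Z * ·) hZ, mul_sub,
        hZmul, hZmul, hZe, hZw, neg_vecMulVec]
    rw [h2, mul_sub, mul_neg, hZmul, hZmul, hZe, hZw, neg_vecMulVec, hZ]
    abel
  refine ⟨θ • Z, by simp [hZ, transpose_vecMulVec, ← smul_neg], fun a b hab => ?_, ?_⟩
  · have hek : ∀ i : Fin n, (i : ℕ) < k → e i = 0 := fun i hi => by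
      have : i ≠ κ := fun h => by rw [h] at hi; simp [hκ] at hi
      simp [he, this]
    rcases hab with h | h <;> simp [hZ, vecMulVec_apply, hw0 _ h, hek _ h]
  · rw [exp_smul_of_cube hcube, add_mulVec, add_mulVec, smul_mulVec, smul_mulVec, ← mulVec_mulVec,
      hZe, hZw, hθ, one_mulVec]
    module

/-- Induction on the number `d` of coordinates that may be moved: a rotation that takes `e_k` to `m
e_k` is split off, and the rest fixes `e_k` as well. -/
theorem mem_closure_rotations_aux (d : ℕ) : ∀ (k : ℕ), n ≤ k + d → ∀ m : SO n,
    (∀ i : Fin n, (i : ℕ) < k → (m : Matrix (Fin n) (Fin n) ℝ) *ᵥ Pi.single i 1 = Pi.single i 1) →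
    m ∈ Submonoid.closure (rotations n k) := by
  induction d with
  | zero =>
    intro k hk m hm
    have : m = 1 := by
      apply Subtype.ext
      refine Matrix.ext_of_mulVec_single fun i => ?_
      rw [hm i (by omega)]; simp only [OneMemClass.coe_one, one_mulVec]
    rw [this]; exact one_mem _
  | succ d ih =>
    intro k hk m hm
    by_cases hkn : n ≤ k
    · exact Submonoid.closure_mono (rotations_anti (Nat.le_succ k))
        (ih (k + 1) (by omega) m fun i _ => hm i (by omega))
    push Not at hkn
    set κ : Fin n := ⟨k, hkn⟩ with hκ
    set v := (m : Matrix (Fin n) (Fin n) ℝ) *ᵥ Pi.single κ 1 with hv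
    have hdot : ∀ x y : Fin n → ℝ, ((m : Matrix (Fin n) (Fin n) ℝ) *ᵥ x) ⬝ᵥ
        ((m : Matrix (Fin n) (Fin n) ℝ) *ᵥ y) = x ⬝ᵥ y := fun x y => by
      rw [dotProduct_mulVec, vecMul_mulVec, transpose_mul_self_SO, vecMul_one]
    have hv0 : ∀ i : Fin n, (i : ℕ) < k → v i = 0 := fun i hi => by
      have hik : i ≠ κ := fun h => by rw [h] at hi; simp [hκ] at hi
      have := hdot (Pi.single i 1) (Pi.single κ 1)
      rw [hm i hi] at this
      simpa [hik, ← hv] using this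
    have hv1 : v ⬝ᵥ v = 1 := by rw [hv, hdot]; simp
    by_cases hlast : k + 1 < n
    · obtain ⟨A, hA, hA0, hAe⟩ := exists_rotation_mulVec hlast v hv0 hv1
      have hfix : ∀ i : Fin n, (i : ℕ) < k → exp A *ᵥ Pi.single i 1 = Pi.single i (1 : ℝ) := by
        intro i hi
        have hcol : A * Matrix.single i i 1 = 0 := by
          ext a b
          by_cases hb : b = i
          · subst hb; simpa using hA0 a b (Or.inr hi)
          · simp [hb]
        have : exp A * Matrix.single i i (1 : ℝ) = Matrix.single i i 1 := by
          have key : ∀ t, HasDerivAt (fun s : ℝ => exp (s • A) * Matrix.single i i (1 : ℝ)) 0 t :=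
            fun t => by
              have := hasDerivAt_matrix_mul (hasDerivAt_matrix_exp A t)
                (hasDerivAt_matrix_const (Matrix.single i i (1 : ℝ)) t)
              simpa [mul_assoc, hcol] using this
          simpa using eq_of_hasDerivAt_matrix_zero key 1 0
        ext a
        have h2 := congrFun (congrFun this a) i
        simpa [Matrix.single_apply, Pi.single_apply, eq_comm] using h2
      have hm' : m = rot A * (rot (-A) * m) := by
        rw [rot_neg hA, mul_inv_cancel_left]
      rw [hm']
      refine mul_mem (Submonoid.subset_closure ⟨A, hA, hA0, rfl⟩)
        (Submonoid.closure_mono (rotations_anti (Nat.le_succ k)) (ih (k + 1) (by omega) _ ?_))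
      intro i hi
      have hinv : ∀ x y : Fin n → ℝ, exp A *ᵥ x = y → exp (-A) *ᵥ y = x := fun x y h => by
        rw [← h, mulVec_mulVec, exp_neg_mul_exp, one_mulVec]
      rw [Submonoid.coe_mul, ← mulVec_mulVec, coe_rot (by simp [hA])]
      rcases Nat.lt_succ_iff_lt_or_eq.1 hi with h | h
      · rw [hm i h]; exact hinv _ _ (hfix i h)
      · have : i = κ := Fin.ext h
        rw [this, ← hv]; exact hinv _ _ hAe
    · -- only one coordinate is left, and the determinant fixes its sign
      have hdiag : (m : Matrix (Fin n) (Fin n) ℝ) =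
          diagonal (fun i => if i = κ then v κ else 1) := by
        refine Matrix.ext_of_mulVec_single fun i => ?_
        by_cases hi : i = κ
        · rw [hi, ← hv]
          ext a
          by_cases ha : a = κ
          · simp [ha]
          · have : (a : ℕ) < k := by
              have := a.2; have : (a : ℕ) ≠ k := fun h => ha (Fin.ext h); omega
            simp [ha, hv0 a this]
        · have : (i : ℕ) < k := by
            have := i.2; have : (i : ℕ) ≠ k := fun h => hi (Fin.ext h); omega
          rw [hm i this]
          simp [hi]
      have hdet := (mem_specialOrthogonalGroup_iff.1 m.2).2
      rw [hdiag, det_diagonal, Finset.prod_ite_eq' Finset.univ κ (fun _ => v κ)] at hdet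
      have hm1 : m = 1 := by
        apply Subtype.ext
        rw [hdiag]
        simp at hdet
        simp [hdet]
      rw [hm1]; exact one_mem _

/-- Every `m ∈ SO(n)` that fixes `e_1, …, e_k` is a product of rotations in the remaining
coordinates. -/
theorem mem_closure_rotations {k : ℕ} (m : SO n)
    (hm : ∀ i : Fin n, (i : ℕ) < k →
      (m : Matrix (Fin n) (Fin n) ℝ) *ᵥ Pi.single i 1 = Pi.single i 1) :
    m ∈ Submonoid.closure (rotations n k) :=
  mem_closure_rotations_aux n k (by omega) m hm

end Rotations

/-! ### The light cone picture of `G` -/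

section LightCone
variable {n : ℕ}

/-- The light-like vector `p = e_{n+1} + e_{n+2}`; it is fixed by `N` and scaled by `A`. -/
def lightP (n : ℕ) : Fin n ⊕ Fin 2 → ℝ := Sum.elim 0 ![1, 1]

/-- The light-like vector `q = e_{n+2} - e_{n+1}`; it is fixed by `N̄` and scaled by `A`. -/
def lightQ (n : ℕ) : Fin n ⊕ Fin 2 → ℝ := Sum.elim 0 ![-1, 1]

/-- `ℝⁿ` as the span of the first `n` basis vectors. -/
def spatial (x : Fin n → ℝ) : Fin n ⊕ Fin 2 → ℝ := Sum.elim x 0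

@[simp] theorem lightP_dot_lightP : lightP n ⬝ᵥ lightP n = 2 := by
  simp [lightP, dotProduct]; norm_num
@[simp] theorem lightQ_dot_lightQ : lightQ n ⬝ᵥ lightQ n = 2 := by
  simp [lightQ, dotProduct]; norm_num
@[simp] theorem lightP_dot_lightQ : lightP n ⬝ᵥ lightQ n = 0 := by simp [lightP, lightQ, dotProduct]
@[simp] theorem lightQ_dot_lightP : lightQ n ⬝ᵥ lightP n = 0 := by simp [lightP, lightQ, dotProduct]
@[simp] theorem spatial_dot_lightP (x : Fin n → ℝ) : spatial x ⬝ᵥ lightP n = 0 := by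
  simp [lightP, spatial, dotProduct]
@[simp] theorem spatial_dot_lightQ (x : Fin n → ℝ) : spatial x ⬝ᵥ lightQ n = 0 := by
  simp [lightQ, spatial, dotProduct]
@[simp] theorem lightP_dot_spatial (x : Fin n → ℝ) : lightP n ⬝ᵥ spatial x = 0 := by
  simp [lightP, spatial, dotProduct]
@[simp] theorem lightQ_dot_spatial (x : Fin n → ℝ) : lightQ n ⬝ᵥ spatial x = 0 := by
  simp [lightQ, spatial, dotProduct]
@[simp] theorem spatial_dot_spatial (x y : Fin n → ℝ) : spatial x ⬝ᵥ spatial y = x ⬝ᵥ y := by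
  simp [spatial, dotProduct]

theorem spatial_add (x y : Fin n → ℝ) : spatial (x + y) = spatial x + spatial y := by
  ext (i | i) <;> simp [spatial]
theorem spatial_smul (c : ℝ) (x : Fin n → ℝ) : spatial (c • x) = c • spatial x := by
  ext (i | i) <;> simp [spatial]

/-- `N(x) = ∑ x_j N_j`. -/
def nLie (x : Fin n → ℝ) : Mat n :=
  -vecMulVec (spatial x) (lightQ n) - vecMulVec (lightP n) (spatial x)

/-- `N̄(x) = ∑ x_j N̄_j`. -/
def nbarLie (x : Fin n → ℝ) : Mat n :=
  vecMulVec (spatial x) (lightP n) + vecMulVec (lightQ n) (spatial x)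

/-- The embedding of `so(n)` as the Lie algebra of `M`. -/
def mLie (A : Matrix (Fin n) (Fin n) ℝ) : Mat n := Matrix.fromBlocks A 0 0 0

theorem nLie_single (j : Fin n) : nLie (Pi.single j 1) = N j := by
  ext (a | a) (b | b)
  · simp [nLie, N, vecMulVec_apply, spatial, lightP, lightQ]
  · fin_cases b <;>
    simp [nLie, N, vecMulVec_apply, spatial, lightP, lightQ, Matrix.single_apply, Pi.single_apply,
      eq_comm]
  · fin_cases a <;>
    simp [nLie, N, vecMulVec_apply, spatial, lightP, lightQ, Matrix.single_apply, Pi.single_apply,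
      eq_comm]
  · fin_cases a <;> fin_cases b <;>
    simp [nLie, N, vecMulVec_apply, spatial, lightP, lightQ]

theorem nbarLie_single (j : Fin n) : nbarLie (Pi.single j 1) = Nbar j := by
  ext (a | a) (b | b)
  · simp [nbarLie, Nbar, vecMulVec_apply, spatial, lightP, lightQ]
  · fin_cases b <;>
    simp [nbarLie, Nbar, vecMulVec_apply, spatial, lightP, lightQ, Matrix.single_apply,
      Pi.single_apply, eq_comm]
  · fin_cases a <;> by_cases h : j = b <;>
    simp [nbarLie, Nbar, vecMulVec_apply, spatial, lightP, lightQ, eq_comm, h]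
  · fin_cases a <;> fin_cases b <;>
    simp [nbarLie, Nbar, vecMulVec_apply, spatial, lightP, lightQ]

theorem nLie_add (x y : Fin n → ℝ) : nLie (x + y) = nLie x + nLie y := by
  simp only [nLie, spatial_add, add_vecMulVec, vecMulVec_add]; abel
theorem nLie_smul (c : ℝ) (x : Fin n → ℝ) : nLie (c • x) = c • nLie x := by
  simp only [nLie, spatial_smul, smul_vecMulVec, vecMulVec_smul]; module
theorem nbarLie_add (x y : Fin n → ℝ) : nbarLie (x + y) = nbarLie x + nbarLie y := by
  simp only [nbarLie, spatial_add, add_vecMulVec, vecMulVec_add]; abel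
theorem nbarLie_smul (c : ℝ) (x : Fin n → ℝ) : nbarLie (c • x) = c • nbarLie x := by
  simp only [nbarLie, spatial_smul, smul_vecMulVec, vecMulVec_smul]; module

theorem eq_sum_smul_single (x : Fin n → ℝ) : x = ∑ j, x j • (Pi.single j 1 : Fin n → ℝ) := by
  ext i; simp [Finset.sum_apply, Pi.single_apply]

theorem sum_smul_N (x : Fin n → ℝ) : ∑ j, x j • N j = nLie x := by
  let L : (Fin n → ℝ) →ₗ[ℝ] Mat n := ⟨⟨nLie, nLie_add⟩, nLie_smul⟩
  change _ = L x
  conv_rhs => rw [eq_sum_smul_single x, map_sum]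
  refine Finset.sum_congr rfl fun j _ => ?_
  rw [map_smul, ← nLie_single]; rfl

theorem sum_smul_Nbar (x : Fin n → ℝ) : ∑ j, x j • Nbar j = nbarLie x := by
  let L : (Fin n → ℝ) →ₗ[ℝ] Mat n := ⟨⟨nbarLie, nbarLie_add⟩, nbarLie_smul⟩
  change _ = L x
  conv_rhs => rw [eq_sum_smul_single x, map_sum]
  refine Finset.sum_congr rfl fun j _ => ?_
  rw [map_smul, ← nbarLie_single]; rfl

theorem nbarExp_eq_exp (x : E n) : nbarExp x = exp (nbarLie x.ofLp) := by
  rw [nbarExp, sum_smul_Nbar]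
theorem nExp_eq_exp (x : E n) : nExp x = exp (nLie x.ofLp) := by
  rw [nExp, sum_smul_N]

theorem nbarExp_eq (x : E n) : nbarExp x = 1 + vecMulVec (spatial x.ofLp) (lightP n) +
    vecMulVec (lightQ n) (spatial x.ofLp) +
    (2⁻¹ * (x.ofLp ⬝ᵥ x.ofLp)) • vecMulVec (lightQ n) (lightP n) := by
  have h2 : nbarLie x.ofLp * nbarLie x.ofLp =
      (x.ofLp ⬝ᵥ x.ofLp) • vecMulVec (lightQ n) (lightP n) := by
    simp [nbarLie, mul_add, add_mul, vecMulVec_mul_vecMulVec]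
  rw [nbarExp_eq_exp, exp_of_cube_zero, h2, smul_smul, nbarLie, ← add_assoc]
  rw [h2]
  simp [nbarLie, add_mul, vecMulVec_mul_vecMulVec]

theorem nExp_eq (x : E n) : nExp x = 1 - vecMulVec (spatial x.ofLp) (lightQ n) -
    vecMulVec (lightP n) (spatial x.ofLp) +
    (2⁻¹ * (x.ofLp ⬝ᵥ x.ofLp)) • vecMulVec (lightP n) (lightQ n) := by
  have h2 : nLie x.ofLp * nLie x.ofLp =
      (x.ofLp ⬝ᵥ x.ofLp) • vecMulVec (lightP n) (lightQ n) := by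
    simp [nLie, mul_sub, sub_mul, vecMulVec_mul_vecMulVec]
  rw [nExp_eq_exp, exp_of_cube_zero, h2, smul_smul, nLie]
  · abel
  rw [h2]
  simp [nLie, sub_mul, vecMulVec_mul_vecMulVec]

theorem H₀_eq : H₀ n = (2⁻¹ : ℝ) • (vecMulVec (lightP n) (lightP n) -
    vecMulVec (lightQ n) (lightQ n)) := by
  ext (a | a) (b | b)
  · simp [H₀, vecMulVec_apply, lightP, lightQ]
  · simp [H₀, vecMulVec_apply, lightP, lightQ]
  · simp [H₀, vecMulVec_apply, lightP, lightQ]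
  · fin_cases a <;> fin_cases b <;> simp [H₀, vecMulVec_apply, lightP, lightQ] <;> norm_num

theorem aExp_eq (t : ℝ) : aExp n t = 1 +
    (2⁻¹ * (Real.exp t - 1)) • vecMulVec (lightP n) (lightP n) +
    (2⁻¹ * (Real.exp (-t) - 1)) • vecMulVec (lightQ n) (lightQ n) := by
  refine eq_exp_of_hasDerivAt (X := H₀ n) (γ := fun t => 1 +
    (2⁻¹ * (Real.exp t - 1)) • vecMulVec (lightP n) (lightP n) +
    (2⁻¹ * (Real.exp (-t) - 1)) • vecMulVec (lightQ n) (lightQ n)) (fun t => ?_) (by simp) t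
  let _ : NormedRing (Mat n) := Matrix.linftyOpNormedRing
  let _ : NormedAlgebra ℝ (Mat n) := Matrix.linftyOpNormedAlgebra
  have h1 := ((((Real.hasDerivAt_exp t).sub_const 1).const_mul (2⁻¹ : ℝ)).smul_const
    (vecMulVec (lightP n) (lightP n))).const_add 1
  have h2 := ((((hasDerivAt_neg t).exp).sub_const 1).const_mul (2⁻¹ : ℝ)).smul_const
    (vecMulVec (lightQ n) (lightQ n))
  refine (h1.add h2).congr_deriv ?_
  rw [H₀_eq]
  simp only [mul_add, mul_one, mul_smul_comm, smul_mul_assoc, sub_mul, vecMulVec_mul_vecMulVec,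
    lightP_dot_lightP, lightQ_dot_lightQ, lightP_dot_lightQ, lightQ_dot_lightP, zero_smul, sub_zero,
    vecMulVec_zero, vecMulVec_smul]
  module

/-- The vector `p + q` is twice the basis vector `e_{n+2}`. -/
theorem lightP_add_lightQ : lightP n + lightQ n = (2 : ℝ) • Pi.single (Sum.inr 1) 1 := by
  ext (a | a)
  · simp [lightP, lightQ]
  · fin_cases a
    · simp [lightP, lightQ]
    · simp [lightP, lightQ]; norm_num

/-! ### Curves in `G` -/

/-- The Lie algebra of `O(n+1,1)`. -/
def IsLie (X : Mat n) : Prop := Xᵀ * form n + form n * X = 0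

theorem form_mul_form : form n * form n = 1 := by
  rw [form, diagonal_mul_diagonal, ← diagonal_one]
  congr 1; ext (a | a)
  · simp
  · fin_cases a <;> simp

theorem form_mulVec_lightP : form n *ᵥ lightP n = -lightQ n := by
  ext (a | a)
  · simp [form, lightP, lightQ, mulVec_diagonal]
  · fin_cases a <;> simp [form, lightP, lightQ, mulVec_diagonal]

theorem form_mulVec_lightQ : form n *ᵥ lightQ n = -lightP n := by
  ext (a | a)
  · simp [form, lightP, lightQ, mulVec_diagonal]
  · fin_cases a <;> simp [form, lightP, lightQ, mulVec_diagonal]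

theorem form_mulVec_spatial (x : Fin n → ℝ) : form n *ᵥ spatial x = spatial x := by
  ext (a | a) <;> simp [form, spatial, mulVec_diagonal]

theorem form_transpose : (form n)ᵀ = form n := by simp [form]

theorem vecMul_form (v : Fin n ⊕ Fin 2 → ℝ) : v ᵥ* form n = form n *ᵥ v := by
  rw [← mulVec_transpose, form_transpose]

theorem isLie_nbarLie (x : Fin n → ℝ) : IsLie (nbarLie x) := by
  simp [IsLie, nbarLie, transpose_vecMulVec, add_mul, mul_add, vecMulVec_mul, mul_vecMulVec,
    vecMul_form, form_mulVec_lightQ, form_mulVec_spatial]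

theorem isLie_nLie (x : Fin n → ℝ) : IsLie (nLie x) := by
  simp [IsLie, nLie, transpose_vecMulVec, sub_mul, mul_sub, vecMulVec_mul, mul_vecMulVec,
    vecMul_form, form_mulVec_lightP, form_mulVec_spatial]

theorem isLie_H₀ : IsLie (H₀ n) := by
  rw [H₀_eq, IsLie]
  simp [transpose_vecMulVec, sub_mul, mul_sub, vecMulVec_mul, mul_vecMulVec,
    vecMul_form, form_mulVec_lightP, form_mulVec_lightQ, ← smul_add]

theorem IsLie.smul {X : Mat n} (hX : IsLie X) (t : ℝ) : IsLie (t • X) := by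
  rw [IsLie] at *
  rw [transpose_smul, smul_mul_assoc, mul_smul_comm, ← smul_add, hX, smul_zero]

theorem IsLie.exp_mem {X : Mat n} (hX : IsLie X) : exp X ∈ indefO n := by
  have hu : IsUnit (form n) := IsUnit.of_mul_eq_one _ form_mul_form
  have hinv : (form n)⁻¹ = form n := Matrix.inv_eq_right_inv form_mul_form
  have h1 : form n * X * (form n)⁻¹ = -Xᵀ := by
    rw [hinv, eq_neg_of_add_eq_zero_right hX, neg_mul, mul_assoc, form_mul_form, mul_one]
  have h2 := Matrix.exp_conj (form n) X hu
  rw [h1, hinv] at h2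
  have h3 : exp (-Xᵀ) * form n = form n * exp X := by
    rw [h2, mul_assoc, form_mul_form, mul_one]
  change (exp X)ᵀ * form n * exp X = form n
  rw [mul_assoc, ← h3, ← Matrix.exp_transpose, ← mul_assoc, exp_mul_exp_neg, one_mul]

theorem indefO_mul {g h : Mat n} (hg : g ∈ indefO n) (hh : h ∈ indefO n) : g * h ∈ indefO n := by
  change (g * h)ᵀ * form n * (g * h) = form n
  have h1 : gᵀ * form n * g = form n := hg
  have h2 : hᵀ * form n * h = form n := hh
  calc (g * h)ᵀ * form n * (g * h) = hᵀ * (gᵀ * form n * g) * h := by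
        simp only [transpose_mul, mul_assoc]
    _ = form n := by rw [h1, h2]

theorem G_subset : G n ⊆ indefO n := connectedComponentIn_subset _ _

theorem one_mem_indefO : (1 : Mat n) ∈ indefO n := by simp [indefO]

theorem one_mem_G : (1 : Mat n) ∈ G n := mem_connectedComponentIn one_mem_indefO

theorem isClosed_G : IsClosed (G n) := by
  have h : IsClosed (indefO n) := isClosed_eq (by fun_prop) continuous_const
  rw [G, connectedComponentIn_eq_image one_mem_indefO]
  exact h.isClosedEmbedding_subtypeVal.isClosedMap _ isClosed_connectedComponent

/-- A continuous curve in `O(n+1,1)` that starts in `G` stays in `G`. -/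
theorem curve_mem_G {γ : ℝ → Mat n} (hγ : Continuous γ) (h : ∀ t, γ t ∈ indefO n)
    (h0 : γ 0 ∈ G n) (t : ℝ) : γ t ∈ G n := by
  have h1 : Set.range γ ⊆ connectedComponentIn (indefO n) (γ 0) :=
    (isPreconnected_range hγ).subset_connectedComponentIn ⟨0, rfl⟩ (by rintro _ ⟨t, rfl⟩; exact h t)
  have h2 := connectedComponentIn_eq h0
  rw [G, h2]
  exact h1 ⟨t, rfl⟩

theorem continuous_exp_smul (X : Mat n) : Continuous fun t : ℝ => exp (t • X) := by
  refine continuous_iff_continuousAt.2 fun t => ?_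
  let _ : NormedRing (Mat n) := Matrix.linftyOpNormedRing
  let _ : NormedAlgebra ℝ (Mat n) := Matrix.linftyOpNormedAlgebra
  exact (hasDerivAt_matrix_exp X t).continuousAt

theorem exp_mul_mem_G {X g : Mat n} (hX : IsLie X) (hg : g ∈ G n) (t : ℝ) :
    exp (t • X) * g ∈ G n := by
  refine curve_mem_G (γ := fun t => exp (t • X) * g) ((continuous_exp_smul X).mul continuous_const)
    (fun t => indefO_mul (hX.smul t).exp_mem (G_subset hg)) (by simpa using hg) t

theorem mul_exp_mem_G {X g : Mat n} (hX : IsLie X) (hg : g ∈ G n) (t : ℝ) :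
    g * exp (t • X) ∈ G n := by
  refine curve_mem_G (γ := fun t => g * exp (t • X)) (continuous_const.mul (continuous_exp_smul X))
    (fun t => indefO_mul (G_subset hg) (hX.smul t).exp_mem) (by simpa using hg) t

theorem mul_nbarExp_mem_G {g : Mat n} (hg : g ∈ G n) (x : E n) : g * nbarExp x ∈ G n := by
  rw [nbarExp_eq_exp]; simpa using mul_exp_mem_G (isLie_nbarLie x.ofLp) hg 1

theorem mul_nExp_mem_G {g : Mat n} (hg : g ∈ G n) (x : E n) : g * nExp x ∈ G n := by
  rw [nExp_eq_exp]; simpa using mul_exp_mem_G (isLie_nLie x.ofLp) hg 1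

theorem mul_aExp_mem_G {g : Mat n} (hg : g ∈ G n) (t : ℝ) : g * aExp n t ∈ G n :=
  mul_exp_mem_G isLie_H₀ hg t

theorem nbarExp_mem_G (x : E n) : nbarExp x ∈ G n := by
  simpa using mul_nbarExp_mem_G one_mem_G x

theorem embM_mem_indefO (m : SO n) : embM m ∈ indefO n := by
  change (embM m)ᵀ * form n * embM m = form n
  have : form n = fromBlocks 1 0 0 (diagonal ![1, -1]) := by
    rw [form, ← diagonal_one, fromBlocks_diagonal]
  rw [this, embM, fromBlocks_transpose, fromBlocks_multiply, fromBlocks_multiply]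
  simp [transpose_mul_self_SO]

theorem embM_one : embM (1 : SO n) = 1 := by simp [embM]

theorem embM_mul (m m' : SO n) : embM (m * m') = embM m * embM m' := by
  simp [embM, fromBlocks_multiply]

theorem hasDerivAt_embM_rot {A : Matrix (Fin n) (Fin n) ℝ} (hA : Aᵀ = -A) (t : ℝ) :
    HasDerivAt (fun t : ℝ => embM (rot (t • A))) (mLie A * embM (rot (t • A))) t := by
  let _ : NormedRing (Matrix (Fin n) (Fin n) ℝ) := Matrix.linftyOpNormedRing
  let _ : NormedAlgebra ℝ (Matrix (Fin n) (Fin n) ℝ) := Matrix.linftyOpNormedAlgebra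
  let _ : NormedRing (Mat n) := Matrix.linftyOpNormedRing
  let _ : NormedAlgebra ℝ (Mat n) := Matrix.linftyOpNormedAlgebra
  let L : Matrix (Fin n) (Fin n) ℝ →ₗ[ℝ] Mat n :=
    { toFun := mLie
      map_add' := fun A B => by simp [mLie, fromBlocks_add]
      map_smul' := fun c A => by simp [mLie, fromBlocks_smul] }
  have h1 : (fun t : ℝ => embM (rot (t • A))) =
      fun t => L.toContinuousLinearMap (exp (t • A)) + fromBlocks 0 0 0 1 := by
    funext t
    change _ = mLie (exp (t • A)) + fromBlocks 0 0 0 1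
    rw [embM, coe_rot (by simp [hA]), mLie, fromBlocks_add]; simp
  have h2 := (L.toContinuousLinearMap.hasFDerivAt.comp_hasDerivAt t
    (hasDerivAt_matrix_exp' A t)).add_const (fromBlocks 0 0 0 (1 : Matrix (Fin 2) (Fin 2) ℝ))
  rw [h1]
  refine h2.congr_deriv ?_
  change mLie (A * exp (t • A)) = _
  rw [embM, coe_rot (by simp [hA]), mLie, mLie, fromBlocks_multiply]; simp

theorem continuous_embM_rot {A : Matrix (Fin n) (Fin n) ℝ} (hA : Aᵀ = -A) :
    Continuous fun t : ℝ => embM (rot (t • A)) := by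
  refine continuous_iff_continuousAt.2 fun t => ?_
  let _ : NormedRing (Mat n) := Matrix.linftyOpNormedRing
  let _ : NormedAlgebra ℝ (Mat n) := Matrix.linftyOpNormedAlgebra
  exact (hasDerivAt_embM_rot hA t).continuousAt

theorem mul_embM_rot_mem_G {A : Matrix (Fin n) (Fin n) ℝ} (hA : Aᵀ = -A) {g : Mat n}
    (hg : g ∈ G n) (t : ℝ) : g * embM (rot (t • A)) ∈ G n :=
  curve_mem_G (γ := fun t => g * embM (rot (t • A)))
    (continuous_const.mul (continuous_embM_rot hA))
    (fun t => indefO_mul (G_subset hg) (embM_mem_indefO _))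
    (by simpa [rot_zero, embM_one] using hg) t

theorem mul_embM_mem_G {g : Mat n} (hg : g ∈ G n) (m : SO n) : g * embM m ∈ G n := by
  have h := mem_closure_rotations (k := 0) m (fun i hi => absurd hi (by omega))
  induction h using Submonoid.closure_induction generalizing g with
  | mem m hm =>
    obtain ⟨A, hA, -, rfl⟩ := hm
    simpa using mul_embM_rot_mem_G hA hg 1
  | one => simpa [embM_one] using hg
  | mul a b _ _ iha ihb => rw [embM_mul, ← mul_assoc]; exact ihb (iha hg)

end LightCone

/-! ### Functions in the principal series -/

section Principal
variable {n : ℕ} {V : Type*} [NormedAddCommGroup V] [InnerProductSpace ℂ V]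

section
attribute [local instance] Matrix.normedAddCommGroup Matrix.normedSpace

/-- A smooth function on `G` has, at each point, a linear differential that gives its derivatives
along all curves in `G`. The value of the differential off the tangent space is immaterial. -/
theorem SmoothOnG.exists_differential {F : Mat n → V} (hF : SmoothOnG F) {g : Mat n}
    (hg : g ∈ G n) :
    ∃ D : Mat n →ₗ[ℝ] V, ∀ (γ : ℝ → Mat n) (γ' : Mat n), γ 0 = g → (∀ t, γ t ∈ G n) →
      HasDerivAt γ γ' 0 → HasDerivAt (fun t => F (γ t)) (D γ') 0 := by
  have h1 : DifferentiableWithinAt ℝ F (G n) g := (hF g hg).differentiableWithinAt (by simp)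
  obtain ⟨D, hD⟩ := h1
  refine ⟨D.toLinearMap, fun γ γ' h0 hmem hγ => ?_⟩
  exact HasFDerivWithinAt.comp_hasDerivAt_of_eq (0 : ℝ) hD hγ (Filter.Eventually.of_forall hmem)
    h0.symm

theorem hasDerivAt_exp_neg_mul (X g : Mat n) :
    HasDerivAt (fun t : ℝ => exp ((-t) • X) * g) (-(X * g)) 0 := by
  have h := hasDerivAt_matrix_mul (hasDerivAt_matrix_exp (-X) 0) (hasDerivAt_matrix_const g 0)
  simpa using h

theorem hasDerivAt_dLeft_of_differential {F : Mat n → V} {X g : Mat n} (hX : IsLie X)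
    (hg : g ∈ G n) {D : Mat n →ₗ[ℝ] V}
    (hD : ∀ (γ : ℝ → Mat n) (γ' : Mat n), γ 0 = g → (∀ t, γ t ∈ G n) →
      HasDerivAt γ γ' 0 → HasDerivAt (fun t => F (γ t)) (D γ') 0) :
    HasDerivAt (fun t : ℝ => F (exp ((-t) • X) * g)) (D (-(X * g))) 0 :=
  hD (fun t : ℝ => exp ((-t) • X) * g) _ (by simp) (fun t => exp_mul_mem_G hX hg (-t))
    (hasDerivAt_exp_neg_mul X g)

theorem SmoothOnG.dLeft {F : Mat n → V} (hF : SmoothOnG F) {X : Mat n} (hX : IsLie X) :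
    SmoothOnG (dLeft X F) := by
  refine contDiffOn_infty.2 fun k g hg => ?_
  have h1 : ContDiffWithinAt ℝ ((k : WithTop ℕ∞) + 1) F (G n) g :=
    (hF g hg).of_le (by exact_mod_cast le_top)
  obtain ⟨u, hu, huG, -, F', hF', hF's⟩ :=
    (contDiffWithinAt_succ_iff_hasFDerivWithinAt' (by simp)).1 h1
  rw [Set.insert_eq_of_mem hg] at hu huG
  let L : Mat n →ₗ[ℝ] Mat n := -LinearMap.mulLeft ℝ X
  have h2 : ContDiffWithinAt ℝ k (fun g => F' g (L.toContinuousLinearMap g)) (G n) g :=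
    hF's.clm_apply L.toContinuousLinearMap.contDiff.contDiffWithinAt
  refine h2.congr_of_eventuallyEq ?_ ?_
  · filter_upwards [hu] with y hy
    refine (hasDerivAt_dLeft_of_differential hX (huG hy) (D := (F' y).toLinearMap)
      fun γ γ' h0 hmem hγ => ?_).deriv
    exact HasFDerivWithinAt.comp_hasDerivAt_of_eq (0 : ℝ) (hF' y hy) hγ
      (Filter.Eventually.of_forall hmem) h0.symm
  · have hy : g ∈ u := mem_of_mem_nhdsWithin hg hu
    refine (hasDerivAt_dLeft_of_differential hX hg (D := (F' g).toLinearMap)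
      fun γ γ' h0 hmem hγ => ?_).deriv
    exact HasFDerivWithinAt.comp_hasDerivAt_of_eq (0 : ℝ) (hF' g hy) hγ
      (Filter.Eventually.of_forall hmem) h0.symm

theorem contDiff_nbarExp : ContDiff ℝ ∞ (nbarExp : E n → Mat n) := by
  have h : (nbarExp : E n → Mat n) = fun x => 1 + vecMulVec (spatial x.ofLp) (lightP n) +
      vecMulVec (lightQ n) (spatial x.ofLp) +
      (2⁻¹ * (x.ofLp ⬝ᵥ x.ofLp)) • vecMulVec (lightQ n) (lightP n) := funext nbarExp_eq
  rw [h]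
  have hs : ∀ a, ContDiff ℝ ∞ fun x : E n => spatial x.ofLp a := by
    rintro (a | a)
    · change ContDiff ℝ ∞ fun x : E n => x.ofLp a
      fun_prop
    · exact contDiff_const
  have hdot : ContDiff ℝ ∞ fun x : E n => x.ofLp ⬝ᵥ x.ofLp := by
    simp only [dotProduct]; fun_prop
  refine contDiff_pi.2 fun a => contDiff_pi.2 fun b => ?_
  simp only [Matrix.add_apply, Matrix.smul_apply, vecMulVec_apply, smul_eq_mul]
  exact ((contDiff_const.add ((hs a).mul contDiff_const)).add (contDiff_const.mul (hs b))).add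
    ((contDiff_const.mul hdot).mul contDiff_const)

theorem SmoothOnG.contDiff_nonCompact {F : Mat n → V} (hF : SmoothOnG F) :
    ContDiff ℝ ∞ (nonCompact F) :=
  ContDiffOn.comp_contDiff hF contDiff_nbarExp nbarExp_mem_G

/-- Smooth functions on `G` are bounded on the maximal compact subgroup. -/
theorem SmoothOnG.exists_bound_orthogonal {F : Mat n → V} (hF : SmoothOnG F) :
    ∃ C : ℝ, 0 ≤ C ∧ ∀ k ∈ G n, kᵀ * k = 1 → ‖F k‖ ≤ C := by
  have hc : IsCompact (G n ∩ {k | kᵀ * k = 1}) := by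
    refine Metric.isCompact_of_isClosed_isBounded
      (isClosed_G.inter (isClosed_eq (by fun_prop) continuous_const)) ?_
    refine (Metric.isBounded_closedBall (x := (0 : Mat n)) (r := 1)).subset ?_
    rintro k ⟨-, hk⟩
    rw [mem_closedBall_zero_iff, Matrix.norm_le_iff zero_le_one]
    intro i j
    exact entry_norm_bound_of_unitary (U := k)
      (Matrix.mem_unitaryGroup_iff'.2 (by simpa [star_eq_conjTranspose] using hk)) i j
  obtain ⟨C, hC⟩ := hc.exists_bound_of_continuousOn (hF.continuousOn.mono Set.inter_subset_left)
  exact ⟨max C 0, le_max_right _ _, fun k hk h => (hC k ⟨hk, h⟩).trans (le_max_left _ _)⟩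

end

variable {σ : Representation ℂ (SO n) V} {lam : ℂ} {F : Mat n → V}

theorem IsPrincipal.aExp (hF : IsPrincipal σ lam F) {g : Mat n} (hg : g ∈ G n) (t : ℝ) :
    F (g * aExp n t) = Complex.exp (-(lam + (n : ℂ) / 2) * t) • F g := by
  have := hF.equivariant g hg 1 t 0
  simpa [embM_one, nExp] using this

theorem IsPrincipal.embM (hF : IsPrincipal σ lam F) {g : Mat n} (hg : g ∈ G n) (m : SO n) :
    F (g * FPicture.embM m) = σ m⁻¹ (F g) := by
  have := hF.equivariant g hg m 0 0
  simpa [FPicture.aExp, nExp] using this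

theorem IsPrincipal.nExp (hF : IsPrincipal σ lam F) {g : Mat n} (hg : g ∈ G n) (x : E n) :
    F (g * nExp x) = F g := by
  have := hF.equivariant g hg 1 0 x
  simpa [embM_one, FPicture.aExp] using this

/-- The Lie algebra of `G` acts on the principal series. -/
theorem IsPrincipal.dLeft [FiniteDimensional ℂ V] (hF : IsPrincipal σ lam F) {X : Mat n}
    (hX : IsLie X) : IsPrincipal σ lam (dLeft X F) where
  smooth := hF.smooth.dLeft hX
  equivariant g hg m t x := by
    obtain ⟨D, hD⟩ := hF.smooth.exists_differential hg
    have h1 := hasDerivAt_dLeft_of_differential hX hg hD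
    have h2 : FPicture.dLeft X F g = D (-(X * g)) := h1.deriv
    have h3 : (fun s : ℝ => F (exp ((-s) • X) * (g * (FPicture.embM m * FPicture.aExp n t *
        FPicture.nExp x)))) =
        fun s => Complex.exp (-(lam + (n : ℂ) / 2) * t) • σ m⁻¹ (F (exp ((-s) • X) * g)) := by
      funext s
      rw [← mul_assoc, hF.equivariant _ (exp_mul_mem_G hX hg (-s))]
    let A : V →L[ℂ] V := (Complex.exp (-(lam + (n : ℂ) / 2) * t) • σ m⁻¹).toContinuousLinearMap
    have h4 := (A.restrictScalars ℝ).hasFDerivAt.comp_hasDerivAt (0 : ℝ) h1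
    rw [FPicture.dLeft, h3, h2]
    exact h4.deriv

/-! ### Growth in the non-compact picture -/

/-- The `K`-part in the Iwasawa decomposition of `n̄_x`: the product `n̄_x a n_x` with `a = exp
(-log (1 + |x|²) H₀)` fixes `e_{n+2}`. -/
theorem mulVec_sphere (x : E n) : (nbarExp x * (FPicture.aExp n (-Real.log (1 + x.ofLp ⬝ᵥ x.ofLp)) *
    FPicture.nExp x)) *ᵥ (lightP n + lightQ n) = lightP n + lightQ n := by
  have hs : 0 ≤ x.ofLp ⬝ᵥ x.ofLp := by
    simpa [dotProduct] using Finset.sum_nonneg fun i _ => mul_self_nonneg (x.ofLp i)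
  set s := x.ofLp ⬝ᵥ x.ofLp with hsdef
  have h1 : FPicture.nExp x *ᵥ (lightP n + lightQ n) =
      (1 + s) • lightP n + lightQ n - (2 : ℝ) • spatial x.ofLp := by
    rw [nExp_eq]
    simp [add_mulVec, sub_mulVec, mulVec_add, smul_mulVec, vecMulVec_mulVec, ← hsdef]
    ext a
    simp
    ring
  have h2 : FPicture.aExp n (-Real.log (1 + s)) *ᵥ
      ((1 + s) • lightP n + lightQ n - (2 : ℝ) • spatial x.ofLp) =
      lightP n + (1 + s) • lightQ n - (2 : ℝ) • spatial x.ofLp := by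
    rw [aExp_eq, neg_neg, Real.exp_neg, Real.exp_log (by linarith)]
    simp [add_mulVec, mulVec_add, mulVec_sub, mulVec_smul, smul_mulVec, vecMulVec_mulVec]
    have h3 : (1 + s) * (1 + s)⁻¹ = 1 := mul_inv_cancel₀ (by linarith)
    ext a
    simp
    linear_combination (lightP n a) * h3
  rw [← mulVec_mulVec, ← mulVec_mulVec, h1, h2, nbarExp_eq]
  simp [add_mulVec, mulVec_add, mulVec_sub, mulVec_smul, smul_mulVec, vecMulVec_mulVec, ← hsdef]
  ext a
  simp
  ring

/-- An element of `O(n+1,1)` that fixes `e_{n+2}` is orthogonal. -/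
theorem transpose_mul_self_of_fix {k : Mat n} (hk : k ∈ indefO n)
    (h : k *ᵥ (lightP n + lightQ n) = lightP n + lightQ n) : kᵀ * k = 1 := by
  set w := lightP n + lightQ n with hw
  have hk' : kᵀ * form n * k = form n := hk
  have hfw : form n *ᵥ w = -w := by
    rw [hw, mulVec_add, form_mulVec_lightP, form_mulVec_lightQ]; abel
  have hform : form n = 1 - (2⁻¹ : ℝ) • vecMulVec w w := by
    rw [hw, lightP_add_lightQ]
    ext (a | a) (b | b)
    · simp [form, vecMulVec_apply, Matrix.one_apply, Matrix.diagonal_apply]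
    · simp [form, vecMulVec_apply]
    · simp [form, vecMulVec_apply]
    · fin_cases a <;> fin_cases b <;> simp [form, vecMulVec_apply]; norm_num
  have h2 : kᵀ *ᵥ w = w := by
    have : kᵀ *ᵥ (form n *ᵥ (k *ᵥ w)) = form n *ᵥ w := by
      rw [mulVec_mulVec, mulVec_mulVec, hk']
    rw [h, hfw, mulVec_neg] at this
    exact neg_injective this
  have h3 : kᵀ * vecMulVec w w * k = vecMulVec w w := by
    rw [mul_vecMulVec, h2, vecMulVec_mul, ← mulVec_transpose, h2]
  have h4 := hk'
  rw [hform, mul_sub, sub_mul, mul_one, mul_smul_comm, smul_mul_assoc, h3] at h4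
  exact sub_left_injective h4

/-- The function `x ↦ F(n̄_x)` grows at most polynomially: `n̄_x = k a n` with `k` in the maximal
compact subgroup and with `a = exp (log (1 + |x|²) H₀)`. -/
theorem IsPrincipal.growth (hF : IsPrincipal σ lam F) :
    ∃ (C : ℝ) (k : ℕ), 0 ≤ C ∧ ∀ x, ‖nonCompact F x‖ ≤ C * (1 + ‖x‖) ^ k := by
  obtain ⟨C, hC0, hC⟩ := hF.smooth.exists_bound_orthogonal
  set c := (lam + (n : ℂ) / 2).re with hc
  refine ⟨C, 2 * ⌈|c|⌉₊, hC0, fun x => ?_⟩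
  set s := x.ofLp ⬝ᵥ x.ofLp with hsdef
  have hsn : s = ‖x‖ ^ 2 := by
    rw [EuclideanSpace.norm_sq_eq]; simp [hsdef, dotProduct, sq]
  have hs : 0 ≤ s := by rw [hsn]; positivity
  set t := -Real.log (1 + s) with ht
  set k := nbarExp x * (FPicture.aExp n t * FPicture.nExp x) with hk
  have hkG : k ∈ G n := by
    rw [hk, ← mul_assoc]
    exact mul_nExp_mem_G (mul_aExp_mem_G (nbarExp_mem_G x) t) x
  have hk1 : F k = Complex.exp (-(lam + (n : ℂ) / 2) * t) • nonCompact F x := by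
    rw [hk, ← mul_assoc, hF.nExp (mul_aExp_mem_G (nbarExp_mem_G x) t), hF.aExp (nbarExp_mem_G x)]
    rfl
  have hkb := hC k hkG (transpose_mul_self_of_fix (G_subset hkG) (mulVec_sphere x))
  have h2 : nonCompact F x = Complex.exp ((lam + (n : ℂ) / 2) * t) • F k := by
    rw [hk1, smul_smul, ← Complex.exp_add, neg_mul, add_neg_cancel, Complex.exp_zero, one_smul]
  have h3 : ‖Complex.exp ((lam + (n : ℂ) / 2) * t)‖ ≤ (1 + s) ^ ⌈|c|⌉₊ := by
    rw [Complex.norm_exp, Complex.re_mul_ofReal, ← hc]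
    have hlog : 0 ≤ Real.log (1 + s) := Real.log_nonneg (by linarith)
    calc Real.exp (c * t) ≤ Real.exp (⌈|c|⌉₊ * Real.log (1 + s)) := by
          refine Real.exp_le_exp.2 ?_
          rw [ht]
          have h5 : -c ≤ ⌈|c|⌉₊ := (neg_le_abs c).trans (Nat.le_ceil _)
          nlinarith
      _ = (1 + s) ^ ⌈|c|⌉₊ := by
          rw [Real.exp_nat_mul, Real.exp_log (by linarith)]
  have h4 : 1 + s ≤ (1 + ‖x‖) ^ 2 := by rw [hsn]; nlinarith [norm_nonneg x]
  rw [h2, norm_smul, mul_comm, pow_mul]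
  exact mul_le_mul hkb (h3.trans (pow_le_pow_left₀ (by linarith) h4 _)) (norm_nonneg _) hC0

end Principal

/-! ### The differential of `σ` -/

section Differential
variable {n : ℕ} {V : Type*} [NormedAddCommGroup V] [InnerProductSpace ℂ V]

/-- The action of `A ∈ so(n)`, written as `½ ∑ A_ab (E_ab - E_ba)`, by operators `S_ab` that
represent the matrices `E_ab - E_ba`. -/
noncomputable def soAct (S : Fin n → Fin n → V →ₗ[ℂ] V) (A : Matrix (Fin n) (Fin n) ℝ) :
    V →ₗ[ℂ] V :=
  (2⁻¹ : ℂ) • ∑ a, ∑ b, (A a b : ℂ) • S a b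

/-- The operators `S_ab` are the values of the differential of `σ` on `E_ab - E_ba ∈ so(n)`. -/
structure IsDifferential (σ : Representation ℂ (SO n) V) (S : Fin n → Fin n → V →ₗ[ℂ] V) :
    Prop where
  antisymm : ∀ a b, S a b = -S b a
  hasDerivAt_zero : ∀ A : Matrix (Fin n) (Fin n) ℝ, Aᵀ = -A → ∀ v,
    HasDerivAt (fun t : ℝ => σ (rot (t • A)) v) (soAct S A v) 0

variable {σ : Representation ℂ (SO n) V} {lam : ℂ} {F : Mat n → V}

theorem IsIrredUnitary.eq_bot_or_eq_top (hσ : IsIrredUnitary σ) (U : Submodule ℂ V)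
    (hU : ∀ m, U.map (σ m) ≤ U) : U = ⊥ ∨ U = ⊤ := by
  let W : Subrepresentation σ := ⟨U, fun m v hv => hU m ⟨v, hv, rfl⟩⟩
  have := hσ.irreducible
  rcases IsSimpleOrder.eq_bot_or_eq_top W with h | h
  · left; exact congrArg Subrepresentation.toSubmodule h
  · right; exact congrArg Subrepresentation.toSubmodule h

/-- A nonzero function in the principal series shows that `σ` is differentiable: its values span
`V`, and `σ(m)⁻¹ F(g) = F(g m)` depends smoothly on `m`. -/
theorem IsPrincipal.exists_isDifferential [FiniteDimensional ℂ V] (hσ : IsIrredUnitary σ)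
    (hF : IsPrincipal σ lam F) {g₀ : Mat n} (hg₀ : g₀ ∈ G n) (h0 : F g₀ ≠ 0) :
    ∃ S, IsDifferential σ S := by
  -- the span of the values is invariant, as `σ(m) F(g) = F(g m⁻¹)`
  have hspan : Submodule.span ℂ (F '' G n) = ⊤ := by
    refine (hσ.eq_bot_or_eq_top _ fun m => ?_).resolve_left fun h => ?_
    · rw [Submodule.map_span_le]
      rintro _ ⟨g, hg, rfl⟩
      refine Submodule.subset_span ⟨g * FPicture.embM m⁻¹, mul_embM_mem_G hg _, ?_⟩
      rw [hF.embM hg, inv_inv]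
    · exact h0 (Submodule.span_eq_bot.1 h _ ⟨g₀, hg₀, rfl⟩)
  -- the vectors at which `σ` has a linear differential form a subspace that contains all values
  have key : ∀ v : V, ∃ D : Matrix (Fin n) (Fin n) ℝ →ₗ[ℝ] V, ∀ A, Aᵀ = -A →
      HasDerivAt (fun t : ℝ => σ (rot (t • A)) v) (D A) 0 := by
    intro v
    have hv : v ∈ Submodule.span ℂ (F '' G n) := hspan ▸ Submodule.mem_top
    induction hv using Submodule.span_induction with
    | mem v hv =>
      obtain ⟨g, hg, rfl⟩ := hv
      obtain ⟨D, hD⟩ := hF.smooth.exists_differential hg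
      let L : Matrix (Fin n) (Fin n) ℝ →ₗ[ℝ] Mat n :=
        { toFun := fun A => -(g * mLie A)
          map_add' := fun A B => by
            rw [mLie, mLie, mLie, ← neg_add, ← mul_add, fromBlocks_add]; simp
          map_smul' := fun c A => by
            rw [mLie, mLie, RingHom.id_apply, smul_neg, ← mul_smul_comm, fromBlocks_smul]; simp }
      refine ⟨D ∘ₗ L, fun A hA => ?_⟩
      have hnA : (-A)ᵀ = -(-A) := by simp [hA]
      have h1 := hD (fun t => g * FPicture.embM (rot (t • (-A)))) (-(g * mLie A))
        (by simp [rot_zero, embM_one]) (mul_embM_rot_mem_G hnA hg) (by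
          have := hasDerivAt_matrix_mul (hasDerivAt_matrix_const g 0) (hasDerivAt_embM_rot hnA 0)
          rw [zero_smul, rot_zero, embM_one, zero_mul, zero_add] at this
          have h2 : mLie (-A) = -mLie A := by ext (i | i) (k | k) <;> simp [mLie]
          have h3 : g * (mLie (-A) * 1) = -(g * mLie A) := by rw [h2, mul_one, mul_neg]
          rw [← h3]; exact this)
      refine h1.congr_of_eventuallyEq (Filter.Eventually.of_forall fun t => ?_)
      change _ = F (g * FPicture.embM (rot (t • (-A))))
      rw [hF.embM hg, smul_neg, rot_neg (by simp [hA]), inv_inv]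
    | zero => exact ⟨0, fun A _ => by simpa using hasDerivAt_const (0 : ℝ) (0 : V)⟩
    | add v w _ _ hv hw =>
      obtain ⟨D, hD⟩ := hv
      obtain ⟨D', hD'⟩ := hw
      exact ⟨D + D', fun A hA => by simpa using (hD A hA).fun_add (hD' A hA)⟩
    | smul c v _ hv =>
      obtain ⟨D, hD⟩ := hv
      refine ⟨⟨⟨fun A => c • D A, fun A B => by simp⟩, fun r A => by
        simp [smul_comm r c]⟩, fun A hA => by simpa using (hD A hA).fun_const_smul c⟩
  choose D hD using key
  -- the differentials depend on choices for matrices that are not skew-symmetric, hence `S_ab` is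
  -- defined by their values on `E_ab - E_ba`
  let B : Fin n → Fin n → Matrix (Fin n) (Fin n) ℝ :=
    fun a b => Matrix.single a b 1 - Matrix.single b a 1
  have hB : ∀ a b, (B a b)ᵀ = -B a b := fun a b => by simp [B]
  let S : Fin n → Fin n → V →ₗ[ℂ] V := fun a b =>
    { toFun := fun v => D v (B a b)
      map_add' := fun v w => (hD (v + w) _ (hB a b)).unique (by
        simpa using (hD v _ (hB a b)).fun_add (hD w _ (hB a b)))
      map_smul' := fun c v => (hD (c • v) _ (hB a b)).unique (by
        simpa using (hD v _ (hB a b)).fun_const_smul c) }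
  refine ⟨S, fun a b => ?_, fun A hA v => (hD v A hA).congr_deriv ?_⟩
  · ext v
    change D v (B a b) = -D v (B b a)
    rw [← map_neg]; congr 1; simp [B]
  · have h1 : A = (2⁻¹ : ℝ) • ∑ a, ∑ b, A a b • B a b := by
      have h2 : ∑ a, ∑ b, A a b • B a b = A - Aᵀ := by
        have h3 : ∀ M : Matrix (Fin n) (Fin n) ℝ, ∑ a, ∑ b, M a b • Matrix.single a b (1 : ℝ) = M :=
          fun M => by
            conv_rhs => rw [Matrix.matrix_eq_sum_single M]
            simp
        have h4 : ∑ a, ∑ b, A a b • Matrix.single b a (1 : ℝ) = Aᵀ := by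
          rw [Finset.sum_comm, ← h3 Aᵀ]; rfl
        simp only [B, smul_sub, Finset.sum_sub_distrib, h3, h4]
      rw [h2, hA]; ext i j; simp; ring
    conv_lhs => rw [h1]
    rw [map_smul, map_sum, soAct]
    simp only [map_sum, map_smul, LinearMap.smul_apply, LinearMap.sum_apply]
    have h5 : ∀ (r : ℝ) (w : V), r • w = (r : ℂ) • w := fun r w => (Complex.coe_smul r w).symm
    simp only [h5, Complex.ofReal_inv, Complex.ofReal_ofNat]
    rfl

/-! ### The action of `N̄_j` and `N_j` in the non-compact picture -/

theorem hasDerivAt_mul_exp (X g : Mat n) :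
    HasDerivAt (fun t : ℝ => g * exp (t • X)) (g * X) 0 := by
  have h := hasDerivAt_matrix_mul (hasDerivAt_matrix_const g 0) (hasDerivAt_matrix_exp X 0)
  simpa using h

theorem nbarLie_commute (x y : Fin n → ℝ) : Commute (nbarLie x) (nbarLie y) := by
  simp [Commute, SemiconjBy, nbarLie, mul_add, add_mul, vecMulVec_mul_vecMulVec,
    dotProduct_comm x y]

theorem nbarExp_mul_exp (x y : E n) (t : ℝ) :
    nbarExp x * exp (t • nbarLie y.ofLp) = nbarExp (x + t • y) := by
  rw [nbarExp_eq_exp, nbarExp_eq_exp, ← nbarLie_smul, ← Matrix.exp_add_of_commute _ _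
    (nbarLie_commute _ _), ← nbarLie_add]
  rfl

/-- The differential of `F` at `n̄_x` in the directions of `𝔫̄`, `𝔞`, `𝔫` and `𝔪`. -/
theorem IsPrincipal.differential_apply [FiniteDimensional ℂ V] (hF : IsPrincipal σ lam F)
    {S : Fin n → Fin n → V →ₗ[ℂ] V} (hS : IsDifferential σ S) (x : E n) {D : Mat n →ₗ[ℝ] V}
    (hD : ∀ (γ : ℝ → Mat n) (γ' : Mat n), γ 0 = nbarExp x → (∀ t, γ t ∈ G n) →
      HasDerivAt γ γ' 0 → HasDerivAt (fun t => F (γ t)) (D γ') 0) :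
    (∀ y : E n, D (nbarExp x * nbarLie y.ofLp) = fderiv ℝ (nonCompact F) x y) ∧
    D (nbarExp x * H₀ n) = -(lam + (n : ℂ) / 2) • nonCompact F x ∧
    (∀ y : E n, D (nbarExp x * nLie y.ofLp) = 0) ∧
    ∀ A : Matrix (Fin n) (Fin n) ℝ, Aᵀ = -A →
      D (nbarExp x * mLie A) = -soAct S A (nonCompact F x) := by
  have hx := nbarExp_mem_G x
  refine ⟨fun y => ?_, ?_, fun y => ?_, fun A hA => ?_⟩
  · have h1 := hD (fun t : ℝ => nbarExp x * exp (t • nbarLie y.ofLp)) _ (by simp)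
      (mul_exp_mem_G (isLie_nbarLie _) hx) (hasDerivAt_mul_exp _ _)
    simp only [nbarExp_mul_exp] at h1
    have h2 : HasDerivAt (fun t : ℝ => x + t • y) y 0 := by
      simpa using ((hasDerivAt_id (0 : ℝ)).smul_const y).const_add x
    have h3 : DifferentiableAt ℝ (nonCompact F) x :=
      hF.smooth.contDiff_nonCompact.differentiable (by simp) x
    exact h1.unique (h3.hasFDerivAt.comp_hasDerivAt_of_eq (0 : ℝ) h2 (by simp))
  · have h1 := hD (fun t : ℝ => nbarExp x * exp (t • H₀ n)) _ (by simp)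
      (mul_exp_mem_G isLie_H₀ hx) (hasDerivAt_mul_exp _ _)
    have h2 : (fun t : ℝ => F (nbarExp x * exp (t • H₀ n))) =
        fun t : ℝ => Complex.exp (-(lam + (n : ℂ) / 2) * t) • nonCompact F x :=
      funext fun t => hF.aExp hx t
    rw [h2] at h1
    refine h1.unique ?_
    have h3 : HasDerivAt (fun t : ℝ => Complex.exp (-(lam + (n : ℂ) / 2) * t))
        (-(lam + (n : ℂ) / 2)) 0 := by
      have := (((Complex.ofRealCLM.hasDerivAt (x := (0 : ℝ))).const_mul
        (-(lam + (n : ℂ) / 2))).cexp)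
      simpa using this
    exact h3.smul_const _
  · have h1 := hD (fun t : ℝ => nbarExp x * exp (t • nLie y.ofLp)) _ (by simp)
      (mul_exp_mem_G (isLie_nLie _) hx) (hasDerivAt_mul_exp _ _)
    have h2 : (fun t : ℝ => F (nbarExp x * exp (t • nLie y.ofLp))) = fun _ => F (nbarExp x) := by
      funext t
      rw [← nLie_smul]
      have := hF.nExp hx (t • y)
      rwa [nExp_eq_exp] at this
    rw [h2] at h1
    exact h1.unique (hasDerivAt_const _ _)
  · have hnA : (-A)ᵀ = -(-A) := by simp [hA]
    have h1 := hD (fun t => nbarExp x * FPicture.embM (rot (t • A))) (nbarExp x * mLie A)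
      (by simp [rot_zero, embM_one]) (mul_embM_rot_mem_G hA hx) (by
        have := hasDerivAt_matrix_mul (hasDerivAt_matrix_const (nbarExp x) 0)
          (hasDerivAt_embM_rot hA 0)
        simpa [rot_zero, embM_one] using this)
    have h2 : (fun t : ℝ => F (nbarExp x * FPicture.embM (rot (t • A)))) =
        fun t => σ (rot (t • (-A))) (nonCompact F x) := by
      funext t
      rw [hF.embM hx, smul_neg, rot_neg (by simp [hA])]; rfl
    rw [h2] at h1
    have h3 : soAct S (-A) (nonCompact F x) = -soAct S A (nonCompact F x) := by
      simp [soAct]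
    rw [← h3]
    exact h1.unique (hS.hasDerivAt_zero _ hnA _)

theorem IsPrincipal.dLeft_nbarLie [FiniteDimensional ℂ V] (hF : IsPrincipal σ lam F)
    {S : Fin n → Fin n → V →ₗ[ℂ] V} (hS : IsDifferential σ S) (x y : E n) :
    nonCompact (FPicture.dLeft (nbarLie y.ofLp) F) x = -fderiv ℝ (nonCompact F) x y := by
  have hx := nbarExp_mem_G x
  obtain ⟨D, hD⟩ := hF.smooth.exists_differential hx
  have h1 : nonCompact (FPicture.dLeft (nbarLie y.ofLp) F) x = _ :=
    (hasDerivAt_dLeft_of_differential (isLie_nbarLie y.ofLp) hx hD).deriv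
  obtain ⟨h2, -⟩ := hF.differential_apply hS x hD
  rw [h1, ← h2, map_neg]
  congr 2
  -- `𝔫̄` is commutative, so left and right translation by `exp (N̄(y))` agree at `n̄_x`
  rw [nbarExp_eq_exp]
  let _ : NormedRing (Mat n) := Matrix.linftyOpNormedRing
  let _ : NormedAlgebra ℝ (Mat n) := Matrix.linftyOpNormedAlgebra
  exact ((nbarLie_commute y.ofLp x.ofLp).exp_right).eq

/-- The decomposition of `Ad(n̄_x)⁻¹ N_j` along `𝔫̄ ⊕ 𝔞 ⊕ 𝔪 ⊕ 𝔫`. -/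
theorem N_mul_nbarExp (j : Fin n) (x : E n) :
    -(N j * nbarExp x) = nbarExp x *
      (nbarLie ((x.ofLp ⬝ᵥ x.ofLp) • Pi.single j 1 - (2 * x j) • x.ofLp) + (2 * x j) • H₀ n +
        mLie ((2 : ℝ) • (vecMulVec (Pi.single j 1) x.ofLp - vecMulVec x.ofLp (Pi.single j 1))) -
        nLie (Pi.single j 1)) := by
  have hm : ∀ u v : Fin n → ℝ, mLie ((2 : ℝ) • (vecMulVec u v - vecMulVec v u)) =
      (2 : ℝ) • (vecMulVec (spatial u) (spatial v) - vecMulVec (spatial v) (spatial u)) := by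
    intro u v
    ext (a | a) (b | b) <;> simp [mLie, spatial, vecMulVec_apply]
  have hxj : x.ofLp ⬝ᵥ Pi.single j 1 = x j := by simp
  have hjx : Pi.single j 1 ⬝ᵥ x.ofLp = x j := by simp
  have hsub : ∀ (a b : ℝ) (u v : Fin n → ℝ),
      nbarLie (a • u - b • v) = a • nbarLie u - b • nbarLie v := fun a b u v => by
    rw [sub_eq_add_neg, ← neg_smul, nbarLie_add, nbarLie_smul, nbarLie_smul]; module
  rw [hm, ← nLie_single, hsub, H₀_eq, nbarExp_eq, nLie]
  generalize (Pi.single j 1 : Fin n → ℝ) = e at *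
  generalize x.ofLp = y at *
  set c := x j
  simp only [nbarLie, mul_add, add_mul, mul_sub, sub_mul, mul_smul_comm, smul_mul_assoc, one_mul,
    mul_one, neg_mul, mul_neg, vecMulVec_mul_vecMulVec, lightP_dot_lightP, lightQ_dot_lightQ,
    lightP_dot_lightQ, spatial_dot_lightP, spatial_dot_lightQ,
    lightP_dot_spatial, lightQ_dot_spatial, spatial_dot_spatial, hxj, hjx, zero_smul,
    vecMulVec_zero, vecMulVec_smul, smul_zero, add_zero, sub_zero, neg_zero, zero_sub]
  module

theorem soAct_vecMulVec {S : Fin n → Fin n → V →ₗ[ℂ] V} (hS : ∀ a b, S a b = -S b a) (j : Fin n)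
    (x : Fin n → ℝ) :
    soAct S ((2 : ℝ) • (vecMulVec (Pi.single j 1) x - vecMulVec x (Pi.single j 1))) =
      (2 : ℂ) • ∑ k, (x k : ℂ) • S j k := by
  have h1 : ∀ a b, ((((2 : ℝ) • (vecMulVec (Pi.single j 1) x -
      vecMulVec x (Pi.single j 1) : Matrix (Fin n) (Fin n) ℝ)) a b : ℝ) : ℂ) • S a b =
      (2 : ℂ) • ((if a = j then (x b : ℂ) • S a b else 0) -
        (if b = j then (x a : ℂ) • S a b else 0)) := by
    intro a b
    by_cases ha : a = j <;> by_cases hb : b = j <;>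
      simp [vecMulVec_apply, ha, hb, mul_smul]
  simp only [soAct, h1, ← Finset.smul_sum, Finset.sum_sub_distrib]
  rw [Finset.sum_comm (f := fun a b => if a = j then (x b : ℂ) • S a b else 0)]
  simp only [Finset.sum_ite_eq', Finset.mem_univ, if_true]
  rw [Finset.sum_congr rfl fun a _ => show (x a : ℂ) • S a j = -((x a : ℂ) • S j a) by
    rw [hS a j, smul_neg], Finset.sum_neg_distrib]
  module

/-- The first-order differential operator by which `N_j` acts in the non-compact picture. -/
theorem IsPrincipal.dLeft_N [FiniteDimensional ℂ V] (hF : IsPrincipal σ lam F)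
    {S : Fin n → Fin n → V →ₗ[ℂ] V} (hS : IsDifferential σ S) (j : Fin n) (x : E n) :
    nonCompact (FPicture.dLeft (N j) F) x =
      (∑ k, ((x k : ℂ) * x k) • partialDeriv j (nonCompact F) x)
      - (2 : ℂ) • (∑ k, ((x j : ℂ) * x k) • partialDeriv k (nonCompact F) x)
      - ((2 * lam + n) * x j) • nonCompact F x
      - (2 : ℂ) • ∑ k, S j k ((x k : ℂ) • nonCompact F x) := by
  have hx := nbarExp_mem_G x
  obtain ⟨D, hD⟩ := hF.smooth.exists_differential hx
  have hlie : IsLie (N j : Mat n) := by rw [← nLie_single]; exact isLie_nLie _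
  have h1 : nonCompact (FPicture.dLeft (N j) F) x = _ :=
    (hasDerivAt_dLeft_of_differential hlie hx hD).deriv
  obtain ⟨h2, h3, h4, h5⟩ := hF.differential_apply hS x hD
  have h4' := h4 (WithLp.toLp 2 (Pi.single j 1))
  have h2' := h2 (WithLp.toLp 2 ((x.ofLp ⬝ᵥ x.ofLp) • Pi.single j 1 - (2 * x j) • x.ofLp))
  have hA : ((2 : ℝ) • (vecMulVec (Pi.single j 1) x.ofLp - vecMulVec x.ofLp (Pi.single j 1)))ᵀ =
      -((2 : ℝ) • (vecMulVec (Pi.single j 1) x.ofLp - vecMulVec x.ofLp (Pi.single j 1))) := by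
    rw [transpose_smul, transpose_sub, transpose_vecMulVec, transpose_vecMulVec, ← smul_neg,
      neg_sub]
  have h5' := h5 _ hA
  have hE : (WithLp.toLp 2 ((x.ofLp ⬝ᵥ x.ofLp) • Pi.single j 1 - (2 * x j) • x.ofLp) : E n) =
      (∑ k, x k * x k) • EuclideanSpace.single j 1 -
        (2 : ℝ) • ∑ k, (x j * x k) • EuclideanSpace.single k 1 := by
    ext i
    simp [dotProduct, Finset.sum_apply, Pi.single_apply]
    ring
  have hr : ∀ (r : ℝ) (w : V), r • w = (r : ℂ) • w := fun r w => (Complex.coe_smul r w).symm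
  rw [h1, N_mul_nbarExp, mul_sub, mul_add, mul_add, mul_smul_comm, map_sub, map_add, map_add,
    map_smul, h2', h3, h5', h4', hE, soAct_vecMulVec hS.antisymm]
  simp only [map_sub, map_smul, map_sum, hr, LinearMap.smul_apply, LinearMap.sum_apply]
  rw [Complex.ofReal_sum, Finset.sum_smul]
  simp only [partialDeriv, Complex.ofReal_mul, Complex.ofReal_ofNat]
  module

end Differential
end FPicture

namespace FPicture
open MeasureTheory
open scoped FourierTransform SchwartzMap LineDeriv

/-! ### The Fourier transform of test functions -/

section FourierTest
variable {n : ℕ} {V : Type*} [NormedAddCommGroup V] [InnerProductSpace ℂ V]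

/-- The constant `(2π)^{-n/2}`. -/
noncomputable def fourierConst (n : ℕ) : ℂ := (((2 * Real.pi) ^ (-(n : ℝ) / 2) : ℝ) : ℂ)

theorem fourier_eq_scaled (φ : E n → ℂ) (x : E n) :
    fourier φ x = fourierConst n * 𝓕 φ ((2 * Real.pi)⁻¹ • x) := by
  rw [Real.fourier_eq', fourier, fourierConst]
  congr 2
  funext y
  rw [smul_eq_mul]
  congr 2
  rw [inner_smul_right]
  push_cast
  have : (Real.pi : ℂ) ≠ 0 := by exact_mod_cast Real.pi_ne_zero
  field_simp

/-- The scaling `x ↦ x / 2π`, which relates the two normalizations of the Fourier transform. -/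
noncomputable def scaling (n : ℕ) : E n ≃L[ℝ] E n :=
  ContinuousLinearEquiv.smulLeft (Units.mk0 (2 * Real.pi)⁻¹ (by positivity))

theorem scaling_apply (x : E n) : scaling n x = (2 * Real.pi)⁻¹ • x := rfl

/-- The Fourier transform of a Schwartz function in the normalization `(2π)^{-n/2}`. -/
noncomputable def fourierSchwartz (ψ : 𝓢(E n, ℂ)) : 𝓢(E n, ℂ) :=
  fourierConst n • SchwartzMap.compCLMOfContinuousLinearEquiv ℂ (scaling n) (𝓕 ψ)

theorem coe_fourierSchwartz (ψ : 𝓢(E n, ℂ)) (x : E n) : fourierSchwartz ψ x = fourier ψ x := by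
  rw [fourier_eq_scaled]
  rfl

theorem fourier_fderiv_schwartz (ψ : 𝓢(E n, ℂ)) (m x : E n) :
    fourier (fun y => fderiv ℝ ψ y m) x = Complex.I * (inner ℝ x m : ℝ) * fourier ψ x := by
  have hm : (fun y : E n => (inner ℝ y m : ℝ)).HasTemperateGrowth :=
    ((innerSL ℝ).flip m).hasTemperateGrowth
  have h1 : (fun y => fderiv ℝ ψ y m) = ⇑(∂_{m} ψ : 𝓢(E n, ℂ)) := rfl
  rw [h1, fourier_eq_scaled, fourier_eq_scaled, ← SchwartzMap.fourier_coe,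
    SchwartzMap.fourier_lineDerivOp_eq, smul_apply,
    SchwartzMap.smulLeftCLM_apply_apply hm,
    ← SchwartzMap.fourier_coe]
  simp only [inner_smul_left, smul_eq_mul, Complex.real_smul]
  push_cast
  have : (Real.pi : ℂ) ≠ 0 := by exact_mod_cast Real.pi_ne_zero
  simp only [conj_trivial]
  push_cast
  field_simp

theorem fderiv_fourier_schwartz (ψ : 𝓢(E n, ℂ)) (m x : E n) :
    fderiv ℝ (fourier ψ) x m = -Complex.I * fourier (fun y => (inner ℝ y m : ℝ) * ψ y) x := by
  have hm : (fun y : E n => (inner ℝ y m : ℝ)).HasTemperateGrowth :=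
    ((innerSL ℝ).flip m).hasTemperateGrowth
  have h1 : (fun y => ((inner ℝ y m : ℝ) : ℂ) * ψ y) =
      ⇑(SchwartzMap.smulLeftCLM ℂ (fun y : E n => (inner ℝ y m : ℝ)) ψ) := by
    funext y; rw [SchwartzMap.smulLeftCLM_apply_apply hm, Complex.real_smul]
  have h2 : fourier ψ = fun x => fourierConst n * (𝓕 ψ : 𝓢(E n, ℂ)) (scaling n x) := by
    funext x; rw [fourier_eq_scaled]; rfl
  have h3 : HasFDerivAt (fourier ψ)
      (fourierConst n • (fderiv ℝ (𝓕 ψ : 𝓢(E n, ℂ)) (scaling n x)).comp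
        (scaling n : E n →L[ℝ] E n)) x := by
    rw [h2]
    exact ((((𝓕 ψ : 𝓢(E n, ℂ)).differentiableAt).hasFDerivAt).comp x
      (scaling n).hasFDerivAt).const_mul _
  have h4 : ∀ y, fderiv ℝ (𝓕 ψ : 𝓢(E n, ℂ)) y m = (∂_{m} (𝓕 ψ) : 𝓢(E n, ℂ)) y := fun y => rfl
  rw [h3.fderiv, h1, fourier_eq_scaled]
  change fourierConst n * fderiv ℝ (𝓕 ψ : 𝓢(E n, ℂ)) (scaling n x) (scaling n m) = _
  rw [scaling_apply, scaling_apply, map_smul, h4, SchwartzMap.lineDerivOp_fourier_eq,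
    FourierTransform.fourier_smul, smul_apply, ← SchwartzMap.fourier_coe,
    Complex.real_smul, smul_eq_mul]
  push_cast
  have : (Real.pi : ℂ) ≠ 0 := by exact_mod_cast Real.pi_ne_zero
  field_simp

/-- A test function as a Schwartz function. -/
noncomputable def IsTest.toSchwartz {φ : E n → ℂ} (hφ : IsTest φ) : 𝓢(E n, ℂ) :=
  hφ.compact.toSchwartzMap hφ.smooth

theorem IsTest.coe_toSchwartz {φ : E n → ℂ} (hφ : IsTest φ) : ⇑hφ.toSchwartz = φ := rfl

theorem IsTest.fderiv {φ : E n → ℂ} (hφ : IsTest φ) (m : E n) :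
    IsTest fun y => fderiv ℝ φ y m where
  smooth := (hφ.smooth.fderiv_right (m := ∞) (by simp)).clm_apply contDiff_const
  compact := hφ.compact.fderiv_apply ℝ m
  away h := hφ.away (tsupport_fderiv_apply_subset ℝ m h)

theorem IsTest.coord_mul {φ : E n → ℂ} (hφ : IsTest φ) (k : Fin n) :
    IsTest fun y : E n => (y k : ℂ) * φ y where
  smooth := by
    refine ContDiff.mul ?_ hφ.smooth
    exact Complex.ofRealCLM.contDiff.comp (by fun_prop)
  compact := hφ.compact.mul_left
  away h := hφ.away (tsupport_mul_subset_right h)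

theorem inner_single_right (x : E n) (k : Fin n) :
    inner ℝ x (EuclideanSpace.single k (1 : ℝ)) = x k := by
  rw [PiLp.inner_apply, Finset.sum_eq_single k]
  · simp
  · intro b _ hb; simp [hb]
  · simp

theorem IsTest.fourier_partialDeriv {φ : E n → ℂ} (hφ : IsTest φ) (k : Fin n) (x : E n) :
    fourier (fun y => FPicture.partialDeriv k φ y) x = Complex.I * (x k : ℂ) * fourier φ x := by
  have := fourier_fderiv_schwartz hφ.toSchwartz (EuclideanSpace.single k 1) x
  rwa [inner_single_right, hφ.coe_toSchwartz] at this

theorem IsTest.fourier_coord_mul {φ : E n → ℂ} (hφ : IsTest φ) (k : Fin n) (x : E n) :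
    fourier (fun y => (y k : ℂ) * φ y) x = Complex.I * FPicture.partialDeriv k (fourier φ) x := by
  have := fderiv_fourier_schwartz hφ.toSchwartz (EuclideanSpace.single k 1) x
  simp only [inner_single_right, hφ.coe_toSchwartz] at this
  rw [FPicture.partialDeriv, this, ← mul_assoc]
  simp

/-! ### Functions of at most polynomial growth -/

/-- A continuous function of at most polynomial growth. -/
def ModerateGrowth (g : E n → V) : Prop :=
  Continuous g ∧ ∃ (C : ℝ) (k : ℕ), 0 ≤ C ∧ ∀ x, ‖g x‖ ≤ C * (1 + ‖x‖) ^ k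

theorem ModerateGrowth.integrable {g : E n → V} (hg : ModerateGrowth g) (ψ : 𝓢(E n, ℂ)) :
    Integrable fun x => ψ x • g x := by
  obtain ⟨hc, C, k, hC0, hC⟩ := hg
  have h1 : Integrable fun x : E n => C * 2 ^ k * (‖x‖ ^ 0 * ‖ψ x‖ + ‖x‖ ^ k * ‖ψ x‖) :=
    ((ψ.integrable_pow_mul volume 0).add (ψ.integrable_pow_mul volume k)).const_mul _
  refine h1.mono' ((ψ.continuous.smul hc).aestronglyMeasurable) (Filter.Eventually.of_forall ?_)
  intro x
  rw [norm_smul]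
  have h2 : (1 + ‖x‖) ^ k ≤ 2 ^ k * (‖x‖ ^ 0 + ‖x‖ ^ k) := by
    rcases le_total ‖x‖ 1 with h | h
    · calc (1 + ‖x‖) ^ k ≤ 2 ^ k := pow_le_pow_left₀ (by positivity) (by linarith) _
        _ ≤ _ := by
          have : 0 ≤ (2 : ℝ) ^ k * ‖x‖ ^ k := by positivity
          rw [pow_zero, mul_add]; linarith
    · calc (1 + ‖x‖) ^ k ≤ (2 * ‖x‖) ^ k := pow_le_pow_left₀ (by positivity) (by linarith) _
        _ ≤ _ := by
          have : 0 ≤ (2 : ℝ) ^ k := by positivity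
          rw [pow_zero, mul_add, mul_pow]; linarith
  calc ‖ψ x‖ * ‖g x‖ ≤ ‖ψ x‖ * (C * (2 ^ k * (‖x‖ ^ 0 + ‖x‖ ^ k))) := by
        gcongr
        exact (hC x).trans (by gcongr)
    _ = _ := by ring

theorem ModerateGrowth.integrable_fourier {g : E n → V} (hg : ModerateGrowth g) {φ : E n → ℂ}
    (hφ : IsTest φ) : Integrable fun x => fourier φ x • g x := by
  have := hg.integrable (fourierSchwartz hφ.toSchwartz)
  simpa only [coe_fourierSchwartz, hφ.coe_toSchwartz] using this

theorem ModerateGrowth.coord_smul {g : E n → V} (hg : ModerateGrowth g) (k : Fin n) :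
    ModerateGrowth fun x => (x k : ℂ) • g x := by
  obtain ⟨hc, C, l, hC0, hC⟩ := hg
  refine ⟨Continuous.smul (by fun_prop) hc, C, l + 1, hC0, fun x => ?_⟩
  have h1 : ‖(x k : ℂ)‖ ≤ 1 + ‖x‖ := by
    rw [Complex.norm_real]; exact (PiLp.norm_apply_le x k).trans (by linarith)
  rw [norm_smul, pow_succ, ← mul_assoc, mul_comm]
  exact mul_le_mul (hC x) h1 (norm_nonneg _) (by positivity)

theorem ModerateGrowth.map [FiniteDimensional ℂ V] {g : E n → V} (hg : ModerateGrowth g)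
    (T : V →ₗ[ℂ] V) : ModerateGrowth fun x => T (g x) := by
  obtain ⟨hc, C, l, hC0, hC⟩ := hg
  refine ⟨T.continuous_of_finiteDimensional.comp hc, ‖T.toContinuousLinearMap‖ * C, l,
    by positivity, fun x => ?_⟩
  calc ‖T (g x)‖ ≤ ‖T.toContinuousLinearMap‖ * ‖g x‖ := T.toContinuousLinearMap.le_opNorm _
    _ ≤ _ := by rw [mul_assoc]; gcongr; exact hC x

omit [InnerProductSpace ℂ V] in
theorem ModerateGrowth.add {g g' : E n → V} (hg : ModerateGrowth g) (hg' : ModerateGrowth g') :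
    ModerateGrowth fun x => g x + g' x := by
  obtain ⟨hc, C, k, hC0, hC⟩ := hg
  obtain ⟨hc', C', k', hC0', hC'⟩ := hg'
  refine ⟨hc.add hc', C + C', k + k', by positivity, fun x => (norm_add_le _ _).trans ?_⟩
  have h1 : (1 : ℝ) ≤ 1 + ‖x‖ := by linarith [norm_nonneg x]
  rw [add_mul]
  refine add_le_add ((hC x).trans ?_) ((hC' x).trans ?_)
  · gcongr; omega
  · gcongr; omega

theorem ModerateGrowth.const_smul {g : E n → V} (hg : ModerateGrowth g) (c : ℂ) :
    ModerateGrowth fun x => c • g x := by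
  obtain ⟨hc, C, k, hC0, hC⟩ := hg
  refine ⟨hc.const_smul c, ‖c‖ * C, k, by positivity, fun x => ?_⟩
  rw [norm_smul, mul_assoc]
  gcongr
  exact hC x

omit [InnerProductSpace ℂ V] in
theorem ModerateGrowth.zero : ModerateGrowth fun _ : E n => (0 : V) :=
  ⟨continuous_const, 0, 0, le_rfl, by simp⟩

omit [InnerProductSpace ℂ V] in
theorem ModerateGrowth.sum {ι : Type*} (s : Finset ι) {g : ι → E n → V}
    (hg : ∀ i, ModerateGrowth (g i)) : ModerateGrowth fun x => ∑ i ∈ s, g i x := by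
  classical
  induction s using Finset.induction_on with
  | empty => simpa using ModerateGrowth.zero
  | insert a s ha ih =>
    simp only [Finset.sum_insert ha]
    exact (hg a).add ih

/-! ### Rules for the Fourier transform on `ℝⁿ ∖ {0}` -/

theorem IsTest.continuous_smul {φ : E n → ℂ} (hφ : IsTest φ) {f : E n → V}
    (hf : ContinuousOn f {0}ᶜ) : Continuous fun x => φ x • f x := by
  rw [continuous_iff_continuousAt]
  intro x
  by_cases hx : x ∈ tsupport φ
  · have hx0 : x ≠ 0 := fun h => hφ.away (h ▸ hx)
    exact hφ.smooth.continuous.continuousAt.smul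
      (hf.continuousAt (isOpen_compl_singleton.mem_nhds hx0))
  · have h1 : (fun x => φ x • f x) =ᶠ[nhds x] fun _ => 0 := by
      filter_upwards [(isClosed_tsupport φ).isOpen_compl.mem_nhds hx] with y hy
      rw [image_eq_zero_of_notMem_tsupport hy, zero_smul]
    exact continuousAt_const.congr h1.symm

theorem IsTest.integrable_smul {φ : E n → ℂ} (hφ : IsTest φ) {f : E n → V}
    (hf : ContinuousOn f {0}ᶜ) : Integrable fun x => φ x • f x :=
  (hφ.continuous_smul hf).integrable_of_hasCompactSupport hφ.compact.smul_right

theorem contDiffOn_partialDeriv {f : E n → V} (hf : ContDiffOn ℝ ∞ f {0}ᶜ) (k : Fin n) :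
    ContDiffOn ℝ ∞ (partialDeriv k f) {0}ᶜ :=
  (hf.fderiv_of_isOpen isOpen_compl_singleton (m := ∞) (by simp)).clm_apply contDiffOn_const

theorem IsFourierImage.congr {g f f' : E n → V} (h : IsFourierImage g f)
    (hf : ∀ ξ, ξ ≠ 0 → f' ξ = f ξ) : IsFourierImage g f' where
  smooth := h.smooth.congr fun ξ hξ => hf ξ hξ
  pairing φ hφ := by
    rw [← h.pairing φ hφ]
    congr 1
    funext ξ
    by_cases hξ : ξ = 0
    · rw [hξ, image_eq_zero_of_notMem_tsupport hφ.away, zero_smul, zero_smul]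
    · rw [hf ξ hξ]

/-- The Fourier transform turns multiplication by `x_k` into `i ∂_k`. -/
theorem IsFourierImage.coord_smul {g f : E n → V} (h : IsFourierImage g f) (k : Fin n) :
    IsFourierImage (fun x => (x k : ℂ) • g x) (fun ξ => Complex.I • partialDeriv k f ξ) where
  smooth := (contDiffOn_partialDeriv h.smooth k).const_smul Complex.I
  pairing φ hφ := by
    have hd := hφ.fderiv (EuclideanSpace.single k 1)
    have h1 : ∫ ξ, φ ξ • partialDeriv k f ξ = -∫ ξ, partialDeriv k φ ξ • f ξ := by
      refine integral_smul_fderiv_eq_neg_fderiv_smul_of_integrable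
        (hd.integrable_smul h.smooth.continuousOn)
        (hφ.integrable_smul (contDiffOn_partialDeriv h.smooth k).continuousOn)
        (hφ.integrable_smul h.smooth.continuousOn)
        (fun x _ => hφ.smooth.differentiable (by simp) x) fun x hx => ?_
      have hx0 : x ≠ 0 := fun h => hφ.away (h ▸ hx)
      exact (h.smooth.contDiffAt (isOpen_compl_singleton.mem_nhds hx0)).differentiableAt (by simp)
    have h2 : ∫ ξ, partialDeriv k φ ξ • f ξ = _ := h.pairing _ hd
    have h3 : ∀ ξ, φ ξ • Complex.I • partialDeriv k f ξ = Complex.I • φ ξ • partialDeriv k f ξ :=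
      fun ξ => smul_comm _ _ _
    simp only [h3]
    rw [integral_smul, h1, h2, ← integral_neg, ← integral_smul]
    congr 1
    funext x
    change Complex.I • -(fourier (fun y => partialDeriv k φ y) x • g x) = _
    rw [hφ.fourier_partialDeriv, smul_neg, smul_smul, smul_smul, ← neg_smul]
    congr 1
    linear_combination (-(x k : ℂ) * fourier φ x) * Complex.I_mul_I

/-- The Fourier transform turns `∂_k` into multiplication by `i ξ_k`. -/
theorem IsFourierImage.partialDeriv {g f : E n → V} (h : IsFourierImage g f)
    (hd : Differentiable ℝ g) (hg : ModerateGrowth g) (k : Fin n)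
    (hg' : ModerateGrowth (partialDeriv k g)) :
    IsFourierImage (partialDeriv k g) (fun ξ => (Complex.I * (ξ k : ℂ)) • f ξ) where
  smooth := by
    refine ContDiffOn.smul (ContDiff.contDiffOn ?_) h.smooth
    exact contDiff_const.mul (Complex.ofRealCLM.contDiff.comp (by fun_prop))
  pairing φ hφ := by
    have hφ' := hφ.coord_mul k
    have h1 : ∀ ξ, φ ξ • (Complex.I * (ξ k : ℂ)) • f ξ = Complex.I • ((ξ k : ℂ) * φ ξ) • f ξ :=
      fun ξ => by rw [smul_smul, smul_smul]; congr 1; ring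
    have h2 : ∀ x, FPicture.partialDeriv k (fourier φ) x = -Complex.I *
        fourier (fun y => (y k : ℂ) * φ y) x := fun x => by
      rw [hφ.fourier_coord_mul, ← mul_assoc]; simp
    have hS : fourier φ = fourierSchwartz hφ.toSchwartz := by
      funext x; rw [coe_fourierSchwartz, hφ.coe_toSchwartz]
    have h3 : ∫ x, fourier φ x • FPicture.partialDeriv k g x =
        -∫ x, FPicture.partialDeriv k (fourier φ) x • g x := by
      refine integral_smul_fderiv_eq_neg_fderiv_smul_of_integrable ?_
        (hg'.integrable_fourier hφ) (hg.integrable_fourier hφ) (fun x _ => ?_) (fun x _ => hd x)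
      · change Integrable fun x => FPicture.partialDeriv k (fourier φ) x • g x
        simp only [h2, mul_smul]
        exact (hg.integrable_fourier hφ').smul (-Complex.I)
      · rw [hS]; exact (fourierSchwartz hφ.toSchwartz).differentiableAt
    simp only [h1]
    rw [integral_smul, h.pairing _ hφ', h3]
    simp only [h2, mul_smul]
    rw [integral_smul, neg_smul, neg_neg]

theorem IsFourierImage.add {g f g' f' : E n → V} (h : IsFourierImage g f)
    (h' : IsFourierImage g' f') (hg : ModerateGrowth g) (hg' : ModerateGrowth g') :
    IsFourierImage (fun x => g x + g' x) (fun ξ => f ξ + f' ξ) where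
  smooth := h.smooth.add h'.smooth
  pairing φ hφ := by
    simp only [smul_add]
    rw [integral_add (hφ.integrable_smul h.smooth.continuousOn)
      (hφ.integrable_smul h'.smooth.continuousOn),
      integral_add (hg.integrable_fourier hφ) (hg'.integrable_fourier hφ), h.pairing φ hφ,
      h'.pairing φ hφ]

theorem IsFourierImage.const_smul {g f : E n → V} (h : IsFourierImage g f) (c : ℂ) :
    IsFourierImage (fun x => c • g x) (fun ξ => c • f ξ) where
  smooth := h.smooth.const_smul c
  pairing φ hφ := by
    have h1 : ∀ (z : ℂ) (v : V), z • c • v = c • z • v := fun z v => smul_comm _ _ _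
    simp only [h1]
    rw [integral_smul, integral_smul, h.pairing φ hφ]

theorem IsFourierImage.map [FiniteDimensional ℂ V] {g f : E n → V} (h : IsFourierImage g f)
    (hg : ModerateGrowth g) (T : V →ₗ[ℂ] V) :
    IsFourierImage (fun x => T (g x)) (fun ξ => T (f ξ)) where
  smooth := (T.toContinuousLinearMap.restrictScalars ℝ).contDiff.comp_contDiffOn h.smooth
  pairing φ hφ := by
    have := FiniteDimensional.complete ℂ V
    have h1 := T.toContinuousLinearMap.integral_comp_comm
      (hφ.integrable_smul h.smooth.continuousOn)
    have h2 := T.toContinuousLinearMap.integral_comp_comm (hg.integrable_fourier hφ)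
    rw [h.pairing φ hφ] at h1
    simpa using h1.trans h2.symm

theorem IsFourierImage.zero : IsFourierImage (fun _ : E n => (0 : V)) (fun _ => 0) where
  smooth := contDiffOn_const
  pairing φ hφ := by simp

theorem IsFourierImage.sum {ι : Type*} (s : Finset ι) {g f : ι → E n → V}
    (h : ∀ i, IsFourierImage (g i) (f i)) (hg : ∀ i, ModerateGrowth (g i)) :
    IsFourierImage (fun x => ∑ i ∈ s, g i x) (fun ξ => ∑ i ∈ s, f i ξ) := by
  classical
  induction s using Finset.induction_on with
  | empty => simpa using IsFourierImage.zero
  | insert a s ha ih =>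
    simp only [Finset.sum_insert ha]
    exact (h a).add ih (hg a) (ModerateGrowth.sum s hg)

/-- The Fourier transform on `ℝⁿ ∖ {0}` of the zero function is zero. -/
theorem IsFourierImage.eq_zero [FiniteDimensional ℂ V] {g f : E n → V} (h : IsFourierImage g f)
    (hg : ∀ x, g x = 0) (ξ : E n) (hξ : ξ ≠ 0) : f ξ = 0 := by
  have := FiniteDimensional.complete ℂ V
  have h1 : ∀ᵐ x ∂(volume : Measure (E n)), x ∈ ({0}ᶜ : Set (E n)) → f x = 0 := by
    refine isOpen_compl_singleton.ae_eq_zero_of_integral_contDiff_smul_eq_zero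
      (h.smooth.continuousOn.locallyIntegrableOn isOpen_compl_singleton.measurableSet) ?_
    intro φ hφ hφc hφ0
    have ht : IsTest fun x => (φ x : ℂ) :=
      { smooth := Complex.ofRealCLM.contDiff.comp hφ
        compact := hφc.comp_left (g := fun r : ℝ => (r : ℂ)) Complex.ofReal_zero
        away := fun h0 => hφ0 (tsupport_comp_subset (g := fun r : ℝ => (r : ℂ))
          Complex.ofReal_zero φ h0) rfl }
    have h2 := h.pairing _ ht
    simpa [hg] using h2
  by_contra hne
  have hopen : IsOpen ({x | x ≠ 0 ∧ f x ≠ 0} : Set (E n)) :=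
    h.smooth.continuousOn.isOpen_inter_preimage isOpen_compl_singleton isOpen_compl_singleton
  have hpos := hopen.measure_pos volume ⟨ξ, hξ, hne⟩
  refine hpos.ne' ?_
  refine measure_mono_null ?_ (ae_iff.1 h1)
  rintro x ⟨hx, hfx⟩ hcon
  exact hfx (hcon hx)

end FourierTest
end FPicture

namespace FPicture
open MeasureTheory

/-! ### The action of `N_j` in the Fourier picture -/

section FourierAction
variable {n : ℕ} {V : Type*} [NormedAddCommGroup V] [InnerProductSpace ℂ V]
variable {σ : Representation ℂ (SO n) V} {lam : ℂ} {F : Mat n → V}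

/-- The second-order differential operator `i (-ξ_j Δ + 2 ∑ ξ_k ∂_k ∂_j + (n - 2λ) ∂_j
- 2 ∑ S_jk ∂_k)` by which `N_j` acts in the Fourier picture. -/
noncomputable def fourierN (S : Fin n → Fin n → V →ₗ[ℂ] V) (lam : ℂ) (j : Fin n) (f : E n → V)
    (ξ : E n) : V :=
  Complex.I • (-((ξ j : ℂ) • ∑ k, fderiv ℝ (fderiv ℝ f) ξ (EuclideanSpace.single k 1)
        (EuclideanSpace.single k 1))
    + (2 : ℂ) • fderiv ℝ (fderiv ℝ f) ξ (EuclideanSpace.single j 1) ξ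
    + (n - 2 * lam) • fderiv ℝ f ξ (EuclideanSpace.single j 1)
    - (2 : ℂ) • ∑ k, S j k (fderiv ℝ f ξ (EuclideanSpace.single k 1)))

theorem IsPrincipal.moderateGrowth (hF : IsPrincipal σ lam F) : ModerateGrowth (nonCompact F) :=
  ⟨hF.smooth.contDiff_nonCompact.continuous, hF.growth⟩

/-- The derivative `∂_j` is minus the action of `N̄_j`, which preserves the principal series. -/
theorem IsPrincipal.moderateGrowth_partialDeriv [FiniteDimensional ℂ V]
    (hF : IsPrincipal σ lam F) {S : Fin n → Fin n → V →ₗ[ℂ] V} (hS : IsDifferential σ S)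
    (j : Fin n) : ModerateGrowth (partialDeriv j (nonCompact F)) := by
  have h1 : partialDeriv j (nonCompact F) =
      fun x => (-1 : ℂ) • nonCompact (FPicture.dLeft (nbarLie (Pi.single j 1)) F) x := by
    funext x
    have := hF.dLeft_nbarLie hS x (EuclideanSpace.single j 1)
    rw [PiLp.ofLp_single] at this
    rw [this, partialDeriv]; simp
  rw [h1]
  exact (hF.dLeft (isLie_nbarLie _)).moderateGrowth.const_smul _

theorem eq_sum_coord_smul (x : E n) : x = ∑ k, x k • EuclideanSpace.single k (1 : ℝ) := by
  ext i
  rw [WithLp.ofLp_sum, Finset.sum_apply, Finset.sum_eq_single i]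
  · simp
  · intro b _ hb; simp [hb.symm]
  · simp

theorem contDiffAt_of_ne {f : E n → V} (hf : ContDiffOn ℝ ∞ f {0}ᶜ) {ξ : E n} (hξ : ξ ≠ 0) :
    ContDiffAt ℝ ∞ f ξ := hf.contDiffAt (isOpen_compl_singleton.mem_nhds hξ)

theorem hasFDerivAt_partialDeriv {f : E n → V} (hf : ContDiffOn ℝ ∞ f {0}ᶜ) {ξ : E n} (hξ : ξ ≠ 0)
    (k : Fin n) : HasFDerivAt (partialDeriv k f)
      ((fderiv ℝ (fderiv ℝ f) ξ).flip (EuclideanSpace.single k 1)) ξ := by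
  have h1 : DifferentiableAt ℝ (fderiv ℝ f) ξ :=
    ((contDiffAt_of_ne hf hξ).fderiv_right (m := 1) (by
      exact WithTop.coe_le_coe.2 le_top)).differentiableAt (by simp)
  have h2 := h1.hasFDerivAt.clm_apply
    (hasFDerivAt_const (EuclideanSpace.single k (1 : ℝ) : E n) ξ)
  convert! h2 using 1
  ext v; simp

/-- The Fourier transform turns `x_l x_k ∂_j` into `-i ∂_l ∂_k ξ_j`. -/
theorem IsFourierImage.coord_coord_partialDeriv {g f : E n → V} (h : IsFourierImage g f)
    (hd : Differentiable ℝ g) (hg : ModerateGrowth g) (j k l : Fin n)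
    (hg' : ModerateGrowth (FPicture.partialDeriv j g)) :
    IsFourierImage (fun x => (x l : ℂ) • (x k : ℂ) • FPicture.partialDeriv j g x)
      (fun ξ => -Complex.I • ((if j = k then FPicture.partialDeriv l f ξ else 0) +
        (if j = l then FPicture.partialDeriv k f ξ else 0) +
        (ξ j : ℂ) • fderiv ℝ (fderiv ℝ f) ξ (EuclideanSpace.single l 1)
          (EuclideanSpace.single k 1))) := by
  have hcoord : ∀ ξ : E n, HasFDerivAt (fun ξ : E n => (ξ j : ℂ))
      (Complex.ofRealCLM.comp (EuclideanSpace.proj j : E n →L[ℝ] ℝ)) ξ := fun ξ =>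
    (Complex.ofRealCLM.hasFDerivAt).comp ξ (EuclideanSpace.proj j : E n →L[ℝ] ℝ).hasFDerivAt
  have hsing : ∀ m : Fin n, (Complex.ofRealCLM.comp (EuclideanSpace.proj j : E n →L[ℝ] ℝ))
      (EuclideanSpace.single m 1) = if j = m then 1 else 0 := by
    intro m; by_cases hm : j = m <;> simp [hm]
  have h1 := (h.partialDeriv hd hg j hg').coord_smul k
  have h2 : IsFourierImage (fun x => (x k : ℂ) • FPicture.partialDeriv j g x)
      (fun ξ => -((if j = k then f ξ else 0) + (ξ j : ℂ) • FPicture.partialDeriv k f ξ)) := by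
    refine h1.congr fun ξ hξ => ?_
    have hf : HasFDerivAt f (fderiv ℝ f ξ) ξ :=
      ((contDiffAt_of_ne h.smooth hξ).differentiableAt (by simp)).hasFDerivAt
    have h3 := ((hcoord ξ).const_mul Complex.I).smul hf
    have h4 : FPicture.partialDeriv k (fun ξ : E n => (Complex.I * (ξ j : ℂ)) • f ξ) ξ =
        (if j = k then Complex.I • f ξ else 0) +
          (Complex.I * (ξ j : ℂ)) • FPicture.partialDeriv k f ξ := by
      have h5 := congrArg (fun L => L (EuclideanSpace.single k (1 : ℝ))) h3.fderiv
      refine Eq.trans h5 ?_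
      simp only [add_apply, smul_apply, ContinuousLinearMap.smulRight_apply, hsing]
      rw [add_comm]
      congr 1
      by_cases hjk : j = k <;> simp [hjk]
    rw [h4, smul_add, smul_smul, ← mul_assoc, Complex.I_mul_I]
    split_ifs <;> simp [smul_smul]
    abel
  refine (h2.coord_smul l).congr fun ξ hξ => ?_
  have hf : HasFDerivAt f (fderiv ℝ f ξ) ξ :=
    ((contDiffAt_of_ne h.smooth hξ).differentiableAt (by simp)).hasFDerivAt
  have h3 := (hcoord ξ).smul (hasFDerivAt_partialDeriv h.smooth hξ k)
  have h4 : HasFDerivAt (fun ξ => if j = k then f ξ else 0)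
      (if j = k then fderiv ℝ f ξ else 0) ξ := by
    split_ifs
    · exact hf
    · exact hasFDerivAt_const _ _
  have h5 := congrArg (fun L => L (EuclideanSpace.single l (1 : ℝ))) ((h4.add h3).neg).fderiv
  have h6 : FPicture.partialDeriv l (fun ξ : E n => -((if j = k then f ξ else 0) +
      (ξ j : ℂ) • FPicture.partialDeriv k f ξ)) ξ = _ := h5
  rw [h6, neg_smul, ← smul_neg]
  congr 1
  simp only [neg_apply, add_apply, smul_apply, ContinuousLinearMap.smulRight_apply,
    ContinuousLinearMap.flip_apply, hsing]
  congr 1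
  split_ifs <;> simp [FPicture.partialDeriv] <;> abel

/-- The operator `fourierN` is the image of the action of `N_j` under the Fourier transform. -/
theorem IsPrincipal.isFourierImage_dLeft_N [FiniteDimensional ℂ V] (hF : IsPrincipal σ lam F)
    {S : Fin n → Fin n → V →ₗ[ℂ] V} (hS : IsDifferential σ S) (j : Fin n) {f : E n → V}
    (hf : IsFourierImage (nonCompact F) f) :
    IsFourierImage (nonCompact (FPicture.dLeft (N j) F)) (fourierN S lam j f) := by
  set g := nonCompact F with hg
  have hd : Differentiable ℝ g := hF.smooth.contDiff_nonCompact.differentiable (by simp)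
  have hm : ModerateGrowth g := hF.moderateGrowth
  have hm' : ∀ k, ModerateGrowth (FPicture.partialDeriv k g) :=
    fun k => hF.moderateGrowth_partialDeriv hS k
  have hmm : ∀ l k m, ModerateGrowth
      fun x => (x l : ℂ) • (x k : ℂ) • FPicture.partialDeriv m g x :=
    fun l k m => ((hm' m).coord_smul k).coord_smul l
  have t1 := IsFourierImage.sum Finset.univ
    (fun k => hf.coord_coord_partialDeriv hd hm j k k (hm' j)) (fun k => hmm k k j)
  have m1 := ModerateGrowth.sum Finset.univ (fun k => hmm k k j)
  have t2 := (IsFourierImage.sum Finset.univ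
    (fun k => hf.coord_coord_partialDeriv hd hm k k j (hm' k)) (fun k => hmm j k k)).const_smul (-2)
  have m2 := (ModerateGrowth.sum Finset.univ (fun k => hmm j k k)).const_smul (-2)
  have t3 := (hf.coord_smul j).const_smul (-(2 * lam + n))
  have m3 := (hm.coord_smul j).const_smul (-(2 * lam + n))
  have t4 := (IsFourierImage.sum Finset.univ
    (fun k => (hf.coord_smul k).map (hm.coord_smul k) (S j k))
    (fun k => (hm.coord_smul k).map (S j k))).const_smul (-2)
  have m4 := (ModerateGrowth.sum Finset.univ
    (fun k => (hm.coord_smul k).map (S j k))).const_smul (-2)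
  have t := ((t1.add t2 m1 m2).add t3 (m1.add m2) m3).add t4 ((m1.add m2).add m3) m4
  have hfun : nonCompact (FPicture.dLeft (N j) F) = _ := funext fun x => hF.dLeft_N hS j x
  have heq : (fun x : E n => ∑ k, (x k : ℂ) • (x k : ℂ) • FPicture.partialDeriv j g x +
      (-2 : ℂ) • ∑ k, (x j : ℂ) • (x k : ℂ) • FPicture.partialDeriv k g x +
      (-(2 * lam + n)) • (x j : ℂ) • g x + (-2 : ℂ) • ∑ k, S j k ((x k : ℂ) • g x)) =
      nonCompact (FPicture.dLeft (N j) F) := by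
    rw [hfun]
    funext x
    simp only [smul_smul]
    module
  rw [heq] at t
  refine t.congr fun ξ hξ => ?_
  have hsum : ∑ k, (ξ k : ℂ) • fderiv ℝ (fderiv ℝ f) ξ (EuclideanSpace.single j 1)
      (EuclideanSpace.single k 1) = fderiv ℝ (fderiv ℝ f) ξ (EuclideanSpace.single j 1) ξ := by
    refine Eq.trans ?_ (congrArg (fderiv ℝ (fderiv ℝ f) ξ (EuclideanSpace.single j 1))
      (eq_sum_coord_smul ξ)).symm
    rw [map_sum]
    refine Finset.sum_congr rfl fun k _ => ?_
    rw [map_smul, Complex.coe_smul]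
  simp only [fourierN, ← hsum, ← Finset.smul_sum, Finset.sum_add_distrib, map_smul, ite_true,
    Finset.sum_ite_eq, Finset.sum_ite_eq', Finset.mem_univ, Finset.sum_const, Finset.card_univ,
    Fintype.card_fin, ← Nat.cast_smul_eq_nsmul ℂ, FPicture.partialDeriv]
  module

end FourierAction
end FPicture

namespace FPicture
open Matrix NormedSpace

/-! ### The Lie algebra action on `V` -/

section LieAction
variable {n : ℕ} {V : Type*} [NormedAddCommGroup V] [InnerProductSpace ℂ V]
variable {σ : Representation ℂ (SO n) V} {S : Fin n → Fin n → V →ₗ[ℂ] V}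

theorem IsDifferential.hasDerivAt [FiniteDimensional ℂ V] (hS : IsDifferential σ S)
    {A : Matrix (Fin n) (Fin n) ℝ} (hA : Aᵀ = -A) (v : V) (t : ℝ) :
    HasDerivAt (fun t : ℝ => σ (rot (t • A)) v) (σ (rot (t • A)) (soAct S A v)) t := by
  have h1 : HasDerivAt (fun s : ℝ => σ (rot (s • A)) v) (soAct S A v) (t - t) := by
    rw [sub_self]; exact hS.hasDerivAt_zero A hA v
  have h2 := h1.scomp (h := fun s : ℝ => s - t) t ((hasDerivAt_id t).sub_const t)
  have h3 := ((σ (rot (t • A))).toContinuousLinearMap.restrictScalars ℝ).hasFDerivAt.comp_hasDerivAt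
    t h2
  refine (h3.congr_deriv (by simp)).congr_of_eventuallyEq (Filter.Eventually.of_forall fun s => ?_)
  change _ = σ (rot (t • A)) (σ (rot ((s - t) • A)) v)
  rw [← Module.End.mul_apply, ← map_mul, ← rot_add_smul hA, add_sub_cancel]

theorem IsDifferential.soAct_rot [FiniteDimensional ℂ V] (hS : IsDifferential σ S)
    {A : Matrix (Fin n) (Fin n) ℝ} (hA : Aᵀ = -A) (v : V) (t : ℝ) :
    soAct S A (σ (rot (t • A)) v) = σ (rot (t • A)) (soAct S A v) := by
  refine (hS.hasDerivAt_zero A hA (σ (rot (t • A)) v)).unique ?_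
  have h3 := ((σ (rot (t • A))).toContinuousLinearMap.restrictScalars ℝ).hasFDerivAt.comp_hasDerivAt
    0 (hS.hasDerivAt_zero A hA v)
  refine h3.congr_of_eventuallyEq (Filter.Eventually.of_forall fun s => ?_)
  change σ (rot (s • A)) (σ (rot (t • A)) v) = σ (rot (t • A)) (σ (rot (s • A)) v)
  rw [← Module.End.mul_apply, ← Module.End.mul_apply, ← map_mul, ← map_mul, ← rot_add_smul hA,
    ← rot_add_smul hA, add_comm]

theorem transpose_conj_skew (m : SO n) {A : Matrix (Fin n) (Fin n) ℝ} (hA : Aᵀ = -A) :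
    ((m : Matrix (Fin n) (Fin n) ℝ) * A * (m : Matrix (Fin n) (Fin n) ℝ)ᵀ)ᵀ =
      -((m : Matrix (Fin n) (Fin n) ℝ) * A * (m : Matrix (Fin n) (Fin n) ℝ)ᵀ) := by
  simp [transpose_mul, hA, mul_assoc]

theorem rot_conj (m : SO n) {A : Matrix (Fin n) (Fin n) ℝ} (hA : Aᵀ = -A) :
    rot ((m : Matrix (Fin n) (Fin n) ℝ) * A * (m : Matrix (Fin n) (Fin n) ℝ)ᵀ) =
      m * rot A * m⁻¹ := by
  apply Subtype.ext
  rw [coe_rot (transpose_conj_skew m hA), Submonoid.coe_mul, Submonoid.coe_mul, coe_rot hA,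
    coe_inv_SO]
  have hinv : (m : Matrix (Fin n) (Fin n) ℝ)⁻¹ = (m : Matrix (Fin n) (Fin n) ℝ)ᵀ :=
    Matrix.inv_eq_right_inv (mul_transpose_self_SO m)
  rw [← hinv]
  exact Matrix.exp_conj _ _ (IsUnit.of_mul_eq_one _ (mul_transpose_self_SO m))

theorem IsDifferential.conj_soAct [FiniteDimensional ℂ V] (hS : IsDifferential σ S) (m : SO n)
    {A : Matrix (Fin n) (Fin n) ℝ} (hA : Aᵀ = -A) (v : V) :
    σ m (soAct S A v) = soAct S ((m : Matrix (Fin n) (Fin n) ℝ) * A *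
      (m : Matrix (Fin n) (Fin n) ℝ)ᵀ) (σ m v) := by
  refine HasDerivAt.unique ?_ (hS.hasDerivAt_zero _ (transpose_conj_skew m hA) (σ m v))
  have h3 := ((σ m).toContinuousLinearMap.restrictScalars ℝ).hasFDerivAt.comp_hasDerivAt
    0 (hS.hasDerivAt_zero A hA v)
  refine h3.congr_of_eventuallyEq (Filter.Eventually.of_forall fun s => ?_)
  change _ = σ m (σ (rot (s • A)) v)
  have h4 : s • ((m : Matrix (Fin n) (Fin n) ℝ) * A * (m : Matrix (Fin n) (Fin n) ℝ)ᵀ) =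
      (m : Matrix (Fin n) (Fin n) ℝ) * (s • A) * (m : Matrix (Fin n) (Fin n) ℝ)ᵀ := by
    rw [mul_smul_comm, smul_mul_assoc]
  change σ (rot (s • _)) (σ m v) = _
  rw [h4, rot_conj m (by simp [hA]), ← Module.End.mul_apply, ← Module.End.mul_apply, ← map_mul,
    ← map_mul, inv_mul_cancel_right]

theorem hasDerivAt_exp_conj (A B : Matrix (Fin n) (Fin n) ℝ) (a b : Fin n) :
    HasDerivAt (fun t : ℝ => (exp (t • A) * B * exp (t • (-A))) a b) ((A * B - B * A) a b) 0 := by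
  have h1 := hasDerivAt_matrix_mul (hasDerivAt_matrix_mul (hasDerivAt_matrix_exp A 0)
    (hasDerivAt_matrix_const B 0)) (hasDerivAt_matrix_exp (-A) 0)
  let _ : NormedRing (Matrix (Fin n) (Fin n) ℝ) := Matrix.linftyOpNormedRing
  let _ : NormedAlgebra ℝ (Matrix (Fin n) (Fin n) ℝ) := Matrix.linftyOpNormedAlgebra
  have h2 := (Matrix.entryLinearMap ℝ ℝ a b).toContinuousLinearMap.hasFDerivAt.comp_hasDerivAt
    (0 : ℝ) h1
  refine h2.congr_deriv ?_
  have h3 : (exp ((0 : ℝ) • A) * A * B + exp ((0 : ℝ) • A) * 0) * exp ((0 : ℝ) • (-A)) +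
      exp ((0 : ℝ) • A) * B * (exp ((0 : ℝ) • (-A)) * -A) = A * B - B * A := by
    simp [sub_eq_add_neg]
  rw [h3]; rfl

/-- The differential is a representation of `so(n)`: differentiate the conjugation formula
`IsDifferential.conj_soAct` along the one-parameter group of `A`. -/
theorem IsDifferential.commutator_soAct [FiniteDimensional ℂ V] (hS : IsDifferential σ S)
    {A B : Matrix (Fin n) (Fin n) ℝ} (hA : Aᵀ = -A) (hB : Bᵀ = -B) (v : V) :
    soAct S A (soAct S B v) - soAct S B (soAct S A v) = soAct S (A * B - B * A) v := by
  have h1 := hS.hasDerivAt_zero A hA (soAct S B v)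
  have h2 : (fun t : ℝ => σ (rot (t • A)) (soAct S B v)) = fun t : ℝ => (2⁻¹ : ℂ) • ∑ a, ∑ b,
      (((exp (t • A) * B * exp (t • (-A))) a b : ℝ) : ℂ) • S a b (σ (rot (t • A)) v) := by
    funext t
    rw [hS.conj_soAct _ hB, coe_rot (by simp [hA]), ← Matrix.exp_transpose]
    simp [soAct, hA]
  rw [h2] at h1
  have h3 : HasDerivAt (fun t : ℝ => (2⁻¹ : ℂ) • ∑ a, ∑ b,
      (((exp (t • A) * B * exp (t • (-A))) a b : ℝ) : ℂ) • S a b (σ (rot (t • A)) v))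
      ((2⁻¹ : ℂ) • ∑ a, ∑ b, ((B a b : ℂ) • S a b (soAct S A v) +
        (((A * B - B * A) a b : ℝ) : ℂ) • S a b v)) 0 := by
    refine HasDerivAt.fun_const_smul _ (HasDerivAt.fun_sum fun a _ =>
      HasDerivAt.fun_sum fun b _ => ?_)
    have h4 := (hasDerivAt_exp_conj A B a b).ofReal_comp
    have h5 := ((S a b).toContinuousLinearMap.restrictScalars ℝ).hasFDerivAt.comp_hasDerivAt
      (0 : ℝ) (hS.hasDerivAt_zero A hA v)
    have h6 := h4.smul h5
    refine h6.congr_deriv ?_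
    simp [rot_zero]
  have h7 := h1.unique h3
  rw [h7]
  simp only [Finset.sum_add_distrib, smul_add]
  have h8 : ∀ (M : Matrix (Fin n) (Fin n) ℝ) (w : V),
      soAct S M w = (2⁻¹ : ℂ) • ∑ a, ∑ b, (M a b : ℂ) • S a b w := fun M w => by simp [soAct]
  rw [← h8, ← h8, add_sub_cancel_left]

/-! #### Complex bilinear form of the action -/

/-- The operator by which `u vᵀ - v uᵀ ∈ so(n, ℂ)` acts, for `u, v ∈ ℂⁿ`. -/
noncomputable def soBil (S : Fin n → Fin n → V →ₗ[ℂ] V) :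
    (Fin n → ℂ) →ₗ[ℂ] (Fin n → ℂ) →ₗ[ℂ] V →ₗ[ℂ] V :=
  LinearMap.mk₂ ℂ (fun u v => ∑ a, ∑ b, (u a * v b) • S a b)
    (fun u u' v => by simp only [Pi.add_apply, add_mul, add_smul, Finset.sum_add_distrib])
    (fun c u v => by
      simp only [Pi.smul_apply, smul_eq_mul, mul_assoc, mul_smul, Finset.smul_sum])
    (fun u v v' => by simp only [Pi.add_apply, mul_add, add_smul, Finset.sum_add_distrib])
    (fun c u v => by
      simp only [Pi.smul_apply, smul_eq_mul, mul_left_comm _ c, mul_smul, Finset.smul_sum])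

theorem soBil_apply (u v : Fin n → ℂ) : soBil S u v = ∑ a, ∑ b, (u a * v b) • S a b := rfl

theorem soBil_single (a b : Fin n) : soBil S (Pi.single a 1) (Pi.single b 1) = S a b := by
  rw [soBil_apply, Finset.sum_eq_single a, Finset.sum_eq_single b]
  · simp
  · intro c _ hc; simp [hc]
  · simp
  · intro c _ hc; simp [hc]
  · simp

theorem IsDifferential.soBil_antisymm (hS : IsDifferential σ S) (u v : Fin n → ℂ) :
    soBil S u v = -soBil S v u := by
  rw [soBil_apply, soBil_apply, Finset.sum_comm, ← Finset.sum_neg_distrib]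
  refine Finset.sum_congr rfl fun a _ => ?_
  rw [← Finset.sum_neg_distrib]
  refine Finset.sum_congr rfl fun b _ => ?_
  rw [hS.antisymm b a, smul_neg, mul_comm]

theorem IsDifferential.soBil_self (hS : IsDifferential σ S) (u : Fin n → ℂ) : soBil S u u = 0 := by
  have h := hS.soBil_antisymm u u
  have h2 : (2 : ℂ) • soBil S u u = 0 := by
    rw [two_smul]; nth_rewrite 1 [h]; exact neg_add_cancel _
  exact (smul_eq_zero.1 h2).resolve_left two_ne_zero

/-- The skew-symmetric matrix `u vᵀ - v uᵀ`. -/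
def wedge (u v : Fin n → ℝ) : Matrix (Fin n) (Fin n) ℝ := vecMulVec u v - vecMulVec v u

theorem transpose_wedge (u v : Fin n → ℝ) : (wedge u v)ᵀ = -wedge u v := by
  simp [wedge, transpose_vecMulVec]

theorem soAct_sub (A B : Matrix (Fin n) (Fin n) ℝ) : soAct S (A - B) = soAct S A - soAct S B := by
  simp [soAct, sub_smul, smul_sub]

theorem soAct_add (A B : Matrix (Fin n) (Fin n) ℝ) : soAct S (A + B) = soAct S A + soAct S B := by
  simp [soAct, add_smul, smul_add, Finset.sum_add_distrib]

theorem soAct_smul (c : ℝ) (A : Matrix (Fin n) (Fin n) ℝ) :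
    soAct S (c • A) = (c : ℂ) • soAct S A := by
  simp only [soAct, Matrix.smul_apply, smul_eq_mul, Complex.ofReal_mul, mul_smul,
    ← Finset.smul_sum]
  rw [smul_comm]

theorem IsDifferential.soAct_wedge (hS : IsDifferential σ S) (u v : Fin n → ℝ) :
    soAct S (wedge u v) = soBil S (fun a => (u a : ℂ)) (fun a => (v a : ℂ)) := by
  have h1 : ∀ u v : Fin n → ℝ, soAct S (vecMulVec u v) =
      (2⁻¹ : ℂ) • soBil S (fun a => (u a : ℂ)) (fun a => (v a : ℂ)) := fun u v => by
    simp [soAct, soBil_apply, vecMulVec_apply]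
  rw [wedge, soAct_sub, h1, h1, hS.soBil_antisymm (fun a => (v a : ℂ))]
  module

theorem ofReal_single (k : Fin n) :
    (fun a => (((Pi.single k 1 : Fin n → ℝ) a : ℝ) : ℂ)) = Pi.single k 1 := by
  ext i
  by_cases h : i = k
  · subst h; simp
  · simp [h]

theorem IsDifferential.soAct_wedge_single (hS : IsDifferential σ S) (a b : Fin n) :
    soAct S (wedge (Pi.single a 1) (Pi.single b 1)) = S a b := by
  rw [hS.soAct_wedge, ← soBil_single (S := S)]
  rw [ofReal_single, ofReal_single]

theorem eq_of_forall_single {W : Type*} [AddCommGroup W] [Module ℂ W] {f g : (Fin n → ℂ) → W}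
    (hf : IsLinearMap ℂ f) (hg : IsLinearMap ℂ g)
    (h : ∀ k, f (Pi.single k 1) = g (Pi.single k 1)) (u : Fin n → ℂ) : f u = g u := by
  have : hf.mk' f = hg.mk' g := by
    refine LinearMap.pi_ext' fun k => LinearMap.ext_ring ?_
    simpa using h k
  exact congrArg (fun L => L u) this

theorem wedge_mul_wedge_sub (u v x y : Fin n → ℝ) :
    wedge u v * wedge x y - wedge x y * wedge u v =
      (v ⬝ᵥ x) • wedge u y - (u ⬝ᵥ x) • wedge v y + (v ⬝ᵥ y) • wedge x u -
        (u ⬝ᵥ y) • wedge x v := by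
  simp only [wedge, mul_sub, sub_mul, vecMulVec_mul_vecMulVec, dotProduct_comm x,
    dotProduct_comm y, vecMulVec_smul]
  module

theorem IsDifferential.commutator_single [FiniteDimensional ℂ V] (hS : IsDifferential σ S)
    (a b c d : Fin n) : S a b * S c d - S c d * S a b =
      ((Pi.single b 1 : Fin n → ℂ) ⬝ᵥ Pi.single c 1) • S a d -
      ((Pi.single a 1 : Fin n → ℂ) ⬝ᵥ Pi.single c 1) • S b d +
      ((Pi.single b 1 : Fin n → ℂ) ⬝ᵥ Pi.single d 1) • S c a -
      ((Pi.single a 1 : Fin n → ℂ) ⬝ᵥ Pi.single d 1) • S c b := by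
  have hd : ∀ i k : Fin n, (((Pi.single i 1 : Fin n → ℝ) ⬝ᵥ Pi.single k 1 : ℝ) : ℂ) =
      (Pi.single i 1 : Fin n → ℂ) ⬝ᵥ Pi.single k 1 := fun i k => by
    by_cases h : i = k <;> simp [h]
  ext v
  have h := hS.commutator_soAct (transpose_wedge (Pi.single a 1) (Pi.single b 1))
    (transpose_wedge (Pi.single c 1) (Pi.single d 1)) v
  rw [wedge_mul_wedge_sub, soAct_sub, soAct_add, soAct_sub] at h
  simp only [soAct_smul, hS.soAct_wedge_single, hd] at h
  exact h

/-- The bracket relations of `so(n, ℂ)`. -/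
theorem IsDifferential.commutator [FiniteDimensional ℂ V] (hS : IsDifferential σ S)
    (u v x y : Fin n → ℂ) : soBil S u v * soBil S x y - soBil S x y * soBil S u v =
      (v ⬝ᵥ x) • soBil S u y - (u ⬝ᵥ x) • soBil S v y + (v ⬝ᵥ y) • soBil S x u -
        (u ⬝ᵥ y) • soBil S x v := by
  revert u
  refine eq_of_forall_single ⟨fun u u' => ?_, fun c u => ?_⟩ ⟨fun u u' => ?_, fun c u => ?_⟩
    fun a => ?_
  · simp only [map_add, LinearMap.add_apply, add_mul, mul_add]; abel
  · simp only [map_smul, LinearMap.smul_apply, smul_mul_assoc, mul_smul_comm, smul_sub]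
  · simp only [map_add, LinearMap.add_apply, add_dotProduct]; module
  · simp only [map_smul, LinearMap.smul_apply, smul_dotProduct, smul_eq_mul]; module
  revert v
  refine eq_of_forall_single ⟨fun u u' => ?_, fun c u => ?_⟩ ⟨fun u u' => ?_, fun c u => ?_⟩
    fun b => ?_
  · simp only [map_add, add_mul, mul_add]; abel
  · simp only [map_smul, smul_mul_assoc, mul_smul_comm, smul_sub]
  · simp only [map_add, LinearMap.add_apply, add_dotProduct]; module
  · simp only [map_smul, LinearMap.smul_apply, smul_dotProduct, smul_eq_mul]; module
  revert x
  refine eq_of_forall_single ⟨fun u u' => ?_, fun c u => ?_⟩ ⟨fun u u' => ?_, fun c u => ?_⟩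
    fun c => ?_
  · simp only [map_add, LinearMap.add_apply, add_mul, mul_add]; abel
  · simp only [map_smul, LinearMap.smul_apply, smul_mul_assoc, mul_smul_comm, smul_sub]
  · simp only [map_add, LinearMap.add_apply, dotProduct_add]; module
  · simp only [map_smul, LinearMap.smul_apply, dotProduct_smul, smul_eq_mul]; module
  revert y
  refine eq_of_forall_single ⟨fun u u' => ?_, fun c u => ?_⟩ ⟨fun u u' => ?_, fun c u => ?_⟩
    fun d => ?_
  · simp only [map_add, add_mul, mul_add]; abel
  · simp only [map_smul, smul_mul_assoc, mul_smul_comm, smul_sub]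
  · simp only [map_add, dotProduct_add]; module
  · simp only [map_smul, dotProduct_smul, smul_eq_mul]; module
  simp only [soBil_single]
  exact hS.commutator_single a b c d

theorem IsDifferential.commutator_apply [FiniteDimensional ℂ V] (hS : IsDifferential σ S)
    (u v x y : Fin n → ℂ) (w : V) : soBil S u v (soBil S x y w) = soBil S x y (soBil S u v w) +
      ((v ⬝ᵥ x) • soBil S u y w - (u ⬝ᵥ x) • soBil S v y w + (v ⬝ᵥ y) • soBil S x u w -
        (u ⬝ᵥ y) • soBil S x v w) := by
  rw [← sub_eq_iff_eq_add']
  exact congrArg (fun L => L w) (hS.commutator u v x y)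

/-- `SO(n)` acting on `ℂⁿ`. -/
noncomputable def actC (m : SO n) (u : Fin n → ℂ) : Fin n → ℂ :=
  (m : Matrix (Fin n) (Fin n) ℝ).map Complex.ofReal *ᵥ u

theorem actC_ofReal (m : SO n) (u : Fin n → ℝ) :
    actC m (fun a => (u a : ℂ)) = fun a => (((m : Matrix (Fin n) (Fin n) ℝ) *ᵥ u) a : ℂ) := by
  funext a
  simp [actC, mulVec, dotProduct]

theorem actC_single (m : SO n) (k : Fin n) : actC m (Pi.single k 1) =
    fun a => (((m : Matrix (Fin n) (Fin n) ℝ) *ᵥ Pi.single k 1) a : ℂ) := by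
  rw [← actC_ofReal]
  rw [ofReal_single]

theorem IsDifferential.conj_soBil [FiniteDimensional ℂ V] (hS : IsDifferential σ S) (m : SO n)
    (u v : Fin n → ℂ) (w : V) :
    σ m (soBil S u v w) = soBil S (actC m u) (actC m v) (σ m w) := by
  revert u
  refine eq_of_forall_single ⟨fun u u' => ?_, fun c u => ?_⟩ ⟨fun u u' => ?_, fun c u => ?_⟩
    fun a => ?_
  · simp only [map_add, LinearMap.add_apply]
  · simp only [map_smul, LinearMap.smul_apply]
  · simp only [actC, mulVec_add, map_add, LinearMap.add_apply]
  · simp only [actC, mulVec_smul, map_smul, LinearMap.smul_apply]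
  revert v
  refine eq_of_forall_single ⟨fun u u' => ?_, fun c u => ?_⟩ ⟨fun u u' => ?_, fun c u => ?_⟩
    fun b => ?_
  · simp only [map_add, LinearMap.add_apply]
  · simp only [map_smul, LinearMap.smul_apply]
  · simp only [actC, mulVec_add, map_add, LinearMap.add_apply]
  · simp only [actC, mulVec_smul, map_smul, LinearMap.smul_apply]
  rw [actC_single, actC_single, ← hS.soAct_wedge, soBil_single, ← hS.soAct_wedge_single,
    hS.conj_soAct m (transpose_wedge _ _)]
  congr 2
  simp [wedge, mul_sub, sub_mul, mul_vecMulVec, vecMulVec_mul, ← mulVec_transpose]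

/-! #### Unitarity and invariant subspaces -/

theorem IsDifferential.inner_soAct [FiniteDimensional ℂ V] (hσ : IsIrredUnitary σ)
    (hS : IsDifferential σ S) {A : Matrix (Fin n) (Fin n) ℝ} (hA : Aᵀ = -A) (v w : V) :
    inner ℂ (soAct S A v) w = -inner ℂ v (soAct S A w) := by
  have h1 := (hS.hasDerivAt_zero A hA v).inner ℂ (hS.hasDerivAt_zero A hA w)
  have h2 : (fun t : ℝ => inner ℂ (σ (rot (t • A)) v) (σ (rot (t • A)) w)) =
      fun _ => inner ℂ v w := funext fun t => hσ.unitary _ _ _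
  rw [h2] at h1
  have h3 := h1.unique (hasDerivAt_const _ _)
  simp only [zero_smul, rot_zero, map_one, Module.End.one_apply] at h3
  exact eq_neg_of_add_eq_zero_right h3

theorem IsDifferential.inner_S [FiniteDimensional ℂ V] (hσ : IsIrredUnitary σ)
    (hS : IsDifferential σ S) (a b : Fin n) (v w : V) :
    inner ℂ (S a b v) w = -inner ℂ v (S a b w) := by
  rw [← hS.soAct_wedge_single]
  exact hS.inner_soAct hσ (transpose_wedge _ _) v w

/-- A subspace that is invariant under a one-parameter group is invariant under its generator. -/
theorem IsDifferential.soAct_mem [FiniteDimensional ℂ V] (hS : IsDifferential σ S)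
    {U : Submodule ℂ V} {A : Matrix (Fin n) (Fin n) ℝ} (hA : Aᵀ = -A)
    (hU : ∀ t : ℝ, U.map (σ (rot (t • A))) ≤ U) {v : V} (hv : v ∈ U) : soAct S A v ∈ U := by
  have hc : IsClosed (U : Set V) := U.closed_of_finiteDimensional
  have h1 := hasDerivAt_iff_tendsto_slope.1 (hS.hasDerivAt_zero A hA v)
  refine hc.mem_of_tendsto h1 (Filter.Eventually.of_forall fun t => ?_)
  have h2 : ∀ t : ℝ, σ (rot (t • A)) v ∈ U := fun t => hU t ⟨v, hv, rfl⟩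
  rw [slope_def_module]
  have h3 : ((t - 0)⁻¹ : ℝ) • (σ (rot (t • A)) v - σ (rot ((0 : ℝ) • A)) v) =
      (((t - 0)⁻¹ : ℝ) : ℂ) • (σ (rot (t • A)) v - σ (rot ((0 : ℝ) • A)) v) :=
    (Complex.coe_smul _ _).symm
  rw [h3]
  exact U.smul_mem _ (U.sub_mem (h2 _) (h2 _))

/-- A subspace that is invariant under a skew-adjoint generator is invariant under its one-parameter
group: the component of an orbit in the orthogonal complement has constant length. -/
theorem IsDifferential.rot_mem [FiniteDimensional ℂ V] (hσ : IsIrredUnitary σ)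
    (hS : IsDifferential σ S) {U : Submodule ℂ V} {A : Matrix (Fin n) (Fin n) ℝ} (hA : Aᵀ = -A)
    (hU : ∀ v ∈ U, soAct S A v ∈ U) {v : V} (hv : v ∈ U) (t : ℝ) : σ (rot (t • A)) v ∈ U := by
  have hU' : ∀ w ∈ Uᗮ, soAct S A w ∈ Uᗮ := fun w hw => by
    rw [Submodule.mem_orthogonal] at hw ⊢
    intro u hu
    have := hS.inner_soAct hσ hA u w
    rw [hw _ (hU u hu), eq_comm, neg_eq_zero] at this
    exact this
  -- the projection `P` to the orthogonal complement commutes with the generator, which is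
  -- skew-adjoint, so that `t ↦ ‖P (σ(exp tA) v)‖²` has derivative `0`
  set P := Uᗮ.starProjection with hP
  have hcomm : ∀ y, P (soAct S A y) = soAct S A (P y) := fun y => by
    have h1 : y = U.starProjection y + P y :=
      (U.starProjection_add_starProjection_orthogonal y).symm
    conv_lhs => rw [h1]
    rw [map_add, map_add, Submodule.starProjection_eq_self_iff.2
      (hU' _ (Submodule.starProjection_apply_mem _ _)),
      (Submodule.starProjection_apply_eq_zero_iff Uᗮ).2, zero_add]
    exact Submodule.le_orthogonal_orthogonal U (hU _ (Submodule.starProjection_apply_mem _ _))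
  have hd : ∀ t, HasDerivAt (fun t : ℝ => P (σ (rot (t • A)) v))
      (soAct S A (P (σ (rot (t • A)) v))) t := fun t => by
    have := (P.restrictScalars ℝ).hasFDerivAt.comp_hasDerivAt t (hS.hasDerivAt hA v t)
    refine this.congr_deriv ?_
    rw [← hcomm, hS.soAct_rot hA]; rfl
  have hconst : ∀ t, HasDerivAt (fun t : ℝ => inner ℂ (P (σ (rot (t • A)) v))
      (P (σ (rot (t • A)) v))) 0 t := fun t => by
    refine ((hd t).inner ℂ (hd t)).congr_deriv ?_
    rw [hS.inner_soAct hσ hA]; simp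
  have h2 := is_const_of_deriv_eq_zero (fun t => (hconst t).differentiableAt)
    (fun t => (hconst t).deriv) t 0
  have h3 : P v = 0 := (Submodule.starProjection_apply_eq_zero_iff Uᗮ).2
    (Submodule.le_orthogonal_orthogonal U hv)
  simp only [zero_smul, rot_zero, map_one, Module.End.one_apply, h3, inner_zero_right] at h2
  have h4 := (Submodule.starProjection_apply_eq_zero_iff Uᗮ).1 (inner_self_eq_zero.1 h2)
  rwa [Submodule.orthogonal_orthogonal] at h4

/-- The subspaces that are invariant under the stabilizer of `e_1, …, e_k` are those that are
invariant under the operators `S_ab` with `a, b > k`. -/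
theorem IsDifferential.map_le_of_S_mem [FiniteDimensional ℂ V] (hσ : IsIrredUnitary σ)
    (hS : IsDifferential σ S) {U : Submodule ℂ V} {k : ℕ}
    (hU : ∀ a b : Fin n, k ≤ (a : ℕ) → k ≤ (b : ℕ) → ∀ v ∈ U, S a b v ∈ U) (m : SO n)
    (hm : ∀ i : Fin n, (i : ℕ) < k →
      (m : Matrix (Fin n) (Fin n) ℝ) *ᵥ Pi.single i 1 = Pi.single i 1) : U.map (σ m) ≤ U := by
  have h := mem_closure_rotations m hm
  clear hm
  induction h using Submonoid.closure_induction with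
  | mem m hm =>
    obtain ⟨A, hA, h0, rfl⟩ := hm
    rintro _ ⟨v, hv, rfl⟩
    have h1 : ∀ v ∈ U, soAct S A v ∈ U := fun v hv => by
      rw [soAct]
      simp only [LinearMap.smul_apply, LinearMap.sum_apply]
      refine U.smul_mem _ (U.sum_mem fun a _ => U.sum_mem fun b _ => ?_)
      by_cases hab : (a : ℕ) < k ∨ (b : ℕ) < k
      · rw [h0 a b hab]; simp
      · push Not at hab
        exact U.smul_mem _ (hU a b hab.1 hab.2 v hv)
    simpa using hS.rot_mem hσ hA h1 hv 1
  | one => rintro _ ⟨v, hv, rfl⟩; simpa using hv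
  | mul a b _ _ iha ihb =>
    rintro _ ⟨v, hv, rfl⟩
    rw [map_mul]
    exact iha ⟨_, ihb ⟨v, hv, rfl⟩, rfl⟩

end LieAction

/-! ### An isotropic basis of the complement of `e₁` -/

section Isotropic
variable {n : ℕ}

/-- The index set of an isotropic basis of `e₁^⊥ ⊆ ℂⁿ`: the indices `+k`, `-k` for the `k`-th plane
of the maximal torus, and an index `0` which matters only if `n` is even. -/
abbrev IsoIndex (n : ℕ) : Type := Fin ((n - 1) / 2) ⊕ Fin ((n - 1) / 2) ⊕ Unit

/-- The basis vector `e_{2k+1}` of `ℝⁿ` (counted from `0`). -/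
def idx₁ (k : Fin ((n - 1) / 2)) : Fin n := ⟨2 * k + 1, by omega⟩

/-- The basis vector `e_{2k+2}` of `ℝⁿ` (counted from `0`). -/
def idx₂ (k : Fin ((n - 1) / 2)) : Fin n := ⟨2 * k + 2, by omega⟩

/-- The isotropic vectors `e_{2k+1} ∓ i e_{2k+2}`, and the last basis vector if `n` is even. For odd
`n` the vector with index `0` is `0`. -/
noncomputable def iso : IsoIndex n → Fin n → ℂ
  | .inl k => Pi.single (idx₁ k) 1 - Complex.I • Pi.single (idx₂ k) 1
  | .inr (.inl k) => Pi.single (idx₁ k) 1 + Complex.I • Pi.single (idx₂ k) 1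
  | .inr (.inr _) => fun a => if (a : ℕ) + 1 = n ∧ Even n then 1 else 0

/-- The frame dual to `iso` for the complex bilinear form. -/
noncomputable def isoDual : IsoIndex n → Fin n → ℂ
  | .inl k => (2⁻¹ : ℂ) • iso (.inr (.inl k))
  | .inr (.inl k) => (2⁻¹ : ℂ) • iso (.inl k)
  | .inr (.inr u) => iso (.inr (.inr u))

/-- The weights of the vectors `iso p`. -/
def isoWt : IsoIndex n → Fin ((n - 1) / 2) → ℤ
  | .inl k => Pi.single k 1
  | .inr (.inl k) => -Pi.single k 1
  | .inr (.inr _) => 0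

/-- The value of `height` at the weight of `iso p`. -/
def isoHt : IsoIndex n → ℤ
  | .inl k => ((n - 1) / 2 : ℕ) - (k : ℤ)
  | .inr (.inl k) => -(((n - 1) / 2 : ℕ) - (k : ℤ))
  | .inr (.inr _) => 0

/-- A linear functional that is positive on the positive roots. -/
def height (n : ℕ) : (Fin ((n - 1) / 2) → ℤ) →+ ℤ where
  toFun μ := ∑ k : Fin ((n - 1) / 2), (((n - 1) / 2 : ℕ) - ((k : ℕ) : ℤ)) * μ k
  map_zero' := by simp
  map_add' μ ν := by simp [mul_add, Finset.sum_add_distrib]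

theorem height_apply (μ : Fin ((n - 1) / 2) → ℤ) :
    height n μ = ∑ k : Fin ((n - 1) / 2), (((n - 1) / 2 : ℕ) - ((k : ℕ) : ℤ)) * μ k := rfl

theorem height_single (k : Fin ((n - 1) / 2)) :
    height n (Pi.single k 1) = ((n - 1) / 2 : ℕ) - (k : ℤ) := by
  rw [height_apply, Finset.sum_eq_single k] <;> simp +contextual

theorem height_isoWt (p : IsoIndex n) : height n (isoWt p) = isoHt p := by
  rcases p with k | k | u
  · exact height_single k
  · rw [isoWt, map_neg, height_single]; rfl
  · exact map_zero _

theorem height_pos_of_mem_posRoots {α : Fin ((n - 1) / 2) → ℤ} (hα : α ∈ posRoots n) :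
    0 < height n α := by
  rcases hα with ⟨i, j, hij, rfl | rfl⟩ | ⟨-, i, rfl⟩
  · rw [map_sub, height_single, height_single]
    have : (i : ℕ) < j := hij
    omega
  · rw [map_add, height_single, height_single]; omega
  · rw [height_single]; omega

theorem height_nonneg {α : Fin ((n - 1) / 2) → ℤ} (hα : α ∈ AddSubmonoid.closure (posRoots n)) :
    0 ≤ height n α := by
  induction hα using AddSubmonoid.closure_induction with
  | mem x hx => exact (height_pos_of_mem_posRoots hx).le
  | zero => simp
  | add x y _ _ hx hy => rw [map_add]; exact add_nonneg hx hy

theorem eq_zero_of_mem_closure_of_height {α : Fin ((n - 1) / 2) → ℤ}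
    (hα : α ∈ AddSubmonoid.closure (posRoots n)) (h : height n α = 0) : α = 0 := by
  induction hα using AddSubmonoid.closure_induction with
  | mem x hx => exact absurd h (height_pos_of_mem_posRoots hx).ne'
  | zero => rfl
  | add x y hx hy ihx ihy =>
    rw [map_add] at h
    have h1 := height_nonneg hx
    have h2 := height_nonneg hy
    rw [ihx (by omega), ihy (by omega), add_zero]

theorem eq_of_sub_mem_closure {μ ν : Fin ((n - 1) / 2) → ℤ}
    (h₁ : μ - ν ∈ AddSubmonoid.closure (posRoots n))
    (h₂ : ν - μ ∈ AddSubmonoid.closure (posRoots n)) : μ = ν := by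
  have a := height_nonneg h₁
  have b := height_nonneg h₂
  rw [map_sub] at a b
  exact sub_eq_zero.1 (eq_zero_of_mem_closure_of_height h₁ (by rw [map_sub]; omega))

theorem iso_zero_of_not_even (hn : ¬Even n) (u : Unit) :
    (iso (.inr (.inr u)) : Fin n → ℂ) = 0 := by
  funext a; simp [iso, hn]

theorem iso_zero_of_even [NeZero n] (hn : Even n) (u : Unit) :
    (iso (.inr (.inr u)) : Fin n → ℂ) = Pi.single ⟨n - 1, Nat.sub_one_lt (NeZero.ne n)⟩ 1 := by
  funext a
  have h0 := NeZero.ne n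
  simp only [iso, hn, and_true, Pi.single_apply, Fin.ext_iff]
  congr 1
  apply propext
  omega

/-- If distinct `p`, `q` lower the height then `-(wt p + wt q)` is a positive root, except where an
index `0` stands for the zero vector. -/
theorem isoWt_add_neg_mem_posRoots {p q : IsoIndex n} (hpq : p ≠ q) (h : isoHt p + isoHt q < 0) :
    -(isoWt p + isoWt q) ∈ posRoots n ∨ (iso p : Fin n → ℂ) = 0 ∨ (iso q : Fin n → ℂ) = 0 := by
  rcases p with j | j | u <;> rcases q with k | k | w <;>
    simp only [isoHt, isoWt] at h ⊢
  · omega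
  · left; left
    exact ⟨k, j, by rw [Fin.lt_def]; omega, Or.inl (by abel)⟩
  · omega
  · left; left
    exact ⟨j, k, by rw [Fin.lt_def]; omega, Or.inl (by abel)⟩
  · left; left
    rcases lt_trichotomy j k with hjk | rfl | hjk
    · exact ⟨j, k, hjk, Or.inr (by abel)⟩
    · exact absurd rfl hpq
    · exact ⟨k, j, hjk, Or.inr (by abel)⟩
  · by_cases hn : Even n
    · left; right; exact ⟨hn, j, by simp⟩
    · right; right; exact iso_zero_of_not_even hn _
  · omega
  · by_cases hn : Even n
    · left; right; exact ⟨hn, k, by simp⟩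
    · right; left; exact iso_zero_of_not_even hn _
  · omega

theorem idx₁_inj {j k : Fin ((n - 1) / 2)} : idx₁ j = idx₁ k ↔ j = k := by
  simp [idx₁, Fin.ext_iff]

theorem idx₂_inj {j k : Fin ((n - 1) / 2)} : idx₂ j = idx₂ k ↔ j = k := by
  simp [idx₂, Fin.ext_iff]

theorem idx₁_ne_idx₂ (j k : Fin ((n - 1) / 2)) : idx₁ j ≠ idx₂ k := by
  simp only [idx₁, idx₂, ne_eq, Fin.mk.injEq]; omega

theorem iso_zero_idx₁ (u : Unit) (k : Fin ((n - 1) / 2)) : iso (.inr (.inr u)) (idx₁ k) = 0 := by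
  have := k.2
  refine if_neg ?_
  rintro ⟨h, c, hc⟩
  simp only [idx₁] at h
  omega

theorem iso_zero_idx₂ (u : Unit) (k : Fin ((n - 1) / 2)) : iso (.inr (.inr u)) (idx₂ k) = 0 := by
  have := k.2
  refine if_neg ?_
  rintro ⟨h, c, hc⟩
  simp only [idx₂] at h
  omega

theorem iso_apply_zero [NeZero n] (p : IsoIndex n) : iso p (0 : Fin n) = 0 := by
  have h1 : ∀ k : Fin ((n - 1) / 2), (0 : Fin n) ≠ idx₁ k := fun k => by simp [idx₁, Fin.ext_iff]
  have h2 : ∀ k : Fin ((n - 1) / 2), (0 : Fin n) ≠ idx₂ k := fun k => by simp [idx₂, Fin.ext_iff]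
  rcases p with k | k | u
  · simp [iso, h1, h2]
  · simp [iso, h1, h2]
  · refine if_neg ?_
    rintro ⟨h, c, hc⟩
    simp only [Fin.val_zero] at h
    omega

/-- The value of the bilinear form on `iso p` and its dual: `1`, except for the index `0` with odd
`n`, where it is `0`. -/
noncomputable def isoNorm : IsoIndex n → ℂ
  | .inl _ => 1
  | .inr (.inl _) => 1
  | .inr (.inr _) => if Even n then 1 else 0

theorem iso_dotProduct_isoDual [NeZero n] (p q : IsoIndex n) :
    iso p ⬝ᵥ isoDual q = if p = q then isoNorm p else 0 := by
  have hz : ∀ u : Unit, ∀ w : Unit, (iso (.inr (.inr u)) : Fin n → ℂ) ⬝ᵥ iso (.inr (.inr w)) =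
      if Even n then 1 else 0 := fun u w => by
    by_cases hn : Even n
    · rw [iso_zero_of_even hn, if_pos hn]; simp
    · rw [iso_zero_of_not_even hn, if_neg hn]; simp
  have hs : ∀ (a : Fin n) (x : Fin n → ℂ), Pi.single a 1 ⬝ᵥ x = x a := fun a x => by simp
  have hs' : ∀ (a : Fin n) (x : Fin n → ℂ), x ⬝ᵥ Pi.single a 1 = x a := fun a x => by simp
  have a1 := fun j k : Fin ((n - 1) / 2) => idx₁_ne_idx₂ (n := n) j k
  have a2 := fun j k : Fin ((n - 1) / 2) => (idx₁_ne_idx₂ (n := n) k j).symm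
  have e : ∀ j k : Fin ((n - 1) / 2), iso (.inl j) ⬝ᵥ iso (.inr (.inl k)) =
      if j = k then (2 : ℂ) else 0 := fun j k => by
    by_cases h : j = k
    · simp [iso, h, a1, a2, Complex.I_mul_I]; norm_num
    · simp [iso, h, a1, a2, idx₁_inj, idx₂_inj, eq_comm]
  have e1 : ∀ j k : Fin ((n - 1) / 2), (iso (.inl j) : Fin n → ℂ) ⬝ᵥ iso (.inl k) = 0 :=
    fun j k => by
    by_cases h : j = k
    · simp [iso, h, a1, a2, Complex.I_mul_I]
    · simp [iso, h, a1, a2, idx₁_inj, idx₂_inj, eq_comm]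
  have e2 : ∀ j k : Fin ((n - 1) / 2),
      (iso (.inr (.inl j)) : Fin n → ℂ) ⬝ᵥ iso (.inr (.inl k)) = 0 :=
    fun j k => by
    by_cases h : j = k
    · simp [iso, h, a1, a2, Complex.I_mul_I]
    · simp [iso, h, a1, a2, idx₁_inj, idx₂_inj, eq_comm]
  have e3 : ∀ (j : Fin ((n - 1) / 2)) (u : Unit),
      (iso (.inl j) : Fin n → ℂ) ⬝ᵥ iso (.inr (.inr u)) = 0 := fun j u => by
    simp only [iso.eq_1, sub_dotProduct, smul_dotProduct, hs, iso_zero_idx₁, iso_zero_idx₂]; simp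
  have e4 : ∀ (j : Fin ((n - 1) / 2)) (u : Unit),
      (iso (.inr (.inl j)) : Fin n → ℂ) ⬝ᵥ iso (.inr (.inr u)) = 0 := fun j u => by
    simp only [iso.eq_2, add_dotProduct, smul_dotProduct, hs, iso_zero_idx₁, iso_zero_idx₂]; simp
  rcases p with j | j | u <;> rcases q with k | k | w <;>
    simp [isoDual, isoNorm, hz, e, e1, e2, e3, e4, dotProduct_comm (iso (.inr (.inr _))),
      dotProduct_comm (iso (.inr (.inl _))) (iso (.inl _)), eq_comm]

/-- The frames `iso` and `isoDual` represent the bilinear form on `e₁^⊥`. -/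
theorem sum_iso [NeZero n] {M : Type*} [AddCommGroup M] [Module ℂ M]
    (B : (Fin n → ℂ) →ₗ[ℂ] (Fin n → ℂ) →ₗ[ℂ] M) :
    ∑ p, B (iso p) (isoDual p) =
      ∑ a ∈ Finset.univ.erase (0 : Fin n), B (Pi.single a 1) (Pi.single a 1) := by
  have h0 := NeZero.ne n
  set g : ℕ → M := fun i => if h : i < n then B (Pi.single ⟨i, h⟩ 1) (Pi.single ⟨i, h⟩ 1) else 0
    with hg
  have h1 : ∀ a : Fin n, B (Pi.single a 1) (Pi.single a 1) = g a := fun a => by simp [hg]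
  have h2 : ∀ r : ℕ, ∑ i ∈ Finset.range (2 * r + 1), g i =
      g 0 + ∑ k : Fin r, (g (2 * k + 1) + g (2 * k + 2)) := fun r => by
    rw [Fin.sum_univ_eq_sum_range (fun k => g (2 * k + 1) + g (2 * k + 2))]
    induction r with
    | zero => simp
    | succ r ih =>
      rw [Finset.sum_range_succ _ r, ← add_assoc, ← ih, mul_add, mul_one,
        Finset.sum_range_succ, Finset.sum_range_succ, add_assoc]
  have h3 : ∑ a ∈ Finset.univ.erase (0 : Fin n), B (Pi.single a 1) (Pi.single a 1) =
      ∑ i ∈ Finset.range n, g i - g 0 := by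
    rw [eq_sub_iff_add_eq, ← Fin.sum_univ_eq_sum_range]
    simp only [h1]
    exact Finset.sum_erase_add _ _ (Finset.mem_univ (0 : Fin n))
  have h4 : ∀ k : Fin ((n - 1) / 2), B (iso (.inl k)) (isoDual (.inl k)) +
      B (iso (.inr (.inl k))) (isoDual (.inr (.inl k))) =
        g (2 * k + 1) + g (2 * k + 2) := fun k => by
    have e1 := h1 (idx₁ k)
    have e2 := h1 (idx₂ k)
    simp only [idx₁, idx₂] at e1 e2
    rw [← e1, ← e2]
    simp only [isoDual, iso, map_sub, map_add, map_smul, LinearMap.add_apply, LinearMap.sub_apply,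
      LinearMap.smul_apply, smul_add, smul_sub, smul_smul, idx₁, idx₂]
    match_scalars <;> ring_nf <;> simp
  rw [h3, Fintype.sum_sum_type, Fintype.sum_sum_type, ← add_assoc, ← Finset.sum_add_distrib,
    Finset.sum_congr rfl fun k _ => h4 k, Fintype.sum_unique (ι := Unit)]
  change _ + B (iso (.inr (.inr ()))) (iso (.inr (.inr ()))) = _
  by_cases hn : Even n
  · have hr : n = 2 * ((n - 1) / 2) + 1 + 1 := by obtain ⟨c, hc⟩ := hn; omega
    have h5 : ∑ i ∈ Finset.range n, g i =
        ∑ i ∈ Finset.range (2 * ((n - 1) / 2) + 1), g i + g (n - 1) := by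
      conv_lhs => rw [hr]
      rw [Finset.sum_range_succ]
      congr 2; omega
    rw [h5, h2, iso_zero_of_even hn, h1]
    abel
  · have hr : n = 2 * ((n - 1) / 2) + 1 := by
      obtain ⟨c, hc⟩ := Nat.not_even_iff_odd.1 hn; omega
    have h5 : ∑ i ∈ Finset.range n, g i = ∑ i ∈ Finset.range (2 * ((n - 1) / 2) + 1), g i := by
      rw [← hr]
    rw [h5, h2, iso_zero_of_not_even hn]
    simp

theorem eq_sum_single_of_apply_zero [NeZero n] {z : Fin n → ℂ} (hz : z 0 = 0) :
    z = ∑ a ∈ Finset.univ.erase (0 : Fin n), z a • Pi.single a 1 := by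
  have h := Finset.sum_erase_add Finset.univ (fun a => z a • (Pi.single a 1 : Fin n → ℂ))
    (Finset.mem_univ (0 : Fin n))
  rw [hz, zero_smul, add_zero] at h
  rw [h]
  exact pi_eq_sum_univ' z

/-- The vectors `iso p` span `e₁^⊥`. -/
theorem eq_sum_iso [NeZero n] {z : Fin n → ℂ} (hz : z 0 = 0) :
    z = ∑ p, (isoDual p ⬝ᵥ z) • iso p := by
  have h := sum_iso (LinearMap.mk₂ ℂ (fun x y : Fin n → ℂ => (y ⬝ᵥ z) • x)
    (fun x x' y => smul_add _ _ _) (fun c x y => smul_comm _ _ _)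
    (fun x y y' => by rw [add_dotProduct, add_smul])
    (fun c x y => by rw [smul_dotProduct, smul_eq_mul, mul_smul]))
  simp only [LinearMap.mk₂_apply] at h
  rw [h]
  simpa using eq_sum_single_of_apply_zero hz

end Isotropic

/-! ### Weights for the stabilizer of `e₁` -/

section Weights
variable {n : ℕ} {V : Type*} [NormedAddCommGroup V] [InnerProductSpace ℂ V]
variable {σ : Representation ℂ (SO n) V} {S : Fin n → Fin n → V →ₗ[ℂ] V}

theorem wedge_single_cube {a b : Fin n} (hab : a ≠ b) :
    wedge (Pi.single a 1) (Pi.single b 1) * (wedge (Pi.single a 1) (Pi.single b 1) *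
      wedge (Pi.single a 1) (Pi.single b 1)) = -wedge (Pi.single a 1) (Pi.single b 1) := by
  simp [wedge, mul_sub, sub_mul, vecMulVec_mul_vecMulVec, hab, hab.symm]
  abel

theorem rot_wedge_mulVec {a b c : Fin n} (hab : a ≠ b) (ha : a ≠ c) (hb : b ≠ c) (t : ℝ) :
    (rot (t • wedge (Pi.single a 1) (Pi.single b 1)) : Matrix (Fin n) (Fin n) ℝ) *ᵥ
      Pi.single c 1 = Pi.single c 1 := by
  have h0 : wedge (Pi.single a 1) (Pi.single b 1) *ᵥ Pi.single c 1 = 0 := by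
    simp only [wedge, sub_mulVec, vecMulVec_mulVec]
    simp [ha, hb]
  rw [coe_rot (by rw [transpose_smul, transpose_wedge, smul_neg]), exp_smul_of_cube
    (wedge_single_cube hab), add_mulVec, add_mulVec, smul_mulVec, smul_mulVec, ← mulVec_mulVec, h0,
    one_mulVec, mulVec_zero, smul_zero, smul_zero, add_zero, add_zero]

/-- The subspace `U` is invariant under the complexified Lie algebra of the stabilizer of `e₁`. -/
def IsStable [NeZero n] (S : Fin n → Fin n → V →ₗ[ℂ] V) (U : Submodule ℂ V) : Prop :=
  ∀ x y : Fin n → ℂ, x 0 = 0 → y 0 = 0 → ∀ v ∈ U, soBil S x y v ∈ U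

variable [NeZero n]

theorem isStable_of_S {U : Submodule ℂ V}
    (h : ∀ a b : Fin n, a ≠ 0 → b ≠ 0 → ∀ v ∈ U, S a b v ∈ U) : IsStable S U := by
  intro x y hx hy v hv
  rw [soBil_apply, LinearMap.sum_apply]
  refine U.sum_mem fun a _ => ?_
  rw [LinearMap.sum_apply]
  refine U.sum_mem fun b _ => ?_
  by_cases ha : a = 0
  · simp [ha, hx]
  by_cases hb : b = 0
  · simp [hb, hy]
  exact U.smul_mem _ (h a b ha hb v hv)

theorem IsStable.S_mem {U : Submodule ℂ V} (hU : IsStable S U) {a b : Fin n} (ha : a ≠ 0)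
    (hb : b ≠ 0) {v : V} (hv : v ∈ U) : S a b v ∈ U := by
  rw [← soBil_single (S := S)]
  exact hU _ _ (by simp [ha.symm]) (by simp [hb.symm]) v hv

theorem isStable_of_iso {U : Submodule ℂ V}
    (h : ∀ p q : IsoIndex n, ∀ v ∈ U, soBil S (iso p) (iso q) v ∈ U) : IsStable S U := by
  intro x y hx hy v hv
  rw [eq_sum_iso hx, eq_sum_iso hy]
  simp only [map_sum, map_smul, LinearMap.sum_apply, LinearMap.smul_apply]
  exact U.sum_mem fun p _ => U.smul_mem _ (U.sum_mem fun q _ => U.smul_mem _ (h _ _ v hv))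

theorem IsDifferential.isStable [FiniteDimensional ℂ V] (hS : IsDifferential σ S)
    {U : Submodule ℂ V} (hU : ∀ m : SO n,
      (m : Matrix (Fin n) (Fin n) ℝ).mulVec (Pi.single 0 1) = Pi.single 0 1 → U.map (σ m) ≤ U) :
    IsStable S U := by
  refine isStable_of_S fun a b ha hb v hv => ?_
  by_cases hab : a = b
  · subst hab
    rw [← soBil_single (S := S), hS.soBil_self]
    exact U.zero_mem
  · rw [← hS.soAct_wedge_single]
    exact hS.soAct_mem (transpose_wedge _ _) (fun t => hU _ (rot_wedge_mulVec hab ha hb t)) hv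

theorem IsStable.map_le [FiniteDimensional ℂ V] (hσ : IsIrredUnitary σ) (hS : IsDifferential σ S)
    {U : Submodule ℂ V} (hU : IsStable S U) (m : SO n)
    (hm : (m : Matrix (Fin n) (Fin n) ℝ).mulVec (Pi.single 0 1) = Pi.single 0 1) :
    U.map (σ m) ≤ U := by
  refine hS.map_le_of_S_mem hσ (k := 1) (fun a b ha hb v hv => hU.S_mem ?_ ?_ hv) m fun i hi => ?_
  · rintro rfl; simp at ha
  · rintro rfl; simp at hb
  · obtain rfl : i = 0 := Fin.ext (by simpa using hi)
    exact hm

theorem isIrredSub_iff [FiniteDimensional ℂ V] (hσ : IsIrredUnitary σ) (hS : IsDifferential σ S)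
    {U : Submodule ℂ V} : IsIrredSub σ U ↔ U ≠ ⊥ ∧ IsStable S U ∧
      ∀ Q ≤ U, IsStable S Q → Q = ⊥ ∨ Q = U :=
  ⟨fun h => ⟨h.ne_bot, hS.isStable h.invariant,
    fun Q hQ hQ' => h.minimal Q hQ fun m hm => hQ'.map_le hσ hS m hm⟩,
   fun h => ⟨h.1, fun m hm => h.2.1.map_le hσ hS m hm,
    fun Q hQ hQ' => h.2.2 Q hQ (hS.isStable hQ')⟩⟩

theorem IsStable.inf {U Q : Submodule ℂ V} (hU : IsStable S U) (hQ : IsStable S Q) :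
    IsStable S (U ⊓ Q) :=
  fun x y hx hy v hv => ⟨hU x y hx hy v hv.1, hQ x y hx hy v hv.2⟩

theorem IsStable.iSup {ι : Sort*} {U : ι → Submodule ℂ V} (hU : ∀ i, IsStable S (U i)) :
    IsStable S (⨆ i, U i) := by
  intro x y hx hy v hv
  have : (⨆ i, U i) ≤ (⨆ i, U i).comap (soBil S x y) :=
    iSup_le fun i v hv => Submodule.mem_iSup_of_mem i (hU i x y hx hy v hv)
  exact this hv

theorem IsStable.sup {U Q : Submodule ℂ V} (hU : IsStable S U) (hQ : IsStable S Q) :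
    IsStable S (U ⊔ Q) := by
  intro x y hx hy v hv
  have : U ⊔ Q ≤ (U ⊔ Q).comap (soBil S x y) :=
    sup_le (fun v hv => Submodule.mem_sup_left (hU x y hx hy v hv))
      fun v hv => Submodule.mem_sup_right (hQ x y hx hy v hv)
  exact this hv

theorem IsStable.orthogonal [FiniteDimensional ℂ V] (hσ : IsIrredUnitary σ)
    (hS : IsDifferential σ S) {U : Submodule ℂ V} (hU : IsStable S U) : IsStable S Uᗮ := by
  refine isStable_of_S fun a b ha hb v hv => ?_
  rw [Submodule.mem_orthogonal] at hv ⊢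
  intro u hu
  rw [← neg_eq_zero, ← hS.inner_S hσ]
  exact hv _ (hU.S_mem ha hb hu)

/-- The orthogonal projection to an invariant subspace commutes with the action. -/
theorem IsStable.starProjection [FiniteDimensional ℂ V] (hσ : IsIrredUnitary σ)
    (hS : IsDifferential σ S) {U : Submodule ℂ V} (hU : IsStable S U) {x y : Fin n → ℂ}
    (hx : x 0 = 0) (hy : y 0 = 0) (v : V) :
    U.starProjection (soBil S x y v) = soBil S x y (U.starProjection v) := by
  conv_lhs => rw [← U.starProjection_add_starProjection_orthogonal v]
  rw [map_add (soBil S x y), map_add, Submodule.starProjection_eq_self_iff.2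
    (hU x y hx hy _ (Submodule.starProjection_apply_mem _ _)),
    (Submodule.starProjection_apply_eq_zero_iff U).2
      (hU.orthogonal hσ hS x y hx hy _ (Submodule.starProjection_apply_mem _ _)), add_zero]

/-- A minimal element among the nonzero invariant subspaces of `Q` is irreducible. -/
theorem exists_isIrredSub_le [FiniteDimensional ℂ V] (hσ : IsIrredUnitary σ)
    (hS : IsDifferential σ S) {Q : Submodule ℂ V} (hQ : IsStable S Q) (h0 : Q ≠ ⊥) :
    ∃ U ≤ Q, IsIrredSub σ U := by
  obtain ⟨U, ⟨hU, hU0, hUQ⟩, hmin⟩ := WellFounded.has_min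
    (wellFounded_lt : WellFounded ((· < ·) : Submodule ℂ V → Submodule ℂ V → Prop))
    {U | IsStable S U ∧ U ≠ ⊥ ∧ U ≤ Q} ⟨Q, hQ, h0, le_rfl⟩
  refine ⟨U, hUQ, (isIrredSub_iff hσ hS).2 ⟨hU0, hU, fun R hR hR' => ?_⟩⟩
  by_contra! h
  exact hmin R ⟨hR', h.1, hR.trans hUQ⟩ (lt_of_le_of_ne hR h.2)

end Weights

/-! #### Weight vectors -/

theorem rotGen_eq {n : ℕ} (k : Fin ((n - 1) / 2)) :
    rotGen n k = wedge (Pi.single (idx₂ k) 1) (Pi.single (idx₁ k) 1) := by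
  simp [rotGen, wedge, idx₁, idx₂, single_eq_single_vecMulVec_single]

theorem IsDifferential.soBil_inl_inr {n : ℕ} {V : Type*} [NormedAddCommGroup V]
    [InnerProductSpace ℂ V] {σ : Representation ℂ (SO n) V} {S : Fin n → Fin n → V →ₗ[ℂ] V}
    (hS : IsDifferential σ S) (k : Fin ((n - 1) / 2)) :
    soBil S (iso (.inl k)) (iso (.inr (.inl k))) = (-2 * Complex.I) • S (idx₂ k) (idx₁ k) := by
  simp only [iso, map_add, map_sub, map_smul, LinearMap.sub_apply, LinearMap.smul_apply,
    soBil_single]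
  rw [hS.antisymm (idx₁ k) (idx₂ k)]
  have h1 : ∀ a, S a a = 0 := fun a => by rw [← soBil_single (S := S), hS.soBil_self]
  rw [h1, h1]
  module

section WeightVectors
variable {n : ℕ} {V : Type*} [NormedAddCommGroup V] [InnerProductSpace ℂ V]
  [FiniteDimensional ℂ V]
variable {σ : Representation ℂ (SO n) V} {S : Fin n → Fin n → V →ₗ[ℂ] V}

theorem IsDifferential.rot_apply_of_eigenvector (hS : IsDifferential σ S)
    {A : Matrix (Fin n) (Fin n) ℝ} (hA : Aᵀ = -A) {v : V} {z : ℂ} (hv : soAct S A v = z • v)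
    (t : ℝ) : σ (rot (t • A)) v = Complex.exp (z * t) • v := by
  have h1 : ∀ t : ℝ, HasDerivAt (fun t : ℝ => Complex.exp (-z * t) • σ (rot (t • A)) v) 0 t :=
    fun t => by
    have h2 : HasDerivAt (fun t : ℝ => Complex.exp (-z * t)) (Complex.exp (-z * t) * (-z)) t := by
      simpa using (((hasDerivAt_id t).ofReal_comp).const_mul (-z)).cexp
    refine (h2.smul (hS.hasDerivAt hA v t)).congr_deriv ?_
    rw [hv, map_smul, smul_smul, ← add_smul]
    simp
  have h2 := is_const_of_deriv_eq_zero (fun t => (h1 t).differentiableAt)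
    (fun t => (h1 t).deriv) t 0
  simp only [Complex.ofReal_zero, mul_zero, Complex.exp_zero, zero_smul, rot_zero, map_one,
    Module.End.one_apply, one_smul] at h2
  conv_rhs => rw [← h2]
  rw [smul_smul, ← Complex.exp_add]
  simp

/-- Weight vectors are the simultaneous eigenvectors of the generators of the maximal torus. -/
theorem IsDifferential.mem_weightSpace_iff (hS : IsDifferential σ S)
    {μ : Fin ((n - 1) / 2) → ℤ} {v : V} :
    v ∈ weightSpace σ μ ↔ ∀ k, S (idx₂ k) (idx₁ k) v = (Complex.I * μ k) • v := by
  have hA : ∀ (k : Fin ((n - 1) / 2)) (θ : ℝ), (θ • rotGen n k)ᵀ = -(θ • rotGen n k) :=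
    fun k θ => by rw [rotGen_eq, transpose_smul, transpose_wedge, smul_neg]
  have hA' : ∀ k : Fin ((n - 1) / 2), (rotGen n k)ᵀ = -rotGen n k := fun k => by
    rw [rotGen_eq, transpose_wedge]
  have hs : ∀ k : Fin ((n - 1) / 2), soAct S (rotGen n k) = S (idx₂ k) (idx₁ k) := fun k => by
    rw [rotGen_eq, hS.soAct_wedge_single]
  constructor
  · intro hv k
    have h1 : ∀ t : ℝ, σ (rot (t • rotGen n k)) v = Complex.exp (Complex.I * μ k * t) • v :=
      fun t => hv k t _ (coe_rot (hA k t))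
    have h2 := hS.hasDerivAt_zero _ (hA' k) v
    simp only [h1] at h2
    have h3 : HasDerivAt (fun t : ℝ => Complex.exp (Complex.I * μ k * t))
        (Complex.exp (Complex.I * μ k * (0 : ℝ)) * (Complex.I * μ k)) 0 := by
      simpa using (((hasDerivAt_id (0 : ℝ)).ofReal_comp).const_mul (Complex.I * μ k)).cexp
    rw [← hs, h2.unique (h3.smul_const v)]
    simp
  · intro h k θ m hm
    obtain rfl : m = rot (θ • rotGen n k) := Subtype.ext (hm.trans (coe_rot (hA k θ)).symm)
    exact hS.rot_apply_of_eigenvector (hA' k) (by rw [hs, h]) θ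

/-- The weights are integral since the rotation by `2π` is trivial. -/
theorem IsDifferential.exists_int_of_eigenvector (hS : IsDifferential σ S)
    (k : Fin ((n - 1) / 2)) {v : V} (h0 : v ≠ 0) {z : ℂ} (hv : S (idx₂ k) (idx₁ k) v = z • v) :
    ∃ m : ℤ, z = Complex.I * m := by
  have h1 := hS.rot_apply_of_eigenvector
    (transpose_wedge (Pi.single (idx₂ k) 1) (Pi.single (idx₁ k) 1))
    (by rw [hS.soAct_wedge_single, hv]) (2 * Real.pi)
  have h2 : rot ((2 * Real.pi) • wedge (Pi.single (idx₂ k) 1) (Pi.single (idx₁ k) 1)) =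
      (1 : SO n) := by
    apply Subtype.ext
    rw [coe_rot (by rw [transpose_smul, transpose_wedge, smul_neg]),
      exp_smul_of_cube (wedge_single_cube (idx₁_ne_idx₂ k k).symm)]
    simp
  rw [h2, map_one, Module.End.one_apply] at h1
  have h3 : (Complex.exp (z * (2 * Real.pi : ℝ)) - 1) • v = 0 := by
    rw [sub_smul, ← h1, one_smul, sub_self]
  obtain ⟨m, hm⟩ := Complex.exp_eq_one_iff.1
    (sub_eq_zero.1 ((smul_eq_zero.1 h3).resolve_right h0))
  refine ⟨m, ?_⟩
  push_cast at hm
  have h4 : (2 * Real.pi : ℂ) * (z - Complex.I * m) = 0 := by linear_combination hm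
  exact sub_eq_zero.1 ((mul_eq_zero.1 h4).resolve_left (by simp))

theorem inner_eq_zero_of_weight_ne (hσ : IsIrredUnitary σ) (hS : IsDifferential σ S)
    {μ ν : Fin ((n - 1) / 2) → ℤ} (h : μ ≠ ν) {v w : V} (hv : v ∈ weightSpace σ μ)
    (hw : w ∈ weightSpace σ ν) : inner ℂ v w = 0 := by
  obtain ⟨k, hk⟩ := Function.ne_iff.1 h
  have h1 := hS.inner_S hσ (idx₂ k) (idx₁ k) v w
  rw [hS.mem_weightSpace_iff.1 hv k, hS.mem_weightSpace_iff.1 hw k, inner_smul_left,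
    inner_smul_right] at h1
  simp only [map_mul, Complex.conj_I, map_intCast] at h1
  have h2 : (μ k - ν k : ℂ) * inner ℂ v w = 0 := by
    have h3 := congrArg (fun z => Complex.I * z) h1
    have hI := Complex.I_mul_I
    linear_combination h3 + (μ k - ν k : ℂ) * inner ℂ v w * hI
  refine (mul_eq_zero.1 h2).resolve_left (sub_ne_zero.2 ?_)
  exact_mod_cast hk

/-- The same description of weight vectors in terms of the isotropic vectors `iso (±k)`, whose pairs
give the generators of the torus up to a factor. -/
theorem IsDifferential.mem_weightSpace_iff' (hS : IsDifferential σ S)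
    {μ : Fin ((n - 1) / 2) → ℤ} {v : V} : v ∈ weightSpace σ μ ↔
      ∀ k, soBil S (iso (.inl k)) (iso (.inr (.inl k))) v = (2 * μ k : ℂ) • v := by
  rw [hS.mem_weightSpace_iff]
  refine forall_congr' fun k => ?_
  rw [hS.soBil_inl_inr, LinearMap.smul_apply]
  constructor
  · intro h
    rw [h, smul_smul]
    congr 1
    linear_combination (-2 * (μ k : ℂ)) * Complex.I_mul_I
  · intro h
    have h2 := congrArg (fun w => (Complex.I / 2) • w) h
    simp only [smul_smul] at h2
    convert h2 using 1
    · rw [show Complex.I / 2 * (-2 * Complex.I) = 1 by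
        linear_combination (-1 : ℂ) * Complex.I_mul_I, one_smul]
    · congr 1; ring

/-- The vector `iso p` is an eigenvector of weight `wt p` for the action of the torus on `ℂⁿ`. -/
theorem iso_dotProduct_iso [NeZero n] (k : Fin ((n - 1) / 2)) (p : IsoIndex n) :
    (iso (.inr (.inl k)) ⬝ᵥ iso p) • iso (.inl k) - (iso (.inl k) ⬝ᵥ iso p) • iso (.inr (.inl k)) =
      (2 * isoWt p k : ℂ) • (iso p : Fin n → ℂ) := by
  have e1 : (iso (.inl k) : Fin n → ℂ) = (2 : ℂ) • isoDual (.inr (.inl k)) := by simp [isoDual]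
  have e2 : (iso (.inr (.inl k)) : Fin n → ℂ) = (2 : ℂ) • isoDual (.inl k) := by simp [isoDual]
  have h1 : (iso (.inr (.inl k)) : Fin n → ℂ) ⬝ᵥ iso p =
      if p = .inl k then 2 * isoNorm p else 0 := by
    rw [e2, smul_dotProduct, dotProduct_comm, iso_dotProduct_isoDual]; simp
  have h2 : (iso (.inl k) : Fin n → ℂ) ⬝ᵥ iso p =
      if p = .inr (.inl k) then 2 * isoNorm p else 0 := by
    rw [e1, smul_dotProduct, dotProduct_comm, iso_dotProduct_isoDual]; simp
  rw [h1, h2]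
  rcases p with j | j | u
  · by_cases h : j = k
    · subst h; simp [isoNorm, isoWt]
    · simp [h, isoWt, Ne.symm h]
  · by_cases h : j = k
    · subst h; simp [isoNorm, isoWt]
    · simp [h, isoWt, Ne.symm h]
  · simp [isoWt]

/-- The bracket relations in the form of a derivation: the operator of `u`, `v` acts on both vectors
`x` and `y`. -/
theorem IsDifferential.commutator_apply' (hS : IsDifferential σ S)
    (u v x y : Fin n → ℂ) (w : V) : soBil S u v (soBil S x y w) = soBil S x y (soBil S u v w) +
      (soBil S ((v ⬝ᵥ x) • u - (u ⬝ᵥ x) • v) y w + soBil S x ((v ⬝ᵥ y) • u - (u ⬝ᵥ y) • v) w) := by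
  rw [hS.commutator_apply]
  simp only [map_sub, map_smul, LinearMap.sub_apply, LinearMap.smul_apply]
  abel

/-- The operator of the pair `p`, `q` shifts weights by `wt p + wt q`. -/
theorem IsDifferential.soBil_iso_mem_weightSpace [NeZero n] (hS : IsDifferential σ S)
    {μ : Fin ((n - 1) / 2) → ℤ} {v : V} (hv : v ∈ weightSpace σ μ) (p q : IsoIndex n) :
    soBil S (iso p) (iso q) v ∈ weightSpace σ (μ + (isoWt p + isoWt q)) := by
  rw [hS.mem_weightSpace_iff'] at hv ⊢
  intro k
  rw [hS.commutator_apply', hv k, iso_dotProduct_iso, iso_dotProduct_iso]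
  simp only [map_smul, LinearMap.smul_apply, Pi.add_apply, Int.cast_add]
  module

/-- `X_{ε_p} = S(ε_p, e₁)` shifts weights by `wt p`. -/
theorem IsDifferential.soBil_iso_single_mem_weightSpace [NeZero n] (hS : IsDifferential σ S)
    {μ : Fin ((n - 1) / 2) → ℤ} {v : V} (hv : v ∈ weightSpace σ μ) (p : IsoIndex n) :
    soBil S (iso p) (Pi.single 0 1) v ∈ weightSpace σ (μ + isoWt p) := by
  rw [hS.mem_weightSpace_iff'] at hv ⊢
  intro k
  rw [hS.commutator_apply', hv k, iso_dotProduct_iso]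
  have h0 : ∀ p : IsoIndex n, iso p ⬝ᵥ (Pi.single 0 1 : Fin n → ℂ) = 0 := fun p => by
    rw [dotProduct_single, iso_apply_zero, zero_mul]
  simp only [map_smul, LinearMap.smul_apply, Pi.add_apply, Int.cast_add, h0, zero_smul, sub_zero,
    map_zero, LinearMap.zero_apply]
  module

end WeightVectors

/-! ### Highest weight vectors -/

section HighestWeight
variable {n : ℕ} {V : Type*} [NormedAddCommGroup V] [InnerProductSpace ℂ V]
variable {σ : Representation ℂ (SO n) V} {S : Fin n → Fin n → V →ₗ[ℂ] V}

/-- The vector `v` is annihilated by all operators that raise the height of weights. -/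
def IsRaisedToZero (S : Fin n → Fin n → V →ₗ[ℂ] V) (v : V) : Prop :=
  ∀ p q : IsoIndex n, 0 < isoHt p + isoHt q → soBil S (iso p) (iso q) v = 0

/-- The vectors, with their weights, that arise from the vector `u` of weight `ν` by repeated
application of negative root vectors. -/
inductive IsLowered (S : Fin n → Fin n → V →ₗ[ℂ] V) (u : V) (ν : Fin ((n - 1) / 2) → ℤ) :
    V → (Fin ((n - 1) / 2) → ℤ) → Prop
  | base : IsLowered S u ν u ν
  | lower {v : V} {μ : Fin ((n - 1) / 2) → ℤ} (p q : IsoIndex n)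
      (hpq : -(isoWt p + isoWt q) ∈ posRoots n) (hv : IsLowered S u ν v μ) :
      IsLowered S u ν (soBil S (iso p) (iso q) v) (μ + (isoWt p + isoWt q))

theorem IsLowered.sub_mem {u v : V} {ν μ : Fin ((n - 1) / 2) → ℤ} (h : IsLowered S u ν v μ) :
    ν - μ ∈ AddSubmonoid.closure (posRoots n) := by
  induction h with
  | base => rw [sub_self]; exact zero_mem _
  | @lower v μ p q hpq hv ih =>
    have := add_mem ih (AddSubmonoid.subset_closure hpq)
    rwa [show ν - μ + -(isoWt p + isoWt q) = ν - (μ + (isoWt p + isoWt q)) by abel] at this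

theorem IsLowered.mem_span {u v : V} {ν μ : Fin ((n - 1) / 2) → ℤ} (h : IsLowered S u ν v μ) :
    v ∈ Submodule.span ℂ {v | ∃ μ, IsLowered S u ν v μ} :=
  Submodule.subset_span ⟨μ, h⟩

variable [FiniteDimensional ℂ V]

/-- The scalar by which `S(ε_p, ε_p^*)` acts on vectors of weight `μ`. -/
theorem IsDifferential.soBil_iso_isoDual (hS : IsDifferential σ S)
    {μ : Fin ((n - 1) / 2) → ℤ} {v : V} (hv : v ∈ weightSpace σ μ) (p : IsoIndex n) :
    soBil S (iso p) (isoDual p) v = ((∑ k, isoWt p k * μ k : ℤ) : ℂ) • v := by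
  have h := hS.mem_weightSpace_iff'.1 hv
  rcases p with k | k | u
  · rw [isoDual, map_smul, LinearMap.smul_apply, h, smul_smul, Finset.sum_eq_single k]
    · congr 1; simp [isoWt]
    · intro j _ hj; simp [isoWt, hj]
    · simp
  · rw [isoDual, map_smul, LinearMap.smul_apply, hS.soBil_antisymm, LinearMap.neg_apply, h,
      ← neg_smul, smul_smul, Finset.sum_eq_single k]
    · congr 1; simp [isoWt]
    · intro j _ hj; simp [isoWt, hj]
    · simp
  · change soBil S (iso (.inr (.inr u))) (iso (.inr (.inr u))) v = _
    rw [hS.soBil_self]; simp [isoWt]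

/-- Only indices opposite to each other have heights with sum `0`. -/
theorem exists_iso_eq_smul_isoDual {p q : IsoIndex n} (h : isoHt p + isoHt q = 0) :
    ∃ c : ℂ, (iso q : Fin n → ℂ) = c • isoDual p := by
  rcases p with j | j | u <;> rcases q with k | k | w <;> simp only [isoHt] at h
  · omega
  · obtain rfl : j = k := Fin.ext (by omega)
    exact ⟨2, by simp [isoDual]⟩
  · omega
  · obtain rfl : j = k := Fin.ext (by omega)
    exact ⟨2, by simp [isoDual]⟩
  · omega
  · omega
  · omega
  · omega
  · exact ⟨1, by simp [isoDual]⟩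

/-- The heights of the weights are halves of eigenvalues of a single operator. -/
theorem finite_weights (hS : IsDifferential σ S) :
    {z : ℤ | ∃ μ, height n μ = z ∧ weightSpace σ μ ≠ ⊥}.Finite := by
  -- `T` acts on vectors of weight `μ` by twice the height of `μ`
  set T : Module.End ℂ V := ∑ k : Fin ((n - 1) / 2),
    (((n - 1) / 2 : ℕ) - (k : ℕ) : ℂ) • soBil S (iso (.inl k)) (iso (.inr (.inl k))) with hT
  refine Set.Finite.of_finite_image (f := fun z : ℤ => (2 * z : ℂ))
    ((Module.End.finite_spectrum T).subset ?_) ?_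
  · rintro _ ⟨z, ⟨μ, rfl, hμ⟩, rfl⟩
    obtain ⟨v, hv, hv0⟩ := Submodule.exists_mem_ne_zero_of_ne_bot hμ
    refine Module.End.HasEigenvalue.mem_spectrum (Module.End.hasEigenvalue_of_hasEigenvector
      (x := v) ⟨Module.End.mem_eigenspace_iff.2 ?_, hv0⟩)
    rw [hT, LinearMap.sum_apply]
    simp only [LinearMap.smul_apply, hS.mem_weightSpace_iff'.1 hv, smul_smul]
    rw [← Finset.sum_smul, height_apply]
    congr 1
    simp only [Int.cast_sum, Int.cast_mul, Int.cast_sub, Int.cast_natCast]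
    rw [Finset.mul_sum]
    exact Finset.sum_congr rfl fun k _ => by ring
  · intro a _ b _ h
    simpa using h

variable [NeZero n]

theorem IsLowered.mem_weightSpace (hS : IsDifferential σ S) {u v : V}
    {ν μ : Fin ((n - 1) / 2) → ℤ} (h : IsLowered S u ν v μ) (hu : u ∈ weightSpace σ ν) :
    v ∈ weightSpace σ μ := by
  induction h with
  | base => exact hu
  | lower p q hpq hv ih => exact hS.soBil_iso_mem_weightSpace ih p q

/-- The span of the vectors obtained by lowering from a highest weight vector is invariant: a
raising operator is moved past the lowering ones until it reaches the highest weight vector. -/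
theorem IsLowered.soBil_mem_span (hS : IsDifferential σ S) {u v : V}
    {ν μ : Fin ((n - 1) / 2) → ℤ} (hu : u ∈ weightSpace σ ν) (hr : IsRaisedToZero S u)
    (h : IsLowered S u ν v μ) (p q : IsoIndex n) :
    soBil S (iso p) (iso q) v ∈ Submodule.span ℂ {v | ∃ μ, IsLowered S u ν v μ} := by
  have hneg : ∀ {v : V} {μ : Fin ((n - 1) / 2) → ℤ}, IsLowered S u ν v μ → ∀ p q : IsoIndex n,
      isoHt p + isoHt q < 0 →
      soBil S (iso p) (iso q) v ∈ Submodule.span ℂ {v | ∃ μ, IsLowered S u ν v μ} := by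
    intro v μ hv p q hpq
    by_cases hp : p = q
    · rw [hp, hS.soBil_self]; exact zero_mem _
    rcases isoWt_add_neg_mem_posRoots hp hpq with h1 | h1 | h1
    · exact (hv.lower p q h1).mem_span
    · rw [h1]; simp
    · rw [h1]; simp
  have hzero : ∀ {v : V} {μ : Fin ((n - 1) / 2) → ℤ}, IsLowered S u ν v μ → ∀ p q : IsoIndex n,
      isoHt p + isoHt q = 0 →
      soBil S (iso p) (iso q) v ∈ Submodule.span ℂ {v | ∃ μ, IsLowered S u ν v μ} := by
    intro v μ hv p q hpq
    obtain ⟨c, hc⟩ := exists_iso_eq_smul_isoDual hpq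
    rw [hc, map_smul, LinearMap.smul_apply, hS.soBil_iso_isoDual (hv.mem_weightSpace hS hu)]
    exact Submodule.smul_mem _ _ (Submodule.smul_mem _ _ hv.mem_span)
  induction h generalizing p q with
  | base =>
    rcases lt_trichotomy (isoHt p + isoHt q) 0 with hpq | hpq | hpq
    · exact hneg .base p q hpq
    · exact hzero .base p q hpq
    · rw [hr p q hpq]; exact zero_mem _
  | @lower v μ p' q' hpq' hv ih =>
    rcases lt_trichotomy (isoHt p + isoHt q) 0 with hpq | hpq | hpq
    · exact hneg (hv.lower p' q' hpq') p q hpq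
    · exact hzero (hv.lower p' q' hpq') p q hpq
    -- the raising operator of `p`, `q` is moved past the last lowering operator, that of `p'`,
    -- `q'`; the commutator terms are operators applied to the vector before this lowering step
    have h3 : isoHt p' + isoHt q' < 0 := by
      have := height_pos_of_mem_posRoots hpq'
      rw [map_neg, map_add, height_isoWt, height_isoWt] at this
      omega
    rw [hS.commutator_apply']
    refine add_mem ?_ (add_mem ?_ ?_)
    · have h4 : Submodule.span ℂ {v | ∃ μ, IsLowered S u ν v μ} ≤
          (Submodule.span ℂ {v | ∃ μ, IsLowered S u ν v μ}).comap (soBil S (iso p') (iso q')) :=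
        Submodule.span_le.2 fun w ⟨κ, hw⟩ => hneg hw p' q' h3
      exact h4 (ih p q)
    · simp only [map_sub, map_smul, LinearMap.sub_apply, LinearMap.smul_apply]
      exact Submodule.sub_mem _ (Submodule.smul_mem _ _ (ih _ _)) (Submodule.smul_mem _ _ (ih _ _))
    · simp only [map_sub, map_smul, LinearMap.sub_apply, LinearMap.smul_apply]
      exact Submodule.sub_mem _ (Submodule.smul_mem _ _ (ih _ _)) (Submodule.smul_mem _ _ (ih _ _))

/-- An irreducible subrepresentation with a weight vector that is annihilated by all raising
operators has the weight of that vector as its highest weight: the vector generates it by lowering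
operators. -/
theorem IsIrredSub.hasHighestWeight (hσ : IsIrredUnitary σ) (hS : IsDifferential σ S)
    {U : Submodule ℂ V} (hU : IsIrredSub σ U) {u : V} (huU : u ∈ U) (hu0 : u ≠ 0)
    {ν : Fin ((n - 1) / 2) → ℤ} (hu : u ∈ weightSpace σ ν) (hr : IsRaisedToZero S u) :
    HasHighestWeight σ U ν := by
  obtain ⟨-, hUs, hUm⟩ := (isIrredSub_iff hσ hS).1 hU
  set Q := Submodule.span ℂ {v | ∃ μ, IsLowered S u ν v μ} with hQ
  have hQs : IsStable S Q := isStable_of_iso fun p q => by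
    have : Q ≤ Q.comap (soBil S (iso p) (iso q)) :=
      Submodule.span_le.2 fun w ⟨κ, hw⟩ => hw.soBil_mem_span hS hu hr p q
    exact fun v hv => this hv
  have huQ : u ∈ Q := IsLowered.base.mem_span
  have hUQ : U ≤ Q := by
    rcases hUm (U ⊓ Q) inf_le_left (hUs.inf hQs) with h | h
    · exact absurd ((Submodule.eq_bot_iff _).1 h u ⟨huU, huQ⟩) hu0
    · exact inf_eq_left.1 h
  refine ⟨fun h => hu0 ((Submodule.eq_bot_iff _).1 h u ⟨huU, hu⟩), fun κ hκ => ?_⟩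
  -- a vector of weight `κ` is orthogonal to all lowered vectors of weights other than `κ`
  obtain ⟨w, ⟨hwU, hw⟩, hw0⟩ := Submodule.exists_mem_ne_zero_of_ne_bot hκ
  by_contra hcon
  have h1 : Q ≤ (ℂ ∙ w)ᗮ := Submodule.span_le.2 fun v ⟨μ, hv⟩ => by
    rw [SetLike.mem_coe, Submodule.mem_orthogonal_singleton_iff_inner_right]
    refine inner_eq_zero_of_weight_ne hσ hS ?_ hw (hv.mem_weightSpace hS hu)
    rintro rfl
    exact hcon hv.sub_mem
  exact hw0 (inner_self_eq_zero.1
    ((Submodule.mem_orthogonal_singleton_iff_inner_right).1 (h1 (hUQ hwU))))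

/-- A vector of highest weight is annihilated by the raising operators, which would produce a weight
of larger height. -/
theorem HasHighestWeight.isRaisedToZero (hS : IsDifferential σ S) {U : Submodule ℂ V}
    (hU : IsStable S U) {τ : Fin ((n - 1) / 2) → ℤ} (h : HasHighestWeight σ U τ) {u : V}
    (huU : u ∈ U) (hu : u ∈ weightSpace σ τ) : IsRaisedToZero S u := by
  intro p q hpq
  by_contra h0
  have h1 := h.2 _ (fun hbot => h0 ((Submodule.eq_bot_iff _).1 hbot _
    ⟨hU _ _ (iso_apply_zero p) (iso_apply_zero q) u huU, hS.soBil_iso_mem_weightSpace hu p q⟩))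
  have h2 := height_nonneg h1
  rw [map_sub, map_add, map_add, height_isoWt, height_isoWt] at h2
  omega

/-- The generators of the torus commute, hence have a simultaneous eigenvector in `U`; it is a
weight vector by `IsDifferential.exists_int_of_eigenvector`. -/
theorem exists_weightSpace_ne_bot (hS : IsDifferential σ S) {U : Submodule ℂ V}
    (hU : IsStable S U) (h0 : U ≠ ⊥) : ∃ μ, U ⊓ weightSpace σ μ ≠ ⊥ := by
  have hne1 : ∀ k : Fin ((n - 1) / 2), idx₁ k ≠ (0 : Fin n) := fun k => by
    simp [idx₁, Fin.ext_iff]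
  have hne2 : ∀ k : Fin ((n - 1) / 2), idx₂ k ≠ (0 : Fin n) := fun k => by
    simp [idx₂, Fin.ext_iff]
  have hcomm : ∀ j k : Fin ((n - 1) / 2), ∀ v, S (idx₂ j) (idx₁ j) (S (idx₂ k) (idx₁ k) v) =
      S (idx₂ k) (idx₁ k) (S (idx₂ j) (idx₁ j) v) := fun j k v => by
    by_cases hjk : j = k
    · rw [hjk]
    have := hS.commutator_apply (Pi.single (idx₂ j) 1) (Pi.single (idx₁ j) 1)
      (Pi.single (idx₂ k) 1) (Pi.single (idx₁ k) 1) v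
    simp only [soBil_single] at this
    rw [this]
    simp [idx₁_ne_idx₂, (idx₁_ne_idx₂ _ _).symm, idx₁_inj, idx₂_inj, Ne.symm hjk]
  have key : ∀ s : Finset (Fin ((n - 1) / 2)), ∃ z : Fin ((n - 1) / 2) → ℂ, ∃ v ∈ U, v ≠ 0 ∧
      ∀ k ∈ s, S (idx₂ k) (idx₁ k) v = z k • v := fun s => by
    induction s using Finset.induction_on with
    | empty =>
      obtain ⟨v, hv, hv0⟩ := Submodule.exists_mem_ne_zero_of_ne_bot h0
      exact ⟨0, v, hv, hv0, by simp⟩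
    | insert k s hk ih =>
      obtain ⟨z, v, hv, hv0, hz⟩ := ih
      set Q : Submodule ℂ V := U ⊓ ⨅ j ∈ s, Module.End.eigenspace (S (idx₂ j) (idx₁ j)) (z j)
        with hQ
      have hmem : ∀ w, w ∈ Q ↔ w ∈ U ∧ ∀ j ∈ s, S (idx₂ j) (idx₁ j) w = z j • w := fun w => by
        simp [hQ, Submodule.mem_iInf]
      have hQk : ∀ w ∈ Q, S (idx₂ k) (idx₁ k) w ∈ Q := fun w hw => by
        rw [hmem] at hw ⊢
        refine ⟨hU.S_mem (hne2 k) (hne1 k) hw.1, fun j hj => ?_⟩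
        rw [hcomm, hw.2 j hj, map_smul]
      have hnt : Nontrivial Q :=
        ⟨⟨v, (hmem v).2 ⟨hv, hz⟩⟩, 0, fun h => hv0 (congrArg Subtype.val h)⟩
      obtain ⟨c, hc⟩ := Module.End.exists_eigenvalue ((S (idx₂ k) (idx₁ k)).restrict hQk)
      obtain ⟨w, hw⟩ := hc.exists_hasEigenvector
      refine ⟨Function.update z k c, w, ((hmem w).1 w.2).1, fun h => hw.2 (Subtype.ext h),
        fun j hj => ?_⟩
      rcases Finset.mem_insert.1 hj with rfl | hj'
      · rw [Function.update_self]
        exact congrArg Subtype.val hw.apply_eq_smul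
      · rw [Function.update_of_ne (by rintro rfl; exact hk hj')]
        exact ((hmem w).1 w.2).2 j hj'
  obtain ⟨z, v, hv, hv0, hz⟩ := key Finset.univ
  choose μ hμ using fun k => hS.exists_int_of_eigenvector k hv0 (hz k (Finset.mem_univ k))
  refine ⟨μ, fun h => hv0 ((Submodule.eq_bot_iff _).1 h v
    ⟨hv, hS.mem_weightSpace_iff.2 fun k => ?_⟩)⟩
  rw [hz k (Finset.mem_univ k), hμ k]

/-- Every nonzero invariant subspace contains a weight vector that is annihilated by all raising
operators: take a weight of maximal height. -/
theorem IsStable.exists_isRaisedToZero (hS : IsDifferential σ S) {U : Submodule ℂ V}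
    (hU : IsStable S U) (h0 : U ≠ ⊥) :
    ∃ μ, ∃ u ∈ U, u ≠ 0 ∧ u ∈ weightSpace σ μ ∧ IsRaisedToZero S u := by
  have hfin : {z : ℤ | ∃ μ, height n μ = z ∧ U ⊓ weightSpace σ μ ≠ ⊥}.Finite :=
    (finite_weights hS).subset fun z ⟨μ, h1, h2⟩ => ⟨μ, h1, fun h => h2 (by rw [h, inf_bot_eq])⟩
  obtain ⟨μ₀, hμ₀⟩ := exists_weightSpace_ne_bot hS hU h0
  obtain ⟨_, ⟨μ, rfl, hμ⟩, hmax⟩ := Set.exists_max_image _ id hfin ⟨_, μ₀, rfl, hμ₀⟩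
  obtain ⟨u, ⟨huU, hu⟩, hu0⟩ := Submodule.exists_mem_ne_zero_of_ne_bot hμ
  refine ⟨μ, u, huU, hu0, hu, fun p q hpq => ?_⟩
  by_contra hne
  have h1 := hmax _ ⟨_, rfl, fun hbot => hne ((Submodule.eq_bot_iff _).1 hbot _
    ⟨hU _ _ (iso_apply_zero p) (iso_apply_zero q) u huU, hS.soBil_iso_mem_weightSpace hu p q⟩)⟩
  simp only [id, map_add, height_isoWt] at h1
  omega

end HighestWeight

/-! ### Isotypic subspaces and the Casimir operator -/

section Casimir
variable {n : ℕ} {V : Type*} [NormedAddCommGroup V] [InnerProductSpace ℂ V]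
  [FiniteDimensional ℂ V]
variable {σ : Representation ℂ (SO n) V} {S : Fin n → Fin n → V →ₗ[ℂ] V}

/-! #### Schur's lemma -/

theorem IsStable.starProjection_mem_weightSpace [NeZero n] (hσ : IsIrredUnitary σ)
    (hS : IsDifferential σ S) {U : Submodule ℂ V} (hU : IsStable S U)
    {μ : Fin ((n - 1) / 2) → ℤ} {v : V} (hv : v ∈ weightSpace σ μ) :
    U.starProjection v ∈ weightSpace σ μ := by
  rw [hS.mem_weightSpace_iff'] at hv ⊢
  intro k
  rw [← hU.starProjection hσ hS (iso_apply_zero _) (iso_apply_zero _), hv k, map_smul]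

theorem isStable_W [NeZero n] (hS : IsDifferential σ S) (τ : Fin ((n - 1) / 2) → ℤ) :
    IsStable S (W σ τ) := by
  rw [W, sSup_eq_iSup']
  exact IsStable.iSup fun U => hS.isStable U.2.1.invariant

/-- Irreducible subrepresentations that are not orthogonal have the same weights. -/
theorem IsIrredSub.weight_of_not_le_orthogonal [NeZero n] (hσ : IsIrredUnitary σ)
    (hS : IsDifferential σ S) {U U' : Submodule ℂ V} (hU : IsIrredSub σ U)
    (hU' : IsIrredSub σ U') (h : ¬U' ≤ Uᗮ) {ν : Fin ((n - 1) / 2) → ℤ}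
    (hν : U' ⊓ weightSpace σ ν ≠ ⊥) : U ⊓ weightSpace σ ν ≠ ⊥ := by
  have hUs := hS.isStable hU.invariant
  obtain ⟨-, hUs', hUm'⟩ := (isIrredSub_iff hσ hS).1 hU'
  obtain ⟨u, ⟨huU, hu⟩, hu0⟩ := Submodule.exists_mem_ne_zero_of_ne_bot hν
  rcases hUm' (U' ⊓ Uᗮ) inf_le_left (hUs'.inf (hUs.orthogonal hσ hS)) with h1 | h1
  · intro hbot
    have h2 := (Submodule.eq_bot_iff _).1 hbot (U.starProjection u)
      ⟨Submodule.starProjection_apply_mem _ _, hUs.starProjection_mem_weightSpace hσ hS hu⟩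
    exact hu0 ((Submodule.eq_bot_iff _).1 h1 u
      ⟨huU, (Submodule.starProjection_apply_eq_zero_iff U).1 h2⟩)
  · exact absurd (inf_eq_left.1 h1) h

/-- Irreducible subrepresentations of different highest weights are orthogonal, since otherwise each
of the two highest weights would be a weight of the other one. -/
theorem W_le_orthogonal [NeZero n] (hσ : IsIrredUnitary σ) (hS : IsDifferential σ S)
    {τ τ' : Fin ((n - 1) / 2) → ℤ} (h : τ ≠ τ') : W σ τ ≤ (W σ τ')ᗮ := by
  refine sSup_le fun U hU => ?_
  rw [← Submodule.le_orthogonal_iff_le_orthogonal]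
  refine sSup_le fun U' hU' => ?_
  by_contra hcon
  have hcon' : ¬U ≤ U'ᗮ := fun h' => hcon (Submodule.le_orthogonal_iff_le_orthogonal.1 h')
  exact h (eq_of_sub_mem_closure
    (hU.2.2 _ (hU.1.weight_of_not_le_orthogonal hσ hS hU'.1 hcon hU'.2.1))
    (hU'.2.2 _ (hU'.1.weight_of_not_le_orthogonal hσ hS hU.1 hcon' hU.2.1)))

/-- A vector of `W_τ` that is annihilated by the raising operators has weight `τ`: project it to an
irreducible summand where its component does not vanish. -/
theorem weight_eq_of_mem_W [NeZero n] (hσ : IsIrredUnitary σ) (hS : IsDifferential σ S)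
    {τ κ : Fin ((n - 1) / 2) → ℤ} {y : V} (hy : y ∈ W σ τ) (hy0 : y ≠ 0)
    (hyκ : y ∈ weightSpace σ κ) (hr : IsRaisedToZero S y) : κ = τ := by
  obtain ⟨U, hU, hUy⟩ : ∃ U : Submodule ℂ V, (IsIrredSub σ U ∧ HasHighestWeight σ U τ) ∧
      U.starProjection y ≠ 0 := by
    by_contra! hcon
    have h1 : W σ τ ≤ (ℂ ∙ y)ᗮ := sSup_le fun U hU => by
      rw [← Submodule.le_orthogonal_iff_le_orthogonal, Submodule.span_singleton_le_iff_mem]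
      exact (Submodule.starProjection_apply_eq_zero_iff U).1 (hcon U hU)
    exact hy0 (inner_self_eq_zero.1 (Submodule.mem_orthogonal_singleton_iff_inner_right.1 (h1 hy)))
  have hUs := hS.isStable hU.1.invariant
  have h2 := hU.1.hasHighestWeight hσ hS (Submodule.starProjection_apply_mem U y) hUy
    (hUs.starProjection_mem_weightSpace hσ hS hyκ) fun p q hpq => by
      rw [← hUs.starProjection hσ hS (iso_apply_zero _) (iso_apply_zero _), hr p q hpq, map_zero]
  exact eq_of_sub_mem_closure (h2.2 _ hU.2.1) (hU.2.2 _ h2.1)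

/-! #### Casimir operators -/

/-- The Casimir operator of the subalgebra `so(s)` for a set `s` of coordinates. -/
noncomputable def casimir (S : Fin n → Fin n → V →ₗ[ℂ] V) (s : Finset (Fin n)) : V →ₗ[ℂ] V :=
  (2⁻¹ : ℂ) • ∑ a ∈ s, ∑ b ∈ s, S a b ∘ₗ S a b

omit [FiniteDimensional ℂ V] in
theorem casimir_apply (s : Finset (Fin n)) (w : V) :
    casimir S s w = (2⁻¹ : ℂ) • ∑ a ∈ s, ∑ b ∈ s, S a b (S a b w) := by
  simp [casimir, LinearMap.sum_apply]

/-- The bilinear map `(x, y) ↦ L(x) L'(y) w`. -/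
noncomputable def compBil (L L' : (Fin n → ℂ) →ₗ[ℂ] V →ₗ[ℂ] V) (w : V) :
    (Fin n → ℂ) →ₗ[ℂ] (Fin n → ℂ) →ₗ[ℂ] V :=
  LinearMap.mk₂ ℂ (fun x y => L x (L' y w)) (by simp) (by simp) (by simp) (by simp)

omit [FiniteDimensional ℂ V] in
theorem compBil_apply (L L' : (Fin n → ℂ) →ₗ[ℂ] V →ₗ[ℂ] V) (w : V) (x y : Fin n → ℂ) :
    compBil L L' w x y = L x (L' y w) := rfl

theorem eq_sum_single_of_support {s : Finset (Fin n)} {z : Fin n → ℂ} (hz : ∀ a ∉ s, z a = 0) :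
    ∑ a ∈ s, z a • (Pi.single a 1 : Fin n → ℂ) = z := by
  rw [Finset.sum_subset (Finset.subset_univ s) fun a _ ha => by rw [hz a ha, zero_smul]]
  exact (pi_eq_sum_univ' z).symm

/-- The bilinear form on `span {e_a | a ∈ s}` is invariant under `u vᵀ - v uᵀ`. -/
theorem sum_skew_eq_zero {M : Type*} [AddCommGroup M] [Module ℂ M]
    (B : (Fin n → ℂ) →ₗ[ℂ] (Fin n → ℂ) →ₗ[ℂ] M) {s : Finset (Fin n)} {u v : Fin n → ℂ}
    (hu : ∀ a ∉ s, u a = 0) (hv : ∀ a ∉ s, v a = 0) :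
    ∑ a ∈ s, (B (v a • u - u a • v) (Pi.single a 1) + B (Pi.single a 1) (v a • u - u a • v)) =
      0 := by
  have h : ∀ a, B (v a • u - u a • v) (Pi.single a 1) + B (Pi.single a 1) (v a • u - u a • v) =
      (B u (v a • Pi.single a 1) - B v (u a • Pi.single a 1)) +
        (B (v a • Pi.single a 1) u - B (u a • Pi.single a 1) v) := fun a => by
    simp only [map_sub, map_smul, LinearMap.sub_apply, LinearMap.smul_apply]
  simp only [h, Finset.sum_add_distrib, Finset.sum_sub_distrib, ← map_sum,
    ← LinearMap.sum_apply, eq_sum_single_of_support hu, eq_sum_single_of_support hv]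
  abel

/-- The Casimir operator of `so(s)` commutes with `so(s)`. -/
theorem IsDifferential.casimir_soBil (hS : IsDifferential σ S) {s : Finset (Fin n)}
    {u v : Fin n → ℂ} (hu : ∀ a ∉ s, u a = 0) (hv : ∀ a ∉ s, v a = 0) (w : V) :
    casimir S s (soBil S u v w) = soBil S u v (casimir S s w) := by
  set e : Fin n → Fin n → ℂ := fun a => Pi.single a 1 with he
  set D : Fin n → Fin n → ℂ := fun a => v a • u - u a • v with hD
  -- `D a` is the image of `e_a` under `u vᵀ - v uᵀ`
  have hc : ∀ a b w, soBil S u v (soBil S (e a) (e b) w) = soBil S (e a) (e b) (soBil S u v w) +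
      (soBil S (D a) (e b) w + soBil S (e a) (D b) w) := fun a b w => by
    rw [hS.commutator_apply']
    simp [he, hD]
  have h1 : ∀ b, ∑ a ∈ s, (soBil S (D a) (e b) (soBil S (e a) (e b) w) +
      soBil S (e a) (e b) (soBil S (D a) (e b) w)) = 0 := fun b =>
    sum_skew_eq_zero (compBil ((soBil S).flip (e b)) ((soBil S).flip (e b)) w) hu hv
  have h2 : ∀ a, ∑ b ∈ s, (soBil S (e a) (D b) (soBil S (e a) (e b) w) +
      soBil S (e a) (e b) (soBil S (e a) (D b) w)) = 0 := fun a =>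
    sum_skew_eq_zero (compBil (soBil S (e a)) (soBil S (e a)) w) hu hv
  have h3 : ∑ a ∈ s, ∑ b ∈ s, (soBil S (D a) (e b) (soBil S (e a) (e b) w) +
      soBil S (e a) (e b) (soBil S (D a) (e b) w)) = 0 := by
    rw [Finset.sum_comm]; exact Finset.sum_eq_zero fun b _ => h1 b
  have h4 := Finset.sum_eq_zero fun a (_ : a ∈ s) => h2 a
  rw [casimir_apply, casimir_apply, map_smul]
  congr 1
  simp only [map_sum, ← soBil_single (S := S)]
  have h5 : ∀ a b, soBil S u v (soBil S (e a) (e b) (soBil S (e a) (e b) w)) =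
      soBil S (e a) (e b) (soBil S (e a) (e b) (soBil S u v w)) +
      ((soBil S (D a) (e b) (soBil S (e a) (e b) w) +
        soBil S (e a) (e b) (soBil S (D a) (e b) w)) +
      (soBil S (e a) (D b) (soBil S (e a) (e b) w) +
        soBil S (e a) (e b) (soBil S (e a) (D b) w))) := fun a b => by
    rw [hc a b, hc a b, map_add, map_add]; abel
  simp only [he] at h3 h4 h5
  simp only [h5, Finset.sum_add_distrib] at h3 h4 ⊢
  rw [h3, h4, add_zero, add_zero]

/-- The Casimir operator of `so(n)` is a scalar. -/
theorem IsDifferential.exists_casimir_univ (hσ : IsIrredUnitary σ) (hS : IsDifferential σ S) :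
    ∃ c : ℂ, ∀ w, casimir S Finset.univ w = c • w := by
  cases subsingleton_or_nontrivial V with
  | inl h => exact ⟨0, fun w => Subsingleton.elim _ _⟩
  | inr h =>
    obtain ⟨c, hc⟩ := Module.End.exists_eigenvalue (casimir S Finset.univ)
    refine ⟨c, fun w => Module.End.mem_eigenspace_iff.1 ?_⟩
    have h1 : Module.End.eigenspace (casimir S Finset.univ) c = ⊤ := by
      refine (hσ.eq_bot_or_eq_top _ fun m => ?_).resolve_left hc
      refine hS.map_le_of_S_mem hσ (k := 0) (fun a b _ _ v hv => ?_) m (by simp)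
      rw [Module.End.mem_eigenspace_iff] at hv ⊢
      rw [← soBil_single (S := S), hS.casimir_soBil (by simp) (by simp), hv, map_smul]
    rw [h1]; trivial

omit [FiniteDimensional ℂ V] in
/-- The Casimir operators of `so(n)` and `so(n-1)` differ by `∑_k S_{k1}²`. -/
theorem IsDifferential.casimir_univ_apply [NeZero n] (hS : IsDifferential σ S) (w : V) :
    casimir S Finset.univ w = casimir S (Finset.univ.erase 0) w +
      ∑ k ∈ Finset.univ.erase 0, S k 0 (S k 0 w) := by
  have h1 : ∀ f : Fin n → V, ∑ a, f a = ∑ a ∈ Finset.univ.erase 0, f a + f 0 := fun f =>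
    (Finset.sum_erase_add _ _ (Finset.mem_univ _)).symm
  have h2 : S 0 0 = 0 := by rw [← soBil_single (S := S), hS.soBil_self]
  have h3 : ∀ b, S 0 b (S 0 b w) = S b 0 (S b 0 w) := fun b => by
    rw [hS.antisymm 0 b]; simp
  rw [casimir_apply, casimir_apply, h1]
  simp only [h1, Finset.sum_add_distrib, h2, h3, LinearMap.zero_apply, add_zero]
  module

/-- The commutator of the Casimir operator of `so(n-1)` with `S_{j1}`. -/
theorem IsDifferential.casimir_erase_S [NeZero n] (hS : IsDifferential σ S) {j : Fin n}
    (hj : j ≠ 0) (w : V) : casimir S (Finset.univ.erase 0) (S j 0 w) =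
      S j 0 (casimir S (Finset.univ.erase 0) w) -
        (2 : ℂ) • ∑ k ∈ Finset.univ.erase 0, S j k (S k 0 w) + ((n : ℂ) - 2) • S j 0 w := by
  have h1 := hS.casimir_univ_apply (S j 0 w)
  have h2 := congrArg (S j 0) (hS.casimir_univ_apply w)
  have h3 : casimir S Finset.univ (S j 0 w) = S j 0 (casimir S Finset.univ w) := by
    rw [← soBil_single (S := S), hS.casimir_soBil (by simp) (by simp)]
  -- the Casimir operator of `so(n)` commutes with `S_{j1}`, so the commutator is minus that of
  -- `∑_k S_{k1}²`
  rw [h3, h2, map_add, map_sum] at h1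
  have hjj : S j j = 0 := by rw [← soBil_single (S := S), hS.soBil_self]
  have h00 : S 0 0 = 0 := by rw [← soBil_single (S := S), hS.soBil_self]
  have hX : ∀ k ∈ Finset.univ.erase 0, ∀ w, S k 0 (S j 0 w) = S j 0 (S k 0 w) + S j k w :=
    fun k hk w => by
    have h := hS.commutator_apply (Pi.single k 1) (Pi.single 0 1) (Pi.single j 1) (Pi.single 0 1) w
    simp only [soBil_single] at h
    rw [h]
    simp [h00, (Finset.ne_of_mem_erase hk).symm, hj]
  have hY : ∀ k ∈ Finset.univ.erase 0, S k 0 (S j k w) =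
      S j k (S k 0 w) - if k = j then 0 else S j 0 w := fun k hk => by
    split_ifs with hkj
    · subst hkj; simp [hjj]
    have h := hS.commutator_apply (Pi.single k 1) (Pi.single 0 1) (Pi.single j 1) (Pi.single k 1) w
    simp only [soBil_single] at h
    rw [h]
    simp [Finset.ne_of_mem_erase hk, hj, Ne.symm hkj, sub_eq_add_neg]
  have hsum : ∑ k ∈ Finset.univ.erase 0, S k 0 (S k 0 (S j 0 w)) =
      ∑ k ∈ Finset.univ.erase 0, S j 0 (S k 0 (S k 0 w)) +
      (2 : ℂ) • ∑ k ∈ Finset.univ.erase 0, S j k (S k 0 w) - ((n : ℂ) - 2) • S j 0 w := by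
    have h4 : ∀ k ∈ Finset.univ.erase 0, S k 0 (S k 0 (S j 0 w)) = S j 0 (S k 0 (S k 0 w)) +
        (2 : ℂ) • S j k (S k 0 w) - if k = j then 0 else S j 0 w := fun k hk => by
      rw [hX k hk, map_add, hX k hk, hY k hk]; module
    rw [Finset.sum_congr rfl h4, Finset.sum_sub_distrib, Finset.sum_add_distrib,
      Finset.smul_sum]
    congr 1
    have h5 : ∑ k ∈ Finset.univ.erase (0 : Fin n), (if k = j then 0 else S j 0 w) =
        ∑ k ∈ Finset.univ.erase (0 : Fin n), S j 0 w -
          ∑ k ∈ Finset.univ.erase (0 : Fin n), if k = j then S j 0 w else 0 := by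
      rw [← Finset.sum_sub_distrib]
      exact Finset.sum_congr rfl fun k _ => by split_ifs <;> simp
    rw [h5, Finset.sum_ite_eq', if_pos (by simp [hj]), Finset.sum_const,
      Finset.card_erase_of_mem (Finset.mem_univ _), Finset.card_univ, Fintype.card_fin,
      ← Nat.cast_smul_eq_nsmul ℂ, Nat.cast_sub (NeZero.one_le)]
    push_cast
    module
  rw [hsum] at h1
  have h6 := eq_sub_of_add_eq h1.symm
  rw [h6]
  abel

end Casimir

section Branching
variable {n : ℕ} [NeZero n] {V : Type*} [NormedAddCommGroup V] [InnerProductSpace ℂ V]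
  [FiniteDimensional ℂ V]
variable {σ : Representation ℂ (SO n) V} {S : Fin n → Fin n → V →ₗ[ℂ] V}

/-! #### The value of the Casimir operator -/

/-- Minus the value of the Casimir operator of `so(n-1)` on the representations of highest weight
`τ`. -/
noncomputable def casimirValue (τ : Fin ((n - 1) / 2) → ℤ) : ℂ :=
  ∑ k, ((τ k : ℂ) ^ 2 + τ k * ((n : ℂ) - 1 - 2 * ((k : ℕ) + 1)))

/-- Minus the contribution of a pair of indices to the Casimir operator. -/
noncomputable def casimirTerm (τ : Fin ((n - 1) / 2) → ℤ) (p q : IsoIndex n) : ℂ :=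
  if p = q then 0 else
  if 0 < isoHt p + isoHt q then
    isoNorm p * ((∑ k, isoWt q k * τ k : ℤ) : ℂ) + isoNorm q * ((∑ k, isoWt p k * τ k : ℤ) : ℂ)
  else if isoHt p + isoHt q = 0 then ((∑ k, isoWt p k * τ k : ℤ) : ℂ) ^ 2 else 0

omit [NeZero n] in
/-- The dual of `iso p` is a multiple of the vector with the opposite index. -/
theorem exists_iso_eq_isoDual (p : IsoIndex n) : ∃ p' : IsoIndex n, ∃ c d : ℂ,
    (iso p : Fin n → ℂ) = c • isoDual p' ∧ (isoDual p : Fin n → ℂ) = d • iso p' ∧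
      isoHt p' = -isoHt p := by
  rcases p with k | k | u
  · exact ⟨.inr (.inl k), 2, 2⁻¹, by simp [isoDual], by simp [isoDual], by simp [isoHt]⟩
  · exact ⟨.inl k, 2, 2⁻¹, by simp [isoDual], by simp [isoDual], by simp [isoHt]⟩
  · exact ⟨.inr (.inr u), 1, 1, by simp [isoDual], by simp [isoDual], by simp [isoHt]⟩

omit [NeZero n] in
theorem exists_isoDual_eq_smul_iso {p q : IsoIndex n} (h : isoHt p + isoHt q = 0) :
    ∃ c : ℂ, (isoDual p : Fin n → ℂ) = c • iso q ∧ (isoDual q : Fin n → ℂ) = c • iso p := by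
  rcases p with j | j | u <;> rcases q with k | k | w <;> simp only [isoHt] at h
  · omega
  · obtain rfl : j = k := Fin.ext (by omega)
    exact ⟨2⁻¹, rfl, rfl⟩
  · omega
  · obtain rfl : j = k := Fin.ext (by omega)
    exact ⟨2⁻¹, rfl, rfl⟩
  · omega
  · omega
  · omega
  · omega
  · exact ⟨1, by simp [isoDual], by simp [isoDual]⟩

/-- The bilinear form is invariant under the torus, so it pairs only vectors of opposite weight. -/
theorem isoHt_add_eq_zero_of_dotProduct_ne_zero {p q : IsoIndex n}
    (h : (iso p : Fin n → ℂ) ⬝ᵥ iso q ≠ 0) : isoHt p + isoHt q = 0 := by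
  obtain ⟨q', c, -, h1, -, h2⟩ := exists_iso_eq_isoDual q
  rw [h1, dotProduct_smul, iso_dotProduct_isoDual] at h
  split_ifs at h with hpq
  · rw [hpq, h2]; ring
  · simp at h

/-- The contribution of the indices `p`, `q` to the Casimir operator on a highest weight vector. If
`p`, `q` raise the height it is a commutator, if the heights add up to `0` it is the square of a
torus generator, and if they lower the height the inner operator is a raising one. -/
theorem IsDifferential.soBil_iso_soBil_isoDual (hS : IsDifferential σ S)
    {τ : Fin ((n - 1) / 2) → ℤ} {u : V} (hu : u ∈ weightSpace σ τ) (hr : IsRaisedToZero S u)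
    (p q : IsoIndex n) : soBil S (iso p) (iso q) (soBil S (isoDual p) (isoDual q) u) =
      -casimirTerm τ p q • u := by
  obtain ⟨p', cp, dp, hp1, hp2, hp3⟩ := exists_iso_eq_isoDual p
  obtain ⟨q', cq, dq, hq1, hq2, hq3⟩ := exists_iso_eq_isoDual q
  rw [casimirTerm]
  split_ifs with h1 h2 h3
  · rw [h1, hS.soBil_self]; simp
  · rw [hS.commutator_apply, hr p q h2, map_zero, zero_add]
    have e1 : iso q ⬝ᵥ isoDual p = (0 : ℂ) := by
      rw [iso_dotProduct_isoDual, if_neg (Ne.symm h1)]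
    have e2 : iso p ⬝ᵥ isoDual q = (0 : ℂ) := by
      rw [iso_dotProduct_isoDual, if_neg h1]
    have e3 := iso_dotProduct_isoDual (n := n) p p
    have e4 := iso_dotProduct_isoDual (n := n) q q
    rw [if_pos rfl] at e3 e4
    rw [e1, e2, e3, e4, hS.soBil_antisymm (isoDual p), LinearMap.neg_apply,
      hS.soBil_iso_isoDual hu, hS.soBil_iso_isoDual hu]
    module
  · obtain ⟨c, hc, hc'⟩ := exists_isoDual_eq_smul_iso h3
    have e : soBil S (iso p) (iso q) (soBil S (isoDual p) (isoDual q) u) =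
        -soBil S (iso p) (isoDual p) (soBil S (iso p) (isoDual p) u) := by
      rw [hS.soBil_antisymm (isoDual p), hc', hc]
      simp only [map_smul, LinearMap.smul_apply, LinearMap.neg_apply, map_neg]
    rw [e, hS.soBil_iso_isoDual hu, map_smul, hS.soBil_iso_isoDual hu]
    module
  · rw [hp2, hq2]
    simp only [map_smul, LinearMap.smul_apply]
    rw [hr p' q' (by omega)]
    simp

omit [NeZero n] in
theorem sum_isoWt_inl (τ : Fin ((n - 1) / 2) → ℤ) (j : Fin ((n - 1) / 2)) :
    ∑ k, isoWt (.inl j) k * τ k = τ j := by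
  rw [Finset.sum_eq_single j] <;> simp +contextual [isoWt]

omit [NeZero n] in
theorem sum_isoWt_inr (τ : Fin ((n - 1) / 2) → ℤ) (j : Fin ((n - 1) / 2)) :
    ∑ k, isoWt (.inr (.inl j)) k * τ k = -τ j := by
  rw [Finset.sum_eq_single j] <;> simp +contextual [isoWt]

/-- The sum of the contributions of all pairs of indices, which amounts to twice `(τ, τ + 2ρ)` with
`ρ` half the sum of the positive roots of `so(n-1)`. -/
theorem sum_casimirTerm (τ : Fin ((n - 1) / 2) → ℤ) :
    ∑ p, ∑ q, casimirTerm τ p q = 2 * casimirValue τ := by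
  obtain ⟨r, hr⟩ : ∃ r, (n - 1) / 2 = r := ⟨_, rfl⟩
  set δ : ℂ := if Even n then 1 else 0 with hδ
  have hn : (n : ℂ) - 1 = 2 * r + δ := by
    have h0 := NeZero.ne n
    rw [hδ]
    split_ifs with h
    · obtain ⟨c, hc⟩ := h
      have : n = 2 * r + 2 := by omega
      rw [this]; push_cast; ring
    · obtain ⟨c, hc⟩ := Nat.not_even_iff_odd.1 h
      have : n = 2 * r + 1 := by omega
      rw [this]; push_cast; ring
  have hz : ∀ u : Unit, (∑ k, isoWt (n := n) (.inr (.inr u)) k * τ k) = 0 := fun u => by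
    simp [isoWt]
  -- the values for the kinds `+`, `-`, `0` of the two indices; the number of planes is `r`, and `δ`
  -- is `1` if the index `0` counts
  have e1 : ∀ j k : Fin ((n - 1) / 2), casimirTerm τ (.inl j) (.inl k) =
      (τ k + τ j : ℂ) - if j = k then (2 * τ j : ℂ) else 0 := fun j k => by
    by_cases h : j = k
    · subst h; simp [casimirTerm]; ring
    · rw [casimirTerm, if_neg (by simpa using h), if_pos (by simp only [isoHt]; omega),
        sum_isoWt_inl, sum_isoWt_inl]
      simp [isoNorm, h]
  have e2 : ∀ j k : Fin ((n - 1) / 2), casimirTerm τ (.inl j) (.inr (.inl k)) =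
      (if j < k then (τ j : ℂ) else 0) - (if j < k then (τ k : ℂ) else 0) +
        if j = k then (τ j : ℂ) ^ 2 else 0 := fun j k => by
    rw [casimirTerm, if_neg (by simp), sum_isoWt_inl, sum_isoWt_inr]
    rcases lt_trichotomy j k with h | h | h
    · rw [if_pos (by simp only [isoHt]; rw [Fin.lt_def] at h; omega)]
      simp [isoNorm, h, h.ne]; ring
    · subst h; simp [isoHt]
    · rw [if_neg (by simp only [isoHt]; rw [Fin.lt_def] at h; omega),
        if_neg (by simp only [isoHt]; rw [Fin.lt_def] at h; omega)]
      simp [h.ne', h.not_gt]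
  have e3 : ∀ j k : Fin ((n - 1) / 2), casimirTerm τ (.inr (.inl j)) (.inl k) =
      (if k < j then (τ k : ℂ) else 0) - (if k < j then (τ j : ℂ) else 0) +
        if k = j then (τ k : ℂ) ^ 2 else 0 := fun j k => by
    rw [casimirTerm, if_neg (by simp), sum_isoWt_inl, sum_isoWt_inr]
    rcases lt_trichotomy k j with h | h | h
    · rw [if_pos (by simp only [isoHt]; rw [Fin.lt_def] at h; omega)]
      simp [isoNorm, h, h.ne]; ring
    · subst h; simp [isoHt]
    · rw [if_neg (by simp only [isoHt]; rw [Fin.lt_def] at h; omega),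
        if_neg (by simp only [isoHt]; rw [Fin.lt_def] at h; omega)]
      simp [h.ne', h.not_gt]
  have e4 : ∀ j k : Fin ((n - 1) / 2),
      casimirTerm τ (.inr (.inl j)) (.inr (.inl k)) = 0 := fun j k => by
    rw [casimirTerm]
    split_ifs with h1 h2 h3
    · rfl
    · simp only [isoHt] at h2; omega
    · simp only [isoHt] at h3; omega
    · rfl
  have e5 : ∀ (j : Fin ((n - 1) / 2)) (u : Unit),
      casimirTerm τ (.inl j) (.inr (.inr u)) = δ * τ j :=
    fun j u => by
    rw [casimirTerm, if_neg (by simp), if_pos (by simp only [isoHt]; omega), sum_isoWt_inl, hz]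
    simp [isoNorm, hδ]
  have e6 : ∀ (j : Fin ((n - 1) / 2)) (u : Unit),
      casimirTerm τ (.inr (.inr u)) (.inl j) = δ * τ j :=
    fun j u => by
    rw [casimirTerm, if_neg (by simp), if_pos (by simp only [isoHt]; omega), sum_isoWt_inl, hz]
    simp [isoNorm, hδ]
  have e7 : ∀ (j : Fin ((n - 1) / 2)) (u : Unit),
      casimirTerm τ (.inr (.inl j)) (.inr (.inr u)) = 0 :=
    fun j u => by
    rw [casimirTerm, if_neg (by simp), if_neg (by simp only [isoHt]; omega),
      if_neg (by simp only [isoHt]; omega)]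
  have e8 : ∀ (j : Fin ((n - 1) / 2)) (u : Unit),
      casimirTerm τ (.inr (.inr u)) (.inr (.inl j)) = 0 :=
    fun j u => by
    rw [casimirTerm, if_neg (by simp), if_neg (by simp only [isoHt]; omega),
      if_neg (by simp only [isoHt]; omega)]
  have e9 : ∀ u w : Unit, casimirTerm τ (.inr (.inr u)) (.inr (.inr w)) = 0 := fun u w => by
    simp [casimirTerm]
  have c1 : ∀ (j : Fin ((n - 1) / 2)) (z : ℂ),
      ∑ k, (if j < k then z else 0) = ((r : ℂ) - 1 - j) * z :=
    fun j z => by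
    rw [← Finset.sum_filter, Finset.sum_const, Finset.filter_lt_eq_Ioi, Fin.card_Ioi, nsmul_eq_mul,
      Nat.sub_sub, Nat.cast_sub (by omega), Nat.cast_add, Nat.cast_one]
    simp only [hr]
    ring
  have c2 : ∀ (j : Fin ((n - 1) / 2)) (z : ℂ),
      ∑ k, (if k < j then z else 0) = (j : ℂ) * z := fun j z => by
    rw [← Finset.sum_filter, Finset.sum_const, Finset.filter_gt_eq_Iio, Fin.card_Iio, nsmul_eq_mul]
  have d1 : ∑ j : Fin ((n - 1) / 2), ∑ k : Fin ((n - 1) / 2), ((if j < k then (τ j : ℂ) else 0) -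
      (if j < k then (τ k : ℂ) else 0) + if j = k then (τ j : ℂ) ^ 2 else 0) =
      ∑ j : Fin ((n - 1) / 2), ((r - 1 - j) * τ j - j * τ j + (τ j : ℂ) ^ 2) := by
    simp only [Finset.sum_add_distrib, Finset.sum_sub_distrib, c1, Finset.sum_ite_eq,
      Finset.mem_univ, if_true]
    congr 2
    rw [Finset.sum_comm]
    simp only [c2]
  have d2 : ∑ j : Fin ((n - 1) / 2), ∑ k : Fin ((n - 1) / 2), ((if k < j then (τ k : ℂ) else 0) -
      (if k < j then (τ j : ℂ) else 0) + if k = j then (τ k : ℂ) ^ 2 else 0) =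
      ∑ j : Fin ((n - 1) / 2), ((r - 1 - j) * τ j - j * τ j + (τ j : ℂ) ^ 2) := by
    rw [Finset.sum_comm, d1]
  have d0 : ∑ j : Fin ((n - 1) / 2), ∑ k : Fin ((n - 1) / 2),
      ((τ k + τ j : ℂ) - if j = k then (2 * τ j : ℂ) else 0) =
      ∑ j : Fin ((n - 1) / 2), (2 * r - 2) * (τ j : ℂ) := by
    simp only [Finset.sum_add_distrib, Finset.sum_sub_distrib, Finset.sum_ite_eq,
      Finset.mem_univ, if_true, Finset.sum_const, Finset.card_univ, Fintype.card_fin,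
      nsmul_eq_mul, ← Finset.mul_sum, hr]
    ring
  simp only [Fintype.sum_sum_type, e1, e2, e3, e4, e5, e6, e7, e8, e9,
    Fintype.sum_unique (ι := Unit)]
  simp only [Finset.sum_add_distrib (f := fun i => ∑ j : Fin ((n - 1) / 2), _),
    Finset.sum_const_zero, add_zero]
  rw [d0, d1, d2, casimirValue, hn,
    Finset.mul_sum]
  simp only [← Finset.sum_add_distrib]
  refine Finset.sum_congr rfl fun j _ => ?_
  ring

/-- The Casimir operator of `so(n-1)` acts on `W_τ` by a scalar, which is computed on a highest
weight vector. -/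
theorem casimir_erase_of_mem_W (hσ : IsIrredUnitary σ) (hS : IsDifferential σ S)
    {τ : Fin ((n - 1) / 2) → ℤ} {w : V} (hw : w ∈ W σ τ) :
    casimir S (Finset.univ.erase 0) w = -casimirValue τ • w := by
  rw [← Module.End.mem_eigenspace_iff]
  revert w
  change W σ τ ≤ _
  refine sSup_le fun U hU => ?_
  obtain ⟨hU0, hUs, hUm⟩ := (isIrredSub_iff hσ hS).1 hU.1
  -- the eigenspace is invariant, so it contains `U` as soon as it contains a highest weight vector
  set Q := Module.End.eigenspace (casimir S (Finset.univ.erase 0)) (-casimirValue τ) with hQ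
  have hsupp : ∀ x : Fin n → ℂ, x 0 = 0 → ∀ a ∉ Finset.univ.erase (0 : Fin n), x a = 0 :=
    fun x hx a ha => by
      obtain rfl : a = 0 := by simpa using ha
      exact hx
  have hQs : IsStable S Q := fun x y hx hy v hv => by
    rw [hQ, Module.End.mem_eigenspace_iff] at hv ⊢
    rw [hS.casimir_soBil (hsupp x hx) (hsupp y hy), hv, map_smul]
  obtain ⟨u, ⟨huU, hu⟩, hu0⟩ := Submodule.exists_mem_ne_zero_of_ne_bot hU.2.1
  have hr := hU.2.isRaisedToZero hS hUs huU hu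
  have huQ : u ∈ Q := by
    rw [hQ, Module.End.mem_eigenspace_iff, casimir_apply]
    have h1 : ∑ a ∈ Finset.univ.erase (0 : Fin n), ∑ b ∈ Finset.univ.erase (0 : Fin n),
        S a b (S a b u) =
          ∑ p, ∑ q, soBil S (iso p) (iso q) (soBil S (isoDual p) (isoDual q) u) := by
      have h2 : ∀ a : Fin n, ∑ b ∈ Finset.univ.erase (0 : Fin n), S a b (S a b u) =
          ∑ q, soBil S (Pi.single a 1) (iso q) (soBil S (Pi.single a 1) (isoDual q) u) :=
          fun a => by
        have := sum_iso (compBil (soBil S (Pi.single a 1)) (soBil S (Pi.single a 1)) u)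
        simp only [compBil_apply, soBil_single] at this
        exact this.symm
      simp only [h2]
      rw [Finset.sum_comm]
      conv_rhs => rw [Finset.sum_comm]
      refine Finset.sum_congr rfl fun q _ => ?_
      exact (sum_iso (compBil ((soBil S).flip (iso q)) ((soBil S).flip (isoDual q)) u)).symm
    rw [h1]
    simp only [hS.soBil_iso_soBil_isoDual hu hr, neg_smul, Finset.sum_neg_distrib,
      ← Finset.sum_smul]
    rw [sum_casimirTerm, smul_neg, smul_smul, inv_mul_cancel_left₀ two_ne_zero]
  rcases hUm (U ⊓ Q) inf_le_left (hUs.inf hQs) with h | h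
  · exact absurd ((Submodule.eq_bot_iff _).1 h u ⟨huU, huQ⟩) hu0
  · exact inf_eq_left.1 h

omit [NeZero n] in
theorem casimirValue_add_single (τ : Fin ((n - 1) / 2) → ℤ) (i : Fin ((n - 1) / 2)) (z : ℤ) :
    casimirValue (τ + Pi.single i z) = casimirValue τ +
      (2 * τ i * z + z ^ 2 + z * ((n : ℂ) - 1 - 2 * ((i : ℕ) + 1))) := by
  have h : ∀ k : Fin ((n - 1) / 2), (((τ + Pi.single i z : Fin ((n - 1) / 2) → ℤ) k : ℤ) : ℂ) ^ 2 +
      ((τ + Pi.single i z : Fin ((n - 1) / 2) → ℤ) k : ℤ) *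
      ((n : ℂ) - 1 - 2 * ((k : ℕ) + 1)) =
      ((τ k : ℂ) ^ 2 + τ k * ((n : ℂ) - 1 - 2 * ((k : ℕ) + 1))) +
      if k = i then (2 * τ i * z + z ^ 2 + z * ((n : ℂ) - 1 - 2 * ((i : ℕ) + 1))) else 0 :=
      fun k => by
    by_cases hk : k = i
    · subst hk; simp; ring
    · simp [hk]
  rw [casimirValue, casimirValue, Finset.sum_congr rfl fun k _ => h k, Finset.sum_add_distrib,
    Finset.sum_ite_eq', if_pos (Finset.mem_univ i)]

/-! ### Branching: the operators `S_{k1}` move highest weights by at most one unit vector -/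

/-- `W_τ ⊕ ⨁_i (W_{τ+e_i} ⊕ W_{τ-e_i})`. -/
def Wnear (σ : Representation ℂ (SO n) V) (τ : Fin ((n - 1) / 2) → ℤ) : Submodule ℂ V :=
  W σ τ ⊔ ⨆ i, (W σ (τ + Pi.single i 1) ⊔ W σ (τ - Pi.single i 1))

theorem isStable_Wnear (hS : IsDifferential σ S) (τ : Fin ((n - 1) / 2) → ℤ) :
    IsStable S (Wnear σ τ) :=
  (isStable_W hS τ).sup (IsStable.iSup fun _ => (isStable_W hS _).sup (isStable_W hS _))

omit [FiniteDimensional ℂ V] in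
theorem W_sub_isoWt_le_Wnear (τ : Fin ((n - 1) / 2) → ℤ) (p : IsoIndex n) :
    W σ (τ - isoWt p) ≤ Wnear σ τ := by
  rcases p with k | k | u
  · exact le_sup_of_le_right (le_iSup_of_le k le_sup_right)
  · rw [isoWt, sub_neg_eq_add]
    exact le_sup_of_le_right (le_iSup_of_le k le_sup_left)
  · rw [isoWt, sub_zero]
    exact le_sup_left

/-- A highest weight vector `u` of weight `κ` for which not all `S(x, e₁) u` are orthogonal to
`W_τ`: for an index `p` of maximal height such that the projection of `S(ε_p, e₁) u` to `W_τ` does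
not vanish, this projection is annihilated by the raising operators. -/
theorem exists_eq_sub_isoWt (hσ : IsIrredUnitary σ) (hS : IsDifferential σ S)
    {τ κ : Fin ((n - 1) / 2) → ℤ} {u : V} (hu : u ∈ weightSpace σ κ) (hr : IsRaisedToZero S u)
    (h : ∃ p, (W σ τ).starProjection (soBil S (iso p) (Pi.single 0 1) u) ≠ 0) :
    ∃ p, κ = τ - isoWt p := by
  classical
  have hWs := isStable_W hS τ
  set P := (W σ τ).starProjection with hP
  obtain ⟨p₀, hp₀⟩ := h
  obtain ⟨a, ha, hmax⟩ := Finset.exists_max_image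
    (Finset.univ.filter fun p => P (soBil S (iso p) (Pi.single 0 1) u) ≠ 0) isoHt
    ⟨p₀, by simpa using hp₀⟩
  have ha0 : P (soBil S (iso a) (Pi.single 0 1) u) ≠ 0 := by simpa using ha
  refine ⟨a, ?_⟩
  rw [eq_sub_iff_add_eq]
  refine weight_eq_of_mem_W hσ hS (Submodule.starProjection_apply_mem _ _) ha0
    (hWs.starProjection_mem_weightSpace hσ hS (hS.soBil_iso_single_mem_weightSpace hu a))
    fun p q hpq => ?_
  have hterm : ∀ p q : IsoIndex n, 0 < isoHt p + isoHt q →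
      ((iso q : Fin n → ℂ) ⬝ᵥ iso a) • P (soBil S (iso p) (Pi.single 0 1) u) = 0 := by
    intro p q hpq
    by_cases hqa : (iso q : Fin n → ℂ) ⬝ᵥ iso a = 0
    · rw [hqa, zero_smul]
    · have h1 := isoHt_add_eq_zero_of_dotProduct_ne_zero hqa
      have h2 : P (soBil S (iso p) (Pi.single 0 1) u) = 0 := by
        by_contra hne
        have := hmax p (by simpa using hne)
        omega
      rw [h2, smul_zero]
  have h0 : ∀ p : IsoIndex n, iso p ⬝ᵥ (Pi.single 0 1 : Fin n → ℂ) = 0 := fun p => by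
    rw [dotProduct_single, iso_apply_zero, zero_mul]
  rw [← hWs.starProjection hσ hS (iso_apply_zero _) (iso_apply_zero _),
    hS.commutator_apply', hr p q hpq, h0, h0]
  simp only [map_zero, zero_smul, sub_zero, LinearMap.zero_apply, add_zero, zero_add, map_sub,
    map_smul, LinearMap.sub_apply, LinearMap.smul_apply]
  rw [← hP, hterm p q hpq, hterm q p (by omega), sub_zero]

/-- The operators `S_{k1}` map `W_τ` to `W_τ ⊕ ⨁_i (W_{τ+e_i} ⊕ W_{τ-e_i})`. -/
theorem S_mem_Wnear (hσ : IsIrredUnitary σ) (hS : IsDifferential σ S)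
    {τ : Fin ((n - 1) / 2) → ℤ} {w : V} (hw : w ∈ W σ τ) {k : Fin n} (hk : k ≠ 0) :
    S k 0 w ∈ Wnear σ τ := by
  have hWs := isStable_W hS τ
  set P := (W σ τ).starProjection with hP
  have hAs := (isStable_Wnear hS τ).orthogonal hσ hS
  set A := (Wnear σ τ)ᗮ with hA
  -- the vectors orthogonal to the target whose images under all `S(x, e₁)` are orthogonal to `W_τ`;
  -- as these operators are skew-adjoint, the claim is that `K` is all of `A`
  set K : Submodule ℂ V := A ⊓ ⨅ x : {x : Fin n → ℂ // x 0 = 0},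
    LinearMap.ker ((P : V →ₗ[ℂ] V) ∘ₗ soBil S x.1 (Pi.single 0 1)) with hK
  have hmem : ∀ v, v ∈ K ↔ v ∈ A ∧ ∀ x : Fin n → ℂ, x 0 = 0 →
      P (soBil S x (Pi.single 0 1) v) = 0 := fun v => by
    simp [hK, Submodule.mem_iInf, LinearMap.mem_ker]
  have hKs : IsStable S K := fun x y hx hy v hv => by
    rw [hmem] at hv ⊢
    refine ⟨hAs x y hx hy v hv.1, fun z hz => ?_⟩
    have h1 := hS.commutator_apply' x y z (Pi.single 0 1) v
    have h2 : ∀ x : Fin n → ℂ, x 0 = 0 → x ⬝ᵥ (Pi.single 0 1 : Fin n → ℂ) = 0 := fun x hx => by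
      rw [dotProduct_single, hx, zero_mul]
    simp only [h2 x hx, h2 y hy, zero_smul, sub_zero, map_zero, LinearMap.zero_apply,
      add_zero] at h1
    rw [← sub_eq_iff_eq_add] at h1
    rw [← h1, map_sub, hP, hWs.starProjection hσ hS hx hy, ← hP, hv.2 z hz, map_zero,
      hv.2 _ (by simp [hx, hy]), sub_zero]
  -- a highest weight vector in `Kᗮ ⊓ A` lies in `K` if no `S(ε_p, e₁)` gives it a component in
  -- `W_τ`, and otherwise its weight shows that it lies in `Wnear`
  have hKA : Kᗮ ⊓ A = ⊥ := by
    by_contra hne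
    obtain ⟨U, hUle, hU⟩ := exists_isIrredSub_le hσ hS ((hKs.orthogonal hσ hS).inf hAs) hne
    have hUs := hS.isStable hU.invariant
    obtain ⟨κ, u, huU, hu0, hu, hr⟩ := hUs.exists_isRaisedToZero hS hU.ne_bot
    by_cases hex : ∃ p, P (soBil S (iso p) (Pi.single 0 1) u) ≠ 0
    · obtain ⟨p, rfl⟩ := exists_eq_sub_isoWt hσ hS hu hr hex
      have h1 : u ∈ Wnear σ τ := W_sub_isoWt_le_Wnear τ p
        ((show U ≤ W σ _ from le_sSup ⟨hU, hU.hasHighestWeight hσ hS huU hu0 hu hr⟩) huU)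
      exact hu0 (inner_self_eq_zero.1 ((hUle huU).2 u h1))
    · push Not at hex
      have h1 : u ∈ K := (hmem u).2 ⟨(hUle huU).2, fun x hx => by
        rw [eq_sum_iso hx]
        simp only [map_sum, map_smul, LinearMap.sum_apply, LinearMap.smul_apply, hex, smul_zero,
          Finset.sum_const_zero]⟩
      exact hu0 (inner_self_eq_zero.1 ((hUle huU).1 u h1))
  have hAK : A ≤ K := by
    have := Submodule.sup_orthogonal_inf_of_hasOrthogonalProjection (K₁ := K) (K₂ := A) inf_le_left
    rw [hKA, sup_bot_eq] at this
    exact this.ge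
  rw [← Submodule.orthogonal_orthogonal (Wnear σ τ), ← hA, Submodule.mem_orthogonal]
  intro s hs
  have h1 := ((hmem s).1 (hAK hs)).2 (Pi.single k 1) (by simp [hk.symm])
  rw [soBil_single] at h1
  have h2 := (Submodule.starProjection_apply_eq_zero_iff (W σ τ)).1 h1
  rw [← neg_eq_zero, ← hS.inner_S hσ]
  exact (Submodule.mem_orthogonal' _ _).1 h2 w hw

/-! #### Consequences for `W_τ` -/

/-- `∑_k S_{k1}²` preserves `W_τ`: it is a difference of two Casimir operators, which are scalars
there. -/
theorem sum_S_S_mem_W (hσ : IsIrredUnitary σ) (hS : IsDifferential σ S)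
    {τ : Fin ((n - 1) / 2) → ℤ} {w : V} (hw : w ∈ W σ τ) :
    ∑ k ∈ Finset.univ.erase 0, S k 0 (S k 0 w) ∈ W σ τ := by
  obtain ⟨c, hc⟩ := hS.exists_casimir_univ hσ
  have h := hS.casimir_univ_apply w
  rw [hc, casimir_erase_of_mem_W hσ hS hw, ← sub_eq_iff_eq_add'] at h
  rw [← h]
  exact sub_mem (Submodule.smul_mem _ _ hw) (Submodule.smul_mem _ _ hw)

/-- The operator `∑_k S_{jk} S_{k1}` from `W_τ` to `W_{τ'}` is a multiple of `S_{j1}`, by comparing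
the two Casimir values. -/
theorem starProjection_sum_S_S (hσ : IsIrredUnitary σ) (hS : IsDifferential σ S)
    {τ : Fin ((n - 1) / 2) → ℤ} (τ' : Fin ((n - 1) / 2) → ℤ) {w : V} (hw : w ∈ W σ τ) {j : Fin n}
    (hj : j ≠ 0) :
    (W σ τ').starProjection ((2 : ℂ) • ∑ k ∈ Finset.univ.erase 0, S j k (S k 0 w)) =
      ((n : ℂ) - 2 + casimirValue τ' - casimirValue τ) • (W σ τ').starProjection (S j 0 w) := by
  have hs := isStable_W hS τ'
  have h1 := hS.casimir_erase_S hj w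
  have h2 : ∀ v, (W σ τ').starProjection (casimir S (Finset.univ.erase 0) v) =
      casimir S (Finset.univ.erase 0) ((W σ τ').starProjection v) := fun v => by
    simp only [casimir_apply, map_smul, map_sum]
    refine congrArg _ (Finset.sum_congr rfl fun a ha => Finset.sum_congr rfl fun b hb => ?_)
    have ha' : (Pi.single a 1 : Fin n → ℂ) 0 = 0 := by simp [(Finset.ne_of_mem_erase ha).symm]
    have hb' : (Pi.single b 1 : Fin n → ℂ) 0 = 0 := by simp [(Finset.ne_of_mem_erase hb).symm]
    simp only [← soBil_single (S := S)]
    rw [hs.starProjection hσ hS ha' hb', hs.starProjection hσ hS ha' hb']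
  have h3 := congrArg (W σ τ').starProjection h1
  rw [h2, casimir_erase_of_mem_W hσ hS (Submodule.starProjection_apply_mem _ _),
    casimir_erase_of_mem_W hσ hS hw, map_add, map_sub, map_smul, map_smul, map_smul, map_smul] at h3
  rw [map_smul]
  linear_combination (norm := module) h3

end Branching

/-! ### Functions with values in the fibres: derivatives at a multiple of `e₁` -/

section Curves
variable {n : ℕ} {V : Type*} [NormedAddCommGroup V] [InnerProductSpace ℂ V]

theorem hasFDerivAt_of_ne {f : E n → V} (hf : ContDiffOn ℝ ∞ f {0}ᶜ) {ξ : E n}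
    (hξ : ξ ≠ 0) : HasFDerivAt f (fderiv ℝ f ξ) ξ :=
  ((contDiffAt_of_ne hf hξ).differentiableAt (by simp)).hasFDerivAt

theorem hasFDerivAt_fderiv_of_ne {f : E n → V} (hf : ContDiffOn ℝ ∞ f {0}ᶜ) {ξ : E n}
    (hξ : ξ ≠ 0) : HasFDerivAt (fderiv ℝ f) (fderiv ℝ (fderiv ℝ f) ξ) ξ :=
  (((contDiffAt_of_ne hf hξ).fderiv_right (m := 1) (by
    exact WithTop.coe_le_coe.2 le_top)).differentiableAt (by simp)).hasFDerivAt

theorem hasDerivAt_comp_curve {f : E n → V} (hf : ContDiffOn ℝ ∞ f {0}ᶜ) {c : ℝ → E n} {c' : E n}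
    {t : ℝ} (hc : HasDerivAt c c' t) (h0 : c t ≠ 0) :
    HasDerivAt (fun t => f (c t)) (fderiv ℝ f (c t) c') t :=
  (hasFDerivAt_of_ne hf h0).comp_hasDerivAt t hc

theorem hasDerivAt_fderiv_curve {f : E n → V} (hf : ContDiffOn ℝ ∞ f {0}ᶜ) {c u : ℝ → E n}
    {c' u' : E n} {t : ℝ} (hc : HasDerivAt c c' t) (hu : HasDerivAt u u' t) (h0 : c t ≠ 0) :
    HasDerivAt (fun t => fderiv ℝ f (c t) (u t))
      (fderiv ℝ (fderiv ℝ f) (c t) c' (u t) + fderiv ℝ f (c t) u') t :=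
  ((hasFDerivAt_fderiv_of_ne hf h0).comp_hasDerivAt t hc).clm_apply hu

theorem hasDerivAt_linear [FiniteDimensional ℂ V] (T : V →ₗ[ℂ] V) {w : ℝ → V} {w' : V} {t : ℝ}
    (hw : HasDerivAt w w' t) : HasDerivAt (fun t => T (w t)) (T w') t :=
  (T.toContinuousLinearMap.restrictScalars ℝ).hasFDerivAt.comp_hasDerivAt t hw

theorem hasDerivAt_line (x : E n) (s : ℝ) : HasDerivAt (fun t : ℝ => t • x) x s := by
  simpa using (hasDerivAt_id s).smul_const x

end Curves

section Pointwise
variable {n : ℕ} [NeZero n] {V : Type*} [NormedAddCommGroup V] [InnerProductSpace ℂ V]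
  [FiniteDimensional ℂ V]
variable {σ : Representation ℂ (SO n) V} {S : Fin n → Fin n → V →ₗ[ℂ] V}

omit [NeZero n] in
/-- The product rule for `t ↦ σ(exp tA) w(t)`. -/
theorem IsDifferential.hasDerivAt_apply (hS : IsDifferential σ S) {A : Matrix (Fin n) (Fin n) ℝ}
    (hA : Aᵀ = -A) {w : ℝ → V} {w' : V} {t : ℝ} (hw : HasDerivAt w w' t) :
    HasDerivAt (fun t : ℝ => σ (rot (t • A)) (w t)) (σ (rot (t • A)) (soAct S A (w t) + w')) t := by
  set b := Module.finBasis ℂ V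
  have h1 : ∀ i, HasDerivAt (fun t => b.repr (w t) i • σ (rot (t • A)) (b i))
      (b.repr (w t) i • σ (rot (t • A)) (soAct S A (b i)) +
        b.repr w' i • σ (rot (t • A)) (b i)) t := fun i => by
    have h2 : HasDerivAt (fun t => b.repr (w t) i) (b.repr w' i) t :=
      ((b.coord i).toContinuousLinearMap.restrictScalars ℝ).hasFDerivAt.comp_hasDerivAt t hw
    exact h2.smul (hS.hasDerivAt hA (b i) t)
  have h3 := HasDerivAt.fun_sum fun i (_ : i ∈ Finset.univ) => h1 i
  have h4 : ∀ (T : V →ₗ[ℂ] V) (v : V), ∑ i, b.repr v i • T (b i) = T v := fun T v => by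
    conv_rhs => rw [← b.sum_repr v]
    rw [map_sum]
    simp only [map_smul]
  simp only [h4] at h3
  refine h3.congr_deriv ?_
  rw [Finset.sum_add_distrib, h4, map_add]
  congr 1
  exact h4 (σ (rot (t • A)) ∘ₗ soAct S A) (w t)

omit [NeZero n] in
theorem hasDerivAt_mem {U : Submodule ℂ V} {w : ℝ → V} {w' : V} {t : ℝ}
    (hw : HasDerivAt w w' t) (hU : ∀ᶠ s in nhds t, w s ∈ U) : w' ∈ U := by
  have hc : IsClosed (U : Set V) := U.closed_of_finiteDimensional
  refine hc.mem_of_tendsto (hasDerivAt_iff_tendsto_slope.1 hw) ?_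
  filter_upwards [nhdsWithin_le_nhds hU] with s hs
  rw [slope_def_module, ← Complex.coe_smul]
  exact U.smul_mem _ (U.sub_mem hs hU.self_of_nhds)

/-- The curve `r (cos t e₁ + sin t e_k)`. -/
noncomputable def circ (r : ℝ) (k : Fin n) (t : ℝ) : E n :=
  (r * Real.cos t) • EuclideanSpace.single 0 1 + (r * Real.sin t) • EuclideanSpace.single k 1

/-- The derivative of `circ r k`. -/
noncomputable def circDeriv (r : ℝ) (k : Fin n) (t : ℝ) : E n :=
  (-(r * Real.sin t)) • EuclideanSpace.single 0 1 + (r * Real.cos t) • EuclideanSpace.single k 1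

theorem hasDerivAt_circ (r : ℝ) (k : Fin n) (t : ℝ) :
    HasDerivAt (circ r k) (circDeriv r k t) t := by
  have h1 := ((Real.hasDerivAt_cos t).const_mul r).smul_const
    (EuclideanSpace.single (0 : Fin n) (1 : ℝ))
  have h2 := ((Real.hasDerivAt_sin t).const_mul r).smul_const (EuclideanSpace.single k (1 : ℝ))
  refine (h1.add h2).congr_deriv ?_
  rw [circDeriv, mul_neg]

theorem hasDerivAt_circDeriv (r : ℝ) (k : Fin n) (t : ℝ) :
    HasDerivAt (circDeriv r k) (-circ r k t) t := by
  have h1 := ((Real.hasDerivAt_sin t).const_mul r).neg.smul_const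
    (EuclideanSpace.single (0 : Fin n) (1 : ℝ))
  have h2 := ((Real.hasDerivAt_cos t).const_mul r).smul_const (EuclideanSpace.single k (1 : ℝ))
  refine (h1.add h2).congr_deriv ?_
  rw [circ]
  module

/-- The circle `circ r k` is the orbit of `r e₁` under the rotations in the plane of `e₁`, `e_k`. -/
theorem circ_eq {k : Fin n} (hk : k ≠ 0) (r t : ℝ) : circ r k t =
    WithLp.toLp 2 (r • ((rot (t • wedge (Pi.single k 1) (Pi.single 0 1)) : SO n) :
      Matrix (Fin n) (Fin n) ℝ) *ᵥ Pi.single 0 1) := by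
  have hA := transpose_wedge (Pi.single k (1 : ℝ)) (Pi.single (0 : Fin n) 1)
  have h1 : wedge (Pi.single k 1) (Pi.single 0 1) *ᵥ Pi.single (0 : Fin n) (1 : ℝ) =
      Pi.single k 1 := by
    simp only [wedge, sub_mulVec, vecMulVec_mulVec]
    simp [hk]
  have h2 : wedge (Pi.single k 1) (Pi.single 0 1) *ᵥ Pi.single k (1 : ℝ) =
      -Pi.single (0 : Fin n) 1 := by
    simp only [wedge, sub_mulVec, vecMulVec_mulVec]
    simp [hk.symm]
  rw [coe_rot (by rw [transpose_smul, hA, smul_neg]), exp_smul_of_cube (wedge_single_cube hk),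
    add_mulVec, add_mulVec, smul_mulVec, smul_mulVec, ← mulVec_mulVec, h1, h2, one_mulVec]
  ext i
  simp only [circ, PiLp.add_apply, PiLp.smul_apply, PiLp.single_apply, smul_eq_mul,
    Pi.add_apply, Pi.smul_apply, Pi.neg_apply, Pi.single_apply]
  ring

variable {τ : Fin ((n - 1) / 2) → ℤ} {g : E n → V}

/-- `g` takes values in the fibres `σ(m) W_τ`. -/
def HasFibreValues (σ : Representation ℂ (SO n) V) (τ : Fin ((n - 1) / 2) → ℤ) (g : E n → V) :
    Prop :=
  ∀ (R : SO n) (s : ℝ), 0 < s →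
    σ R⁻¹ (g (WithLp.toLp 2 (s • (R : Matrix (Fin n) (Fin n) ℝ) *ᵥ Pi.single 0 1))) ∈ W σ τ

theorem single_smul_ne_zero {s : ℝ} (hs : 0 < s) : s • (EuclideanSpace.single 0 1 : E n) ≠ 0 := by
  simp [hs.ne']

omit [FiniteDimensional ℂ V] in
theorem HasFibreValues.mem (hg : HasFibreValues σ τ g) {s : ℝ} (hs : 0 < s) :
    g (s • EuclideanSpace.single 0 1) ∈ W σ τ := by
  have := hg 1 s hs
  rw [inv_one, map_one, OneMemClass.coe_one, one_mulVec] at this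
  exact this

/-- The radial derivatives of `g` remain in `W_τ`. -/
theorem HasFibreValues.fderiv_mem (hd : ContDiffOn ℝ ∞ g {0}ᶜ) (hg : HasFibreValues σ τ g) {s : ℝ}
    (hs : 0 < s) : fderiv ℝ g (s • EuclideanSpace.single 0 1) (EuclideanSpace.single 0 1) ∈
      W σ τ := by
  refine hasDerivAt_mem (hasDerivAt_comp_curve hd (hasDerivAt_line _ s) (single_smul_ne_zero hs)) ?_
  filter_upwards [lt_mem_nhds hs] with t ht
  exact hg.mem ht

theorem HasFibreValues.fderiv_fderiv_mem (hd : ContDiffOn ℝ ∞ g {0}ᶜ) (hg : HasFibreValues σ τ g)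
    {s : ℝ} (hs : 0 < s) : fderiv ℝ (fderiv ℝ g) (s • EuclideanSpace.single 0 1)
      (EuclideanSpace.single 0 1) (EuclideanSpace.single 0 1) ∈ W σ τ := by
  have h1 := hasDerivAt_fderiv_curve hd (hasDerivAt_line (EuclideanSpace.single (0 : Fin n) 1) s)
    (hasDerivAt_const s (EuclideanSpace.single (0 : Fin n) (1 : ℝ))) (single_smul_ne_zero hs)
  rw [map_zero, add_zero] at h1
  refine hasDerivAt_mem h1 ?_
  filter_upwards [lt_mem_nhds hs] with t ht
  exact hg.fderiv_mem hd ht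

omit [FiniteDimensional ℂ V] in
/-- Along the circle, rotating the values of `g` back gives a curve in `W_τ`. -/
theorem HasFibreValues.circ_mem (hg : HasFibreValues σ τ g) {k : Fin n} (hk : k ≠ 0) {s : ℝ}
    (hs : 0 < s) (t : ℝ) :
    σ (rot (t • wedge (Pi.single 0 1) (Pi.single k 1))) (g (circ s k t)) ∈ W σ τ := by
  have h := hg (rot (t • wedge (Pi.single k 1) (Pi.single 0 1))) s hs
  rw [← circ_eq hk, ← rot_neg (by rw [transpose_smul, transpose_wedge, smul_neg]), ← smul_neg] at h
  have h2 : -wedge (Pi.single k (1 : ℝ)) (Pi.single (0 : Fin n) 1) =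
      wedge (Pi.single 0 1) (Pi.single k 1) := by simp [wedge]
  rwa [h2] at h

theorem circ_ne_zero {k : Fin n} (hk : k ≠ 0) {s : ℝ} (hs : 0 < s) (t : ℝ) : circ s k t ≠ 0 := by
  intro h
  have h0 := congrArg (fun x : E n => x 0) h
  have h1 := congrArg (fun x : E n => x k) h
  simp [circ, hk, hk.symm, hs.ne'] at h0 h1
  have := Real.sin_sq_add_cos_sq t
  rw [h0, h1] at this
  norm_num at this

theorem IsDifferential.hasDerivAt_circ (hS : IsDifferential σ S) (hd : ContDiffOn ℝ ∞ g {0}ᶜ)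
    {k : Fin n} (hk : k ≠ 0) {s : ℝ} (hs : 0 < s) (t : ℝ) :
    HasDerivAt (fun t : ℝ => σ (rot (t • wedge (Pi.single 0 1) (Pi.single k 1))) (g (circ s k t)))
      (σ (rot (t • wedge (Pi.single 0 1) (Pi.single k 1)))
        (S 0 k (g (circ s k t)) + fderiv ℝ g (circ s k t) (circDeriv s k t))) t := by
  have h := hS.hasDerivAt_apply (transpose_wedge (Pi.single (0 : Fin n) 1) (Pi.single k 1))
    (hasDerivAt_comp_curve hd (FPicture.hasDerivAt_circ s k t) (circ_ne_zero hk hs t))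
  rwa [hS.soAct_wedge_single] at h

theorem HasFibreValues.circ_deriv_mem (hS : IsDifferential σ S) (hd : ContDiffOn ℝ ∞ g {0}ᶜ)
    (hg : HasFibreValues σ τ g) {k : Fin n} (hk : k ≠ 0) {s : ℝ} (hs : 0 < s) (t : ℝ) :
    σ (rot (t • wedge (Pi.single 0 1) (Pi.single k 1)))
        (S 0 k (g (circ s k t)) + fderiv ℝ g (circ s k t) (circDeriv s k t)) ∈ W σ τ :=
  hasDerivAt_mem (hS.hasDerivAt_circ hd hk hs t)
    (Filter.Eventually.of_forall fun t => hg.circ_mem hk hs t)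

theorem circ_zero (s : ℝ) (k : Fin n) : circ s k 0 = s • EuclideanSpace.single 0 1 := by
  simp [circ]

theorem circDeriv_zero (s : ℝ) (k : Fin n) : circDeriv s k 0 = s • EuclideanSpace.single k 1 := by
  simp [circDeriv]

/-- Modulo `W_τ`, the derivative in a direction orthogonal to the radial one is algebraic. -/
theorem HasFibreValues.fderiv_sub_mem (hS : IsDifferential σ S) (hd : ContDiffOn ℝ ∞ g {0}ᶜ)
    (hg : HasFibreValues σ τ g) {k : Fin n} (hk : k ≠ 0) {s : ℝ} (hs : 0 < s) :
    s • fderiv ℝ g (s • EuclideanSpace.single 0 1) (EuclideanSpace.single k 1) -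
      S k 0 (g (s • EuclideanSpace.single 0 1)) ∈ W σ τ := by
  have h := hg.circ_deriv_mem hS hd hk hs 0
  rw [zero_smul, rot_zero, map_one, Module.End.one_apply, circ_zero, circDeriv_zero, map_smul,
    hS.antisymm 0 k, LinearMap.neg_apply] at h
  rwa [sub_eq_neg_add]

/-- The radial derivative of `HasFibreValues.fderiv_sub_mem`, which determines the mixed second
derivatives modulo `W_τ`. -/
theorem HasFibreValues.mixed_mem (hS : IsDifferential σ S) (hd : ContDiffOn ℝ ∞ g {0}ᶜ)
    (hg : HasFibreValues σ τ g) {k : Fin n} (hk : k ≠ 0) {s : ℝ} (hs : 0 < s) :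
    fderiv ℝ g (s • EuclideanSpace.single 0 1) (EuclideanSpace.single k 1) +
      s • fderiv ℝ (fderiv ℝ g) (s • EuclideanSpace.single 0 1) (EuclideanSpace.single 0 1)
        (EuclideanSpace.single k 1) -
      S k 0 (fderiv ℝ g (s • EuclideanSpace.single 0 1) (EuclideanSpace.single 0 1)) ∈ W σ τ := by
  have hline := hasDerivAt_line (EuclideanSpace.single (0 : Fin n) 1) s
  have h1 := hasDerivAt_fderiv_curve hd hline
    (hasDerivAt_const s (EuclideanSpace.single k (1 : ℝ))) (single_smul_ne_zero hs)
  have h3 := hasDerivAt_linear (S k 0) (hasDerivAt_comp_curve hd hline (single_smul_ne_zero hs))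
  rw [map_zero, add_zero] at h1
  have h4 := ((hasDerivAt_id s).smul h1).sub h3
  have h5 := hasDerivAt_mem (U := W σ τ) h4 (by
    filter_upwards [lt_mem_nhds hs] with t ht
    exact hg.fderiv_sub_mem hS hd hk ht)
  rw [one_smul, id, add_comm] at h5
  exact h5

/-- The second derivative along the circle of the values of `g` rotated back to `W_τ`. It determines
`∂_k² g` modulo `W_τ`. -/
theorem HasFibreValues.second_mem (hS : IsDifferential σ S) (hd : ContDiffOn ℝ ∞ g {0}ᶜ)
    (hg : HasFibreValues σ τ g) {k : Fin n} (hk : k ≠ 0) {s : ℝ} (hs : 0 < s) :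
    (s * s) • fderiv ℝ (fderiv ℝ g) (s • EuclideanSpace.single 0 1) (EuclideanSpace.single k 1)
        (EuclideanSpace.single k 1) -
      (2 * s) • S k 0 (fderiv ℝ g (s • EuclideanSpace.single 0 1) (EuclideanSpace.single k 1)) +
      S k 0 (S k 0 (g (s • EuclideanSpace.single 0 1))) ∈ W σ τ := by
  have hA := transpose_wedge (Pi.single (0 : Fin n) (1 : ℝ)) (Pi.single k 1)
  have hc := FPicture.hasDerivAt_circ s k 0
  have h0 := circ_ne_zero hk hs 0
  have h2 := hasDerivAt_linear (S 0 k) (hasDerivAt_comp_curve hd hc h0)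
  have h3 := hasDerivAt_fderiv_curve hd hc (hasDerivAt_circDeriv s k 0) h0
  have h4 := hasDerivAt_mem (hS.hasDerivAt_apply hA (h2.add h3))
    (Filter.Eventually.of_forall fun t => hg.circ_deriv_mem hS hd hk hs t)
  have h5 := (W σ τ).smul_mem (s : ℂ) (hg.fderiv_mem hd hs)
  have h6 := add_mem h4 h5
  rw [Complex.coe_smul] at h6
  convert! h6 using 1
  simp [rot_zero, circ_zero, circDeriv_zero, hS.soAct_wedge_single, hS.antisymm 0 k]
  module

end Pointwise

/-! ### The action of `N_j` at a multiple of `e₁` -/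

section FourierPointwise
variable {n : ℕ} [NeZero n] {V : Type*} [NormedAddCommGroup V] [InnerProductSpace ℂ V]
  [FiniteDimensional ℂ V]
variable {σ : Representation ℂ (SO n) V} {S : Fin n → Fin n → V →ₗ[ℂ] V}
variable {τ : Fin ((n - 1) / 2) → ℤ} {g : E n → V}

theorem sum_eq_erase_add {M : Type*} [AddCommMonoid M] (f : Fin n → M) :
    ∑ k, f k = ∑ k ∈ Finset.univ.erase 0, f k + f 0 :=
  (Finset.sum_erase_add _ _ (Finset.mem_univ _)).symm

/-- The action of `N_1` in the Fourier picture preserves `W_τ` at multiples of `e₁`: the remaining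
terms combine to `∑_k S_{k1}²`. -/
theorem HasFibreValues.fourierN_zero_mem (hσ : IsIrredUnitary σ) (hS : IsDifferential σ S)
    (hd : ContDiffOn ℝ ∞ g {0}ᶜ) (hg : HasFibreValues σ τ g) (lam : ℂ) {s : ℝ} (hs : 0 < s) :
    fourierN S lam 0 g (s • EuclideanSpace.single 0 1) ∈ W σ τ := by
  rw [fourierN]
  refine (W σ τ).smul_mem _ ?_
  set η : E n := s • EuclideanSpace.single 0 1 with hη
  have h00 : S 0 0 = 0 := by rw [← soBil_single (S := S), hS.soBil_self]
  have hη0 : η 0 = s := by simp [hη]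
  -- for each `k ≠ 1`, `second_mem` replaces `∂_k²` by first derivatives, which cancel against the
  -- term with `S_{1k} ∂_k`
  have h1 : ∀ k ∈ Finset.univ.erase (0 : Fin n),
      -((s : ℂ) • fderiv ℝ (fderiv ℝ g) η (EuclideanSpace.single k 1) (EuclideanSpace.single k 1)) +
      (2 : ℂ) • S k 0 (fderiv ℝ g η (EuclideanSpace.single k 1)) -
      (s : ℂ)⁻¹ • S k 0 (S k 0 (g η)) ∈ W σ τ := fun k hk => by
    have h := (W σ τ).smul_mem (-(s : ℂ)⁻¹) (hg.second_mem hS hd (Finset.ne_of_mem_erase hk) hs)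
    have hs' : (s : ℂ) ≠ 0 := by exact_mod_cast hs.ne'
    convert h using 1
    simp only [← Complex.coe_smul (E := V), Complex.ofReal_mul, Complex.ofReal_ofNat]
    rw [smul_add, smul_sub, smul_smul, smul_smul]
    rw [show -(s : ℂ)⁻¹ * (s * s) = -s by field_simp, show -(s : ℂ)⁻¹ * (2 * s) = -2 by field_simp]
    module
  have h2 := (W σ τ).smul_mem (s : ℂ)⁻¹ (sum_S_S_mem_W hσ hS (hg.mem hs))
  have h3 := hg.fderiv_mem hd hs
  have h4 := hg.fderiv_fderiv_mem hd hs
  have h5 := add_mem (add_mem (add_mem (sum_mem h1) h2) ((W σ τ).smul_mem (s : ℂ) h4))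
    ((W σ τ).smul_mem ((n : ℂ) - 2 * lam) h3)
  rw [← hη] at h5
  convert h5 using 1
  have h6 : ∑ k ∈ Finset.univ.erase 0, S 0 k (fderiv ℝ g η (EuclideanSpace.single k 1)) =
      -∑ k ∈ Finset.univ.erase 0, S k 0 (fderiv ℝ g η (EuclideanSpace.single k 1)) := by
    rw [← Finset.sum_neg_distrib]
    exact Finset.sum_congr rfl fun k _ => by rw [hS.antisymm 0 k, LinearMap.neg_apply]
  rw [hη0, sum_eq_erase_add, sum_eq_erase_add (fun k => S 0 k _), h6]
  simp only [h00, Finset.sum_add_distrib, Finset.sum_sub_distrib, Finset.sum_neg_distrib,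
    ← Finset.smul_sum, LinearMap.zero_apply]
  have h7 : fderiv ℝ (fderiv ℝ g) η (EuclideanSpace.single 0 1) η = (s : ℂ) •
      fderiv ℝ (fderiv ℝ g) η (EuclideanSpace.single 0 1) (EuclideanSpace.single 0 1) := by
    rw [Complex.coe_smul, ← map_smul]
  rw [h7]
  module

/-- The action of `N_u`, `u ≠ 1`, at multiples of `e₁`, modulo `W_τ`. -/
theorem HasFibreValues.fourierN_sub_mem (hS : IsDifferential σ S)
    (hd : ContDiffOn ℝ ∞ g {0}ᶜ) (hg : HasFibreValues σ τ g) (lam : ℂ) {u : Fin n} (hu : u ≠ 0)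
    {s : ℝ} (hs : 0 < s) :
    fourierN S lam u g (s • EuclideanSpace.single 0 1) -
      (Complex.I * (s : ℂ)⁻¹) •
        (((n : ℂ) - 2 - 2 * lam) • S u 0 (g (s • EuclideanSpace.single 0 1)) -
        (2 : ℂ) • ∑ k ∈ Finset.univ.erase 0, S u k (S k 0 (g (s • EuclideanSpace.single 0 1)))) ∈
      W σ τ := by
  set η : E n := s • EuclideanSpace.single 0 1 with hη
  have hηne : η ≠ 0 := single_smul_ne_zero hs
  have hs' : (s : ℂ) ≠ 0 := by exact_mod_cast hs.ne'
  have hWs := isStable_W hS τ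
  have hηu : η u = 0 := by simp [hη, hu]
  set D := fderiv ℝ g η with hD
  have hθ : ∀ k : Fin n, k ≠ 0 →
      D (EuclideanSpace.single k 1) - (s : ℂ)⁻¹ • S k 0 (g η) ∈ W σ τ := fun k hk => by
    have h := (W σ τ).smul_mem ((s : ℂ)⁻¹) (hg.fderiv_sub_mem hS hd hk hs)
    convert h using 1
    rw [← Complex.coe_smul (E := V), smul_sub, smul_smul, inv_mul_cancel₀ hs', one_smul]
  have h1 := sum_mem fun k (hk : k ∈ Finset.univ.erase (0 : Fin n)) =>
    hWs.S_mem hu (Finset.ne_of_mem_erase hk) (hθ k (Finset.ne_of_mem_erase hk))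
  have h2 := hg.mixed_mem hS hd hu hs
  rw [← hη, ← hD] at h2
  -- `2 ∑_k ξ_k ∂_k ∂_u` is `2 s ∂_1 ∂_u` at `s e₁`, and `∂_1 ∂_u` is known from `mixed_mem`
  have hsymm : fderiv ℝ (fderiv ℝ g) η (EuclideanSpace.single u 1) η =
      s • fderiv ℝ (fderiv ℝ g) η (EuclideanSpace.single 0 1) (EuclideanSpace.single u 1) := by
    have h3 : IsSymmSndFDerivAt ℝ g η := (contDiffAt_of_ne hd hηne).isSymmSndFDerivAt (by
      simp only [minSmoothness_of_isRCLikeNormedField]; exact WithTop.coe_le_coe.2 le_top)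
    rw [h3.eq, ← _root_.smul_apply, ← map_smul, ← hη]
  have h4 := add_mem (add_mem ((W σ τ).smul_mem (2 * Complex.I) h2)
    ((W σ τ).smul_mem (Complex.I * ((n : ℂ) - 2 - 2 * lam)) (hθ u hu)))
    ((W σ τ).smul_mem (-2 * Complex.I) h1)
  convert h4 using 1
  rw [fourierN, hηu, hsymm, ← hD, sum_eq_erase_add (fun k => S u k _)]
  simp only [map_sub, map_smul, Finset.sum_sub_distrib, ← Finset.smul_sum]
  simp only [Complex.ofReal_zero, zero_smul, neg_zero, zero_add]
  module

/-! ### The fibres -/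

omit [FiniteDimensional ℂ V] in
theorem W_map_le (m : SO n)
    (hm : (m : Matrix (Fin n) (Fin n) ℝ) *ᵥ Pi.single 0 1 = Pi.single 0 1) :
    (W σ τ).map (σ m) ≤ W σ τ := by
  rw [W, Submodule.map_le_iff_le_comap]
  refine sSup_le fun U hU => ?_
  rw [← Submodule.map_le_iff_le_comap]
  exact (hU.1.invariant m hm).trans (le_sSup hU)

omit [FiniteDimensional ℂ V] in
/-- The fibre can be computed with any `m` such that `‖ξ‖ m e₁ = ξ`. -/
theorem fibre_eq {ξ : E n} (hξ : ξ ≠ 0) {m : SO n}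
    (hm : ‖ξ‖ • (m : Matrix (Fin n) (Fin n) ℝ) *ᵥ Pi.single 0 1 = ξ.ofLp) :
    fibre σ τ ξ = (W σ τ).map (σ m) := by
  refine le_antisymm (iSup_le fun m' => iSup_le fun hm' => ?_) (le_iSup₂_of_le m hm le_rfl)
  have h1 : (m' : Matrix (Fin n) (Fin n) ℝ) *ᵥ Pi.single 0 1 =
      (m : Matrix (Fin n) (Fin n) ℝ) *ᵥ Pi.single 0 1 :=
    smul_right_injective _ (norm_ne_zero_iff.2 hξ) (hm'.trans hm.symm)
  have h2 := W_map_le (σ := σ) (τ := τ) (m⁻¹ * m') (by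
    rw [Submonoid.coe_mul, coe_inv_SO, ← mulVec_mulVec, h1, mulVec_mulVec, transpose_mul_self_SO,
      one_mulVec])
  rintro _ ⟨w, hw, rfl⟩
  refine ⟨σ (m⁻¹ * m') w, h2 ⟨w, hw, rfl⟩, ?_⟩
  rw [← Module.End.mul_apply, ← map_mul, mul_inv_cancel_left]

theorem exists_mulVec_eq (hn : 2 ≤ n) {ξ : E n} (hξ : ξ ≠ 0) :
    ∃ m : SO n, ‖ξ‖ • (m : Matrix (Fin n) (Fin n) ℝ) *ᵥ Pi.single 0 1 = ξ.ofLp := by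
  have h0 : ‖ξ‖ ≠ 0 := norm_ne_zero_iff.2 hξ
  have h1 : ξ.ofLp ⬝ᵥ ξ.ofLp = ‖ξ‖ * ‖ξ‖ := by
    rw [← real_inner_self_eq_norm_mul_norm, EuclideanSpace.inner_eq_star_dotProduct]
    simp
  obtain ⟨A, hA, -, hv⟩ := exists_rotation_mulVec (n := n) (k := 0) (by omega) (‖ξ‖⁻¹ • ξ.ofLp)
    (by simp) (by rw [smul_dotProduct, dotProduct_smul, h1]; simp; field_simp)
  refine ⟨rot A, ?_⟩
  rw [coe_rot hA]
  have h2 : (⟨0, by omega⟩ : Fin n) = 0 := rfl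
  rw [h2] at hv
  rw [hv, smul_smul, mul_inv_cancel₀ h0, one_smul]

/-- The projection to the fibre over `ξ` is conjugate to the projection to `W_τ` by `σ(m)`. -/
theorem starProjection_fibre (hσ : IsIrredUnitary σ) {ξ : E n} (hξ : ξ ≠ 0) {m : SO n}
    (hm : ‖ξ‖ • (m : Matrix (Fin n) (Fin n) ℝ) *ᵥ Pi.single 0 1 = ξ.ofLp) (v : V) :
    (fibre σ τ ξ).starProjection v = σ m ((W σ τ).starProjection (σ m⁻¹ v)) := by
  rw [fibre_eq hξ hm]
  have h1 : v = σ m (σ m⁻¹ v) := by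
    rw [← Module.End.mul_apply, ← map_mul, mul_inv_cancel, map_one, Module.End.one_apply]
  generalize σ m⁻¹ v = y at h1 ⊢
  subst h1
  refine Submodule.eq_starProjection_of_mem_of_inner_eq_zero
    ⟨_, Submodule.starProjection_apply_mem _ _, rfl⟩ ?_
  rintro _ ⟨w, hw, rfl⟩
  rw [← map_sub, hσ.unitary]
  exact Submodule.starProjection_inner_eq_zero _ _ hw

/-! ### Transport along a rotation -/

/-- The linear map of `ℝⁿ` given by `m ∈ SO(n)`. -/
noncomputable def euclid (m : SO n) : E n →L[ℝ] E n :=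
  (Matrix.toEuclideanLin (m : Matrix (Fin n) (Fin n) ℝ)).toContinuousLinearMap

omit [NeZero n] in
theorem euclid_apply (m : SO n) (x : E n) :
    euclid m x = WithLp.toLp 2 ((m : Matrix (Fin n) (Fin n) ℝ) *ᵥ x.ofLp) := rfl

/-- The function `η ↦ σ(m)⁻¹ f(m η)`. -/
noncomputable def transport (σ : Representation ℂ (SO n) V) (m : SO n) (f : E n → V)
    (η : E n) : V :=
  σ m⁻¹ (f (euclid m η))

omit [NeZero n] in
theorem euclid_ne_zero (m : SO n) {η : E n} (hη : η ≠ 0) : euclid m η ≠ 0 := by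
  intro h
  apply hη
  have h1 := congrArg WithLp.ofLp h
  rw [euclid_apply] at h1
  have h2 := congrArg (fun x => (m : Matrix (Fin n) (Fin n) ℝ)ᵀ *ᵥ x) h1
  simp only [mulVec_mulVec, transpose_mul_self_SO, one_mulVec] at h2
  ext i
  simpa using congrFun h2 i

omit [NeZero n] in
theorem contDiffOn_transport {f : E n → V} (hf : ContDiffOn ℝ ∞ f {0}ᶜ) (m : SO n) :
    ContDiffOn ℝ ∞ (transport σ m f) {0}ᶜ :=
  ((σ m⁻¹).toContinuousLinearMap.restrictScalars ℝ).contDiff.comp_contDiffOn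
    (hf.comp (euclid m).contDiff.contDiffOn fun _ hη => euclid_ne_zero m hη)

omit [NeZero n] in
theorem fderiv_transport {f : E n → V} (hf : ContDiffOn ℝ ∞ f {0}ᶜ) (m : SO n) {η : E n}
    (hη : η ≠ 0) (x : E n) :
    fderiv ℝ (transport σ m f) η x = σ m⁻¹ (fderiv ℝ f (euclid m η) (euclid m x)) := by
  have h1 := ((σ m⁻¹).toContinuousLinearMap.restrictScalars ℝ).hasFDerivAt.comp η
    ((hasFDerivAt_of_ne hf (euclid_ne_zero m hη)).comp η (euclid m).hasFDerivAt)
  exact congrArg (fun L => L x) h1.fderiv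

omit [NeZero n] in
theorem fderiv_fderiv_transport {f : E n → V} (hf : ContDiffOn ℝ ∞ f {0}ᶜ) (m : SO n) {η : E n}
    (hη : η ≠ 0) (x y : E n) : fderiv ℝ (fderiv ℝ (transport σ m f)) η x y =
      σ m⁻¹ (fderiv ℝ (fderiv ℝ f) (euclid m η) (euclid m x) (euclid m y)) := by
  have h1 := (hasFDerivAt_fderiv_of_ne (contDiffOn_transport (σ := σ) hf m) hη).clm_apply
    (hasFDerivAt_const y η)
  have h2 := ((σ m⁻¹).toContinuousLinearMap.restrictScalars ℝ).hasFDerivAt.comp η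
    (((hasFDerivAt_fderiv_of_ne hf (euclid_ne_zero m hη)).comp η (euclid m).hasFDerivAt).clm_apply
    (hasFDerivAt_const (euclid m y) η))
  have h3 := h2.congr_of_eventuallyEq (f₁ := fun η => fderiv ℝ (transport σ m f) η y) (by
    filter_upwards [isOpen_compl_singleton.mem_nhds hη] with ζ hζ
    exact fderiv_transport hf m hζ y)
  have h4 := congrArg (fun L => L x) (h1.unique h3)
  simpa using h4

omit [FiniteDimensional ℂ V] in
/-- Transport along a rotation preserves the condition on the values. -/
theorem hasFibreValues_transport {f : E n → V}
    (hf : ∀ ξ, ξ ≠ 0 → f ξ ∈ fibre σ τ ξ) (m : SO n) :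
    HasFibreValues σ τ (transport σ m f) := by
  intro R s hs
  set e : E n := WithLp.toLp 2 (s • (R : Matrix (Fin n) (Fin n) ℝ) *ᵥ Pi.single 0 1) with he
  have h1 : (euclid m e).ofLp =
      s • ((m * R : SO n) : Matrix (Fin n) (Fin n) ℝ) *ᵥ Pi.single 0 1 := by
    rw [euclid_apply, he, Submonoid.coe_mul, ← mulVec_mulVec, mulVec_smul]
  have h2 : ‖euclid m e‖ = s := by
    have h3 : ‖euclid m e‖ * ‖euclid m e‖ = s * s := by
      rw [← real_inner_self_eq_norm_mul_norm, EuclideanSpace.inner_eq_star_dotProduct, h1,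
        star_trivial, smul_dotProduct, dotProduct_smul, dotProduct_mulVec, vecMul_mulVec,
        transpose_mul_self_SO]
      simp
    exact (mul_self_inj (norm_nonneg _) hs.le).1 h3
  have h4 : euclid m e ≠ 0 := by rw [← norm_ne_zero_iff, h2]; exact hs.ne'
  have h5 := hf _ h4
  rw [fibre_eq h4 (m := m * R) (by rw [h2, h1])] at h5
  obtain ⟨w, hw, hwe⟩ := h5
  rw [transport, ← hwe, ← Module.End.mul_apply, ← Module.End.mul_apply, ← map_mul, ← map_mul]
  simpa [mul_assoc] using hw

end FourierPointwise

/-! ### Equivariance of the action in the Fourier picture -/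

section FourierTransport
variable {n : ℕ} {V : Type*} [NormedAddCommGroup V] [InnerProductSpace ℂ V]
  [FiniteDimensional ℂ V]
variable {σ : Representation ℂ (SO n) V} {S : Fin n → Fin n → V →ₗ[ℂ] V}

theorem euclid_single (m : SO n) (k : Fin n) : euclid m (EuclideanSpace.single k 1) =
    ∑ a, (m : Matrix (Fin n) (Fin n) ℝ) a k • EuclideanSpace.single a (1 : ℝ) := by
  rw [eq_sum_coord_smul (euclid m (EuclideanSpace.single k 1))]
  simp [euclid_apply]

theorem sum_smul_euclid_single (m : SO n) (j : Fin n) :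
    ∑ k, (m : Matrix (Fin n) (Fin n) ℝ) j k • euclid m (EuclideanSpace.single k 1) =
      EuclideanSpace.single j 1 := by
  ext i
  have h := congrFun (congrFun (mul_transpose_self_SO m) i) j
  simp only [mul_apply, transpose_apply] at h
  simp only [WithLp.ofLp_sum, Finset.sum_apply, WithLp.ofLp_smul, Pi.smul_apply, euclid_apply,
    PiLp.ofLp_single, mulVec_single_one, smul_eq_mul, Matrix.col_apply]
  simp only [mul_comm ((m : Matrix (Fin n) (Fin n) ℝ) j _), h, one_apply, Pi.single_apply]

/-- The contraction of a bilinear map with the Euclidean inner product does not depend on the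
orthonormal basis. -/
theorem sum_bilin_euclid (m : SO n) {M : Type*} [AddCommGroup M] [Module ℝ M]
    (β : E n →ₗ[ℝ] E n →ₗ[ℝ] M) :
    ∑ k, β (euclid m (EuclideanSpace.single k 1)) (euclid m (EuclideanSpace.single k 1)) =
      ∑ k, β (EuclideanSpace.single k 1) (EuclideanSpace.single k 1) := by
  have h : ∀ k, β (euclid m (EuclideanSpace.single k 1)) (euclid m (EuclideanSpace.single k 1)) =
      ∑ a, β (EuclideanSpace.single a 1) ((m : Matrix (Fin n) (Fin n) ℝ) a k •
        euclid m (EuclideanSpace.single k 1)) := fun k => by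
    have h' : ∀ y, β (euclid m (EuclideanSpace.single k 1)) y =
        ∑ a, (m : Matrix (Fin n) (Fin n) ℝ) a k • β (EuclideanSpace.single a 1) y := fun y => by
      rw [euclid_single, map_sum, LinearMap.sum_apply]
      simp only [map_smul, LinearMap.smul_apply]
    rw [h']
    simp only [map_smul]
  simp only [h]
  rw [Finset.sum_comm]
  refine Finset.sum_congr rfl fun a _ => ?_
  rw [← map_sum, sum_smul_euclid_single]

/-- The inclusion `ℝⁿ → ℂⁿ`. -/
noncomputable def complexify : E n →ₗ[ℝ] (Fin n → ℂ) where
  toFun x a := (x a : ℂ)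
  map_add' x y := by ext; simp
  map_smul' c x := by ext; simp

theorem complexify_single (k : Fin n) :
    complexify (EuclideanSpace.single k 1 : E n) = Pi.single k 1 := ofReal_single k

theorem actC_single' (m : SO n) (k : Fin n) :
    actC m (Pi.single k 1) = complexify (euclid m (EuclideanSpace.single k 1)) := by
  rw [actC_single]; rfl

/-- The operators by which the `N_j` act in the Fourier picture are equivariant for `SO(n)`. -/
theorem IsDifferential.fourierN_transport (hS : IsDifferential σ S) {f : E n → V}
    (hf : ContDiffOn ℝ ∞ f {0}ᶜ) (lam : ℂ) (m : SO n) (j : Fin n) {η : E n} (hη : η ≠ 0) :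
    σ m⁻¹ (fourierN S lam j f (euclid m η)) =
      ∑ k, ((m : Matrix (Fin n) (Fin n) ℝ) j k : ℂ) • fourierN S lam k (transport σ m f) η := by
  set e : Fin n → E n := fun k => EuclideanSpace.single k 1 with he
  set M : Matrix (Fin n) (Fin n) ℝ := (m : Matrix (Fin n) (Fin n) ℝ) with hM
  set D1 := fderiv ℝ f (euclid m η) with hD1
  set D2 := fderiv ℝ (fderiv ℝ f) (euclid m η) with hD2
  have g1 : ∀ x, fderiv ℝ (transport σ m f) η x = σ m⁻¹ (D1 (euclid m x)) :=
    fderiv_transport hf m hη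
  have g2 : ∀ x y, fderiv ℝ (fderiv ℝ (transport σ m f)) η x y =
      σ m⁻¹ (D2 (euclid m x) (euclid m y)) := fderiv_fderiv_transport hf m hη
  have hsum : ∑ k, M j k • euclid m (e k) = e j := sum_smul_euclid_single m j
  have hA : ∑ k, (M j k : ℂ) * (η k : ℂ) = (euclid m η j : ℂ) := by
    simp [euclid_apply, mulVec, dotProduct, hM]
  have hL : ∑ k, fderiv ℝ (fderiv ℝ (transport σ m f)) η (e k) (e k) =
      σ m⁻¹ (∑ k, D2 (e k) (e k)) := by
    have h := sum_bilin_euclid m (LinearMap.mk₂ ℝ (fun x y => D2 x y) (by simp) (by simp) (by simp)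
      (by simp))
    simp only [LinearMap.mk₂_apply] at h
    simp only [g2, ← map_sum]
    rw [h]
  have hB : ∑ k, (M j k : ℂ) • fderiv ℝ (fderiv ℝ (transport σ m f)) η (e k) η =
      σ m⁻¹ (D2 (e j) (euclid m η)) := by
    simp only [g2, Complex.coe_smul]
    rw [← hsum, map_sum, _root_.sum_apply, map_sum]
    simp only [map_smul, _root_.smul_apply]
    exact Finset.sum_congr rfl fun k _ => by
      rw [← Complex.coe_smul, ← Complex.coe_smul, map_smul]
  have hC : ∑ k, (M j k : ℂ) • fderiv ℝ (transport σ m f) η (e k) = σ m⁻¹ (D1 (e j)) := by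
    simp only [g1, Complex.coe_smul]
    rw [← hsum, map_sum, map_sum]
    simp only [map_smul]
    exact Finset.sum_congr rfl fun k _ => by
      rw [← Complex.coe_smul, ← Complex.coe_smul, map_smul]
  have hconj : ∀ k l x, S k l (σ m⁻¹ x) =
      σ m⁻¹ (soBil S (complexify (euclid m (e k))) (complexify (euclid m (e l))) x) :=
      fun k l x => by
    have h := hS.conj_soBil m (Pi.single k 1) (Pi.single l 1) (σ m⁻¹ x)
    rw [soBil_single, actC_single', actC_single', ← Module.End.mul_apply (σ m) (σ m⁻¹), ← map_mul,
      mul_inv_cancel, map_one, Module.End.one_apply] at h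
    rw [← h, ← Module.End.mul_apply (σ m⁻¹) (σ m), ← map_mul, inv_mul_cancel, map_one,
      Module.End.one_apply]
  have hD : ∑ k, (M j k : ℂ) • ∑ l, S k l (fderiv ℝ (transport σ m f) η (e l)) =
      σ m⁻¹ (∑ l, S j l (D1 (e l))) := by
    have h := sum_bilin_euclid m (LinearMap.mk₂ ℝ
      (fun x y => soBil S (Pi.single j 1) (complexify x) (D1 y)) (by simp) (by simp) (by simp)
      (fun c x y => by simp [← Complex.coe_smul]))
    simp only [LinearMap.mk₂_apply, complexify_single, soBil_single] at h
    rw [← h]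
    simp only [g1, hconj, Finset.smul_sum]
    rw [Finset.sum_comm, map_sum]
    refine Finset.sum_congr rfl fun l _ => ?_
    have hs' : (Pi.single j 1 : Fin n → ℂ) = ∑ k, M j k • complexify (euclid m (e k)) := by
      rw [← complexify_single, ← sum_smul_euclid_single m j, map_sum]
      simp only [map_smul]
      rfl
    rw [hs', map_sum, LinearMap.sum_apply, LinearMap.sum_apply, map_sum]
    refine Finset.sum_congr rfl fun k _ => ?_
    rw [← Complex.coe_smul, map_smul, LinearMap.smul_apply, LinearMap.smul_apply, map_smul]
  have hterm : ∀ k, (M j k : ℂ) • fourierN S lam k (transport σ m f) η =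
      Complex.I • (-(((M j k : ℂ) * (η k : ℂ)) • σ m⁻¹ (∑ k, D2 (e k) (e k))) +
        (2 : ℂ) • ((M j k : ℂ) • fderiv ℝ (fderiv ℝ (transport σ m f)) η (e k) η) +
        (n - 2 * lam) • ((M j k : ℂ) • fderiv ℝ (transport σ m f) η (e k)) -
        (2 : ℂ) • ((M j k : ℂ) • ∑ l, S k l (fderiv ℝ (transport σ m f) η (e l)))) := fun k => by
    rw [fourierN, hL]
    module
  rw [Finset.sum_congr rfl fun k _ => hterm k, ← Finset.smul_sum, Finset.sum_sub_distrib,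
    Finset.sum_add_distrib, Finset.sum_add_distrib, Finset.sum_neg_distrib, ← Finset.sum_smul,
    ← Finset.smul_sum, ← Finset.smul_sum, ← Finset.smul_sum, hA, hB, hC, hD, fourierN]
  simp only [map_smul, map_sub, map_add, map_neg]
  rfl

theorem partialDeriv_transport {f : E n → V} (hf : ContDiffOn ℝ ∞ f {0}ᶜ) (m : SO n) (j : Fin n)
    {η : E n} (hη : η ≠ 0) : σ m⁻¹ (partialDeriv j f (euclid m η)) =
      ∑ k, ((m : Matrix (Fin n) (Fin n) ℝ) j k : ℂ) •
        fderiv ℝ (transport σ m f) η (EuclideanSpace.single k 1) := by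
  simp only [fderiv_transport hf m hη, Complex.coe_smul]
  rw [partialDeriv, ← sum_smul_euclid_single m j, map_sum, map_sum]
  simp only [map_smul]
  exact Finset.sum_congr rfl fun k _ => by
    rw [← Complex.coe_smul, ← Complex.coe_smul, map_smul]

end FourierTransport

/-! ### Components of the action of `N_j` -/

section Components
variable {n : ℕ} [NeZero n] {V : Type*} [NormedAddCommGroup V] [InnerProductSpace ℂ V]
  [FiniteDimensional ℂ V]
variable {σ : Representation ℂ (SO n) V} {S : Fin n → Fin n → V →ₗ[ℂ] V}
variable {τ : Fin ((n - 1) / 2) → ℤ} {g : E n → V}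

/-- At multiples of `e₁` the components of the action of `N_u` lie in `W_τ` and its neighbours. -/
theorem HasFibreValues.fourierN_mem_Wnear (hσ : IsIrredUnitary σ) (hS : IsDifferential σ S)
    (hd : ContDiffOn ℝ ∞ g {0}ᶜ) (hg : HasFibreValues σ τ g) (lam : ℂ) (u : Fin n) {s : ℝ}
    (hs : 0 < s) : fourierN S lam u g (s • EuclideanSpace.single 0 1) ∈ Wnear σ τ := by
  by_cases hu : u = 0
  · subst hu
    exact Submodule.mem_sup_left (hg.fourierN_zero_mem hσ hS hd lam hs)
  · have h1 := hg.fourierN_sub_mem hS hd lam hu hs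
    have h2 := fun k (hk : k ≠ 0) => S_mem_Wnear hσ hS (hg.mem hs) hk
    rw [← sub_add_cancel (fourierN S lam u g _) ((Complex.I * (s : ℂ)⁻¹) • _)]
    refine add_mem (Submodule.mem_sup_left h1) (Submodule.smul_mem _ _ (sub_mem
      (Submodule.smul_mem _ _ (h2 u hu)) (Submodule.smul_mem _ _ (sum_mem fun k hk => ?_))))
    exact (isStable_Wnear hS τ).S_mem hu (Finset.ne_of_mem_erase hk)
      (h2 k (Finset.ne_of_mem_erase hk))

/-- At multiples of `e₁`, the component of the action of `N_u` in `W_{τ'}` is a multiple of that of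
`∂_u`. Both vanish for `u = 1`; for `u ≠ 1` both are multiples of the component of `S_{u1} g`. -/
theorem HasFibreValues.starProjection_fourierN (hσ : IsIrredUnitary σ) (hS : IsDifferential σ S)
    (hd : ContDiffOn ℝ ∞ g {0}ᶜ) (hg : HasFibreValues σ τ g) (lam : ℂ) (u : Fin n) {s : ℝ}
    (hs : 0 < s) {τ' : Fin ((n - 1) / 2) → ℤ} (hτ : τ ≠ τ') :
    (W σ τ').starProjection (fourierN S lam u g (s • EuclideanSpace.single 0 1)) =
      (-Complex.I * (2 * lam + (casimirValue τ' - casimirValue τ))) •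
        (W σ τ').starProjection
          (fderiv ℝ g (s • EuclideanSpace.single 0 1) (EuclideanSpace.single u 1)) := by
  have h0 : ∀ w ∈ W σ τ, (W σ τ').starProjection w = 0 := fun w hw =>
    (Submodule.starProjection_apply_eq_zero_iff _).2 (W_le_orthogonal hσ hS hτ hw)
  by_cases hu : u = 0
  · subst hu
    rw [h0 _ (hg.fourierN_zero_mem hσ hS hd lam hs), h0 _ (hg.fderiv_mem hd hs), smul_zero]
  · have h1 := h0 _ (hg.fourierN_sub_mem hS hd lam hu hs)
    have h2 := h0 _ (hg.fderiv_sub_mem hS hd hu hs)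
    rw [map_sub, sub_eq_zero] at h1 h2
    have h3 := starProjection_sum_S_S hσ hS τ' (hg.mem hs) hu
    rw [h1, map_smul, map_sub, h3, map_smul, ← h2, ← Complex.coe_smul, map_smul]
    have hs' : (s : ℂ) ≠ 0 := by exact_mod_cast hs.ne'
    match_scalars
    field_simp
    ring

theorem euclid_smul_single {ξ : E n} {m : SO n}
    (hm : ‖ξ‖ • (m : Matrix (Fin n) (Fin n) ℝ) *ᵥ Pi.single 0 1 = ξ.ofLp) :
    euclid m (‖ξ‖ • EuclideanSpace.single 0 1) = ξ := by
  rw [map_smul, euclid_apply, PiLp.ofLp_single, ← WithLp.toLp_smul, hm]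

/-- The components of the action of `N_j` at any `ξ ≠ 0`, by transport to a multiple of `e₁`. -/
theorem fourierN_mem_fibre (hn : 2 ≤ n) (hσ : IsIrredUnitary σ) (hS : IsDifferential σ S)
    {f : E n → V} (hd : ContDiffOn ℝ ∞ f {0}ᶜ) (hf : ∀ ξ, ξ ≠ 0 → f ξ ∈ fibre σ τ ξ) (lam : ℂ)
    (j : Fin n) {ξ : E n} (hξ : ξ ≠ 0) :
    fourierN S lam j f ξ ∈ fibre σ τ ξ ⊔ ⨆ i : Fin ((n - 1) / 2),
      (fibre σ (τ + Pi.single i 1) ξ ⊔ fibre σ (τ - Pi.single i 1) ξ) := by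
  obtain ⟨m, hm⟩ := exists_mulVec_eq hn hξ
  have hs : 0 < ‖ξ‖ := norm_pos_iff.2 hξ
  have h1 := hS.fourierN_transport hd lam m j (single_smul_ne_zero (n := n) hs)
  rw [euclid_smul_single hm] at h1
  have h2 : σ m⁻¹ (fourierN S lam j f ξ) ∈ Wnear σ τ := by
    rw [h1]
    exact sum_mem fun k _ => Submodule.smul_mem _ _ ((hasFibreValues_transport hf
      m).fourierN_mem_Wnear hσ hS (contDiffOn_transport hd m) lam k hs)
  simp only [fibre_eq hξ hm, ← Submodule.map_sup, ← Submodule.map_iSup]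
  refine ⟨_, h2, ?_⟩
  rw [← Module.End.mul_apply, ← map_mul, mul_inv_cancel, map_one, Module.End.one_apply]

/-- The component of the action of `N_j` in a fibre of another highest weight `τ'`, as a multiple of
that of `∂_j`. -/
theorem pr_fourierN (hn : 2 ≤ n) (hσ : IsIrredUnitary σ) (hS : IsDifferential σ S)
    {f : E n → V} (hd : ContDiffOn ℝ ∞ f {0}ᶜ) (hf : ∀ ξ, ξ ≠ 0 → f ξ ∈ fibre σ τ ξ) (lam : ℂ)
    (j : Fin n) {τ' : Fin ((n - 1) / 2) → ℤ} (hτ : τ ≠ τ') {ξ : E n} (hξ : ξ ≠ 0) :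
    pr σ τ' (fourierN S lam j f) ξ =
      (-Complex.I * (2 * lam + (casimirValue τ' - casimirValue τ))) •
        pr σ τ' (partialDeriv j f) ξ := by
  obtain ⟨m, hm⟩ := exists_mulVec_eq hn hξ
  have hs : 0 < ‖ξ‖ := norm_pos_iff.2 hξ
  have hne := single_smul_ne_zero (n := n) hs
  have h1 := hS.fourierN_transport hd lam m j hne
  have h2 := partialDeriv_transport (σ := σ) hd m j hne
  rw [euclid_smul_single hm] at h1 h2
  have hg := hasFibreValues_transport hf m
  rw [pr, pr, starProjection_fibre hσ hξ hm, starProjection_fibre hσ hξ hm, h1, h2, ← map_smul]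
  congr 1
  simp only [map_sum, map_smul, Finset.smul_sum,
    hg.starProjection_fourierN hσ hS (contDiffOn_transport hd m) lam _ hs hτ]
  exact Finset.sum_congr rfl fun k _ => smul_comm _ _ _

end Components
end FPicture

theorem mainTheorem4 (n : ℕ) [NeZero n] (hn : 2 ≤ n)
    {V : Type*} [NormedAddCommGroup V] [InnerProductSpace ℂ V] [FiniteDimensional ℂ V]
    (σ : Representation ℂ (FPicture.SO n) V) (hσ : FPicture.IsIrredUnitary σ) (lam : ℂ)
    (τ : Fin ((n - 1) / 2) → ℤ) (f : FPicture.E n → V) (hf : FPicture.InIhatType σ lam τ f)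
    (j : Fin n) :
    ∃ h : FPicture.E n → V,
      FPicture.IsDerivedAction σ lam (FPicture.N j) f h ∧
      FPicture.InIhat σ lam h ∧
      (∀ ξ : FPicture.E n, ξ ≠ 0 →
        h ξ ∈ FPicture.fibre σ τ ξ ⊔
          ⨆ i : Fin ((n - 1) / 2),
            (FPicture.fibre σ (τ + Pi.single i 1) ξ ⊔ FPicture.fibre σ (τ - Pi.single i 1) ξ)) ∧
      ∀ (i : Fin ((n - 1) / 2)) (ξ : FPicture.E n), ξ ≠ 0 →
        FPicture.pr σ (τ + Pi.single i 1) h ξ =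
          (-Complex.I * (2 * lam + 1 +
              2 * ((τ i : ℂ) + ((n : ℂ) - 2 * ((i : ℕ) + 1 : ℂ) - 1) / 2))) •
            FPicture.pr σ (τ + Pi.single i 1) (FPicture.partialDeriv j f) ξ ∧
        FPicture.pr σ (τ - Pi.single i 1) h ξ =
          (-Complex.I * (2 * lam + 1 -
              2 * ((τ i : ℂ) + ((n : ℂ) - 2 * ((i : ℕ) + 1 : ℂ) - 1) / 2))) •
            FPicture.pr σ (τ - Pi.single i 1) (FPicture.partialDeriv j f) ξ := by
  classical
  obtain ⟨⟨F₀, hF₀, hfF₀⟩, hfib⟩ := hf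
  have hN : FPicture.IsLie (FPicture.N j) := FPicture.nLie_single j ▸ FPicture.isLie_nLie _
  have hne : ∀ (i : Fin ((n - 1) / 2)) (z : ℤ), z ≠ 0 → τ ≠ τ + Pi.single i z := fun i z hz h =>
    hz (by simpa using congrFun h i)
  by_cases hex : ∃ F g₀, FPicture.IsPrincipal σ lam F ∧ g₀ ∈ FPicture.G n ∧ F g₀ ≠ 0
  · obtain ⟨F, g₀, hF, hg₀, h0⟩ := hex
    obtain ⟨S, hS⟩ := hF.exists_isDifferential hσ hg₀ h0
    refine ⟨FPicture.fourierN S lam j f, fun F hF hfF => hF.isFourierImage_dLeft_N hS j hfF,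
      ⟨_, hF₀.dLeft hN, hF₀.isFourierImage_dLeft_N hS j hfF₀⟩,
      fun ξ hξ => FPicture.fourierN_mem_fibre hn hσ hS hfF₀.smooth hfib lam j hξ,
      fun i ξ hξ => ⟨?_, ?_⟩⟩
    · rw [FPicture.pr_fourierN hn hσ hS hfF₀.smooth hfib lam j (hne i 1 one_ne_zero) hξ,
        FPicture.casimirValue_add_single]
      congr 2
      push_cast
      ring
    · rw [sub_eq_add_neg, ← Pi.single_neg, FPicture.pr_fourierN hn hσ hS hfF₀.smooth hfib lam j
        (hne i (-1) (by simp)) hξ, FPicture.casimirValue_add_single]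
      congr 2
      push_cast
      ring
  · -- all functions in the principal series vanish on `G`, hence so do all Fourier images
    push Not at hex
    have hzero : ∀ F, FPicture.IsPrincipal σ lam F → FPicture.nonCompact F = fun _ => 0 :=
      fun F hF => funext fun x => hex F _ hF (FPicture.nbarExp_mem_G x)
    have hf0 : ∀ ξ, ξ ≠ 0 → f ξ = 0 := fun ξ hξ => by
      have := hzero _ hF₀ ▸ hfF₀
      exact this.eq_zero (fun _ => rfl) ξ hξ
    have hd0 : ∀ ξ, ξ ≠ 0 → FPicture.partialDeriv j f ξ = 0 := fun ξ hξ => by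
      have : f =ᶠ[nhds ξ] fun _ => 0 :=
        (isOpen_compl_singleton.eventually_mem hξ).mono fun η hη => hf0 η hη
      simp [FPicture.partialDeriv, this.fderiv_eq]
    have him : ∀ F, FPicture.IsPrincipal σ lam F →
        FPicture.IsFourierImage (FPicture.nonCompact (FPicture.dLeft (FPicture.N j) F))
          fun _ => (0 : V) := fun F hF => by
      rw [hzero _ (hF.dLeft hN)]
      exact FPicture.IsFourierImage.zero
    refine ⟨fun _ => 0, fun F hF _ => him F hF, ⟨_, hF₀.dLeft hN, him F₀ hF₀⟩,
      fun ξ _ => zero_mem _, fun i ξ hξ => ?_⟩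
    simp [FPicture.pr, hd0 ξ hξ]
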